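/- Let $1<R_o<\sqrt2$, let $\Omega=\{x\in\mathbb R^2 : 1<|x|<R_o\}$ and $\mathbf F(x)=\tfrac12(-x_2,x_1)$, the vector potential of the uniform magnetic field $\operatorname{curl}\mathbf F=1$. For $B\in\mathbb R$ let $\mathcal H(B)=(-i\nabla+B\mathbf F)^2$ be the magnetic Neumann operator in $L^2(\Omega)$, with boundary condition $N\cdot(-i\nabla+B\mathbf F)\psi=0$ on $\partial\Omega$; that is, the self-adjoint operator associated with the quadratic form $\psi\mapsto\int_\Omega|(-i\nabla+B\mathbf F)\psi|^2\,dx$ on $\{\psi\in L^2(\Omega) : (-i\nabla+B\mathbf F)\psi\in L^2(\Omega)^2\}=H^1(\Omega)$. Let $\lambda_1(\mathcal H(B))=\inf\operatorname{spec}\mathcal H(B)$. Then the function $B\mapsto\lambda_1(\mathcal H(B))$ is differentiable at $B=1$ and $$\frac{d}{dB}\lambda_1(\mathcal H(B))\Big|_{B=1}<0 .$$ Moreover, there is $\varepsilon>0$ such that $B\mapsto\lambda_1(\mathcal H(B))$ is strictly decreasing on $(1-\varepsilon,1+\varepsilon)$. -/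

import Mathlib

noncomputable section

open MeasureTheory
open scoped ContDiff ComplexInnerProductSpace

namespace MagneticNeumann

/-- The Euclidean plane. -/
abbrev Plane : Type := EuclideanSpace ℝ (Fin 2)

/-- The complex Hilbert space `L²(Ω)` for Lebesgue measure. -/
abbrev L2 (Ω : Set Plane) : Type := Lp ℂ 2 (volume.restrict Ω)

/-- `C_c^∞(Ω)`, complex valued. -/
def IsTestFunction (Ω : Set Plane) (φ : Plane → ℂ) : Prop :=
  ContDiff ℝ ∞ φ ∧ HasCompactSupport φ ∧ tsupport φ ⊆ Ω

/-- The partial derivative `∂φ/∂x_j`. -/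
def partialDeriv (j : Fin 2) (φ : Plane → ℂ) (x : Plane) : ℂ :=
  fderiv ℝ φ x (EuclideanSpace.single j 1)

/-- `(-i∇ + A) u = G` on `Ω` in the sense of distributions, with `u`, `G₀`, `G₁` in `L²(Ω)`.
Thus `∃ G, HasMagneticGradient Ω A u G` says that `u` is in the magnetic Sobolev space
`H¹_A(Ω) = {u ∈ L²(Ω) : (-i∇ + A) u ∈ L²(Ω)²}` (equal to `H¹(Ω)` if `A` is bounded on `Ω`). -/
def HasMagneticGradient (Ω : Set Plane) (A : C(Plane, Plane)) (u : L2 Ω) (G : Fin 2 → L2 Ω) :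
    Prop :=
  ∀ (j : Fin 2) (φ : Plane → ℂ), IsTestFunction Ω φ →
    ∫ x in Ω, u x * (Complex.I * partialDeriv j φ x + (A x j : ℂ) * φ x) =
      ∫ x in Ω, G j x * φ x

theorem IsTestFunction.continuous_partialDeriv {Ω : Set Plane} {φ : Plane → ℂ}
    (h : IsTestFunction Ω φ) (j : Fin 2) : Continuous (partialDeriv j φ) :=
  (h.1.continuous_fderiv (by simp)).clm_apply continuous_const

theorem IsTestFunction.hasCompactSupport_partialDeriv {Ω : Set Plane} {φ : Plane → ℂ}
    (h : IsTestFunction Ω φ) (j : Fin 2) : HasCompactSupport (partialDeriv j φ) :=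
  h.2.1.fderiv_apply (𝕜 := ℝ) (EuclideanSpace.single j 1)

theorem integrable_mul_of_hasCompactSupport {Ω : Set Plane} (u : L2 Ω) {ψ : Plane → ℂ}
    (hc : Continuous ψ) (hs : HasCompactSupport ψ) :
    Integrable (fun x => u x * ψ x) (volume.restrict Ω) :=
  (Lp.memLp u).integrable_mul
    (hc.memLp_of_hasCompactSupport hs : MemLp ψ 2 (volume.restrict Ω))

theorem IsTestFunction.continuous_symbol {Ω : Set Plane} {φ : Plane → ℂ}
    (h : IsTestFunction Ω φ) (A : C(Plane, Plane)) (c : ℂ) (j : Fin 2) :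
    Continuous fun x => c * partialDeriv j φ x + (A x j : ℂ) * φ x := by
  have h1 := h.continuous_partialDeriv j
  have h2 := h.1.continuous
  fun_prop

theorem IsTestFunction.hasCompactSupport_symbol {Ω : Set Plane} {φ : Plane → ℂ}
    (h : IsTestFunction Ω φ) (A : C(Plane, Plane)) (c : ℂ) (j : Fin 2) :
    HasCompactSupport fun x => c * partialDeriv j φ x + (A x j : ℂ) * φ x :=
  ((h.hasCompactSupport_partialDeriv j).mul_left).add h.2.1.mul_left

theorem HasMagneticGradient.add {Ω : Set Plane} {A : C(Plane, Plane)} {u v : L2 Ω}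
    {G H : Fin 2 → L2 Ω} (hu : HasMagneticGradient Ω A u G) (hv : HasMagneticGradient Ω A v H) :
    HasMagneticGradient Ω A (u + v) (G + H) := by
  intro j φ hφ
  have hc := hφ.continuous_symbol A Complex.I j
  have hs := hφ.hasCompactSupport_symbol A Complex.I j
  have e1 : ∀ (a b : L2 Ω) (ψ : Plane → ℂ), Continuous ψ → HasCompactSupport ψ →
      ∫ x in Ω, (a + b : L2 Ω) x * ψ x = (∫ x in Ω, a x * ψ x) + ∫ x in Ω, b x * ψ x := by
    intro a b ψ h1 h2
    rw [← integral_add (integrable_mul_of_hasCompactSupport a h1 h2)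
      (integrable_mul_of_hasCompactSupport b h1 h2)]
    refine integral_congr_ae ?_
    filter_upwards [Lp.coeFn_add a b] with x hx
    rw [hx, Pi.add_apply, add_mul]
  rw [e1 u v _ hc hs, Pi.add_apply, e1 (G j) (H j) _ hφ.1.continuous hφ.2.1, hu j φ hφ, hv j φ hφ]

theorem HasMagneticGradient.smul {Ω : Set Plane} {A : C(Plane, Plane)} {u : L2 Ω}
    {G : Fin 2 → L2 Ω} (c : ℂ) (hu : HasMagneticGradient Ω A u G) :
    HasMagneticGradient Ω A (c • u) (c • G) := by
  intro j φ hφ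
  have e1 : ∀ (a : L2 Ω) (ψ : Plane → ℂ),
      ∫ x in Ω, (c • a : L2 Ω) x * ψ x = c * ∫ x in Ω, a x * ψ x := by
    intro a ψ
    rw [← integral_const_mul]
    refine integral_congr_ae ?_
    filter_upwards [Lp.coeFn_smul c a] with x hx
    rw [hx, Pi.smul_apply, smul_eq_mul, mul_assoc]
  rw [e1, Pi.smul_apply, e1, hu j φ hφ]

theorem HasMagneticGradient.zero {Ω : Set Plane} {A : C(Plane, Plane)} :
    HasMagneticGradient Ω A 0 0 := by
  intro j φ hφ
  have e1 : ∀ ψ : Plane → ℂ, ∫ x in Ω, (0 : L2 Ω) x * ψ x = 0 := by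
    intro ψ
    refine integral_eq_zero_of_ae ?_
    filter_upwards [Lp.coeFn_zero ℂ 2 (volume.restrict Ω)] with x hx
    rw [hx]; simp
  rw [e1, Pi.zero_apply, e1]

/-- The graph of the magnetic Neumann operator `(-i∇ + A)²` in `L²(Ω)`, i.e. of the operator
associated with the form `v, u ↦ ⟪(-i∇ + A) v, (-i∇ + A) u⟫` on `H¹_A(Ω)`: a pair `(u, f)` belongs
to it iff `u ∈ H¹_A(Ω)` and `⟪(-i∇ + A) v, (-i∇ + A) u⟫ = ⟪v, f⟫` for every `v ∈ H¹_A(Ω)`.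
Testing with `v ∈ C_c^∞(Ω)` gives `f = (-i∇ + A)² u`; testing with all `v` adds the
(weak) Neumann condition `N · (-i∇ + A) u = 0` on the boundary. -/
def neumannGraph (Ω : Set Plane) (A : C(Plane, Plane)) : Submodule ℂ (L2 Ω × L2 Ω) where
  carrier := {p | ∃ G : Fin 2 → L2 Ω, HasMagneticGradient Ω A p.1 G ∧
    ∀ (v : L2 Ω) (H : Fin 2 → L2 Ω), HasMagneticGradient Ω A v H →
      ∑ j, ⟪H j, G j⟫ = ⟪v, p.2⟫}
  zero_mem' := ⟨0, HasMagneticGradient.zero, fun v H _ => by simp⟩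
  add_mem' := by
    rintro p q ⟨G, hG, hp⟩ ⟨K, hK, hq⟩
    refine ⟨G + K, hG.add hK, fun v H hv => ?_⟩
    simp only [Pi.add_apply, inner_add_right, Finset.sum_add_distrib, hp v H hv, hq v H hv,
      Prod.snd_add]
  smul_mem' := by
    rintro c p ⟨G, hG, hp⟩
    refine ⟨c • G, hG.smul c, fun v H hv => ?_⟩
    simp only [Pi.smul_apply, inner_smul_right, ← Finset.mul_sum, hp v H hv, Prod.smul_snd]

/-- The magnetic Neumann operator `(-i∇ + A)²` as an unbounded operator in `L²(Ω)`
(for `Ω` open; see `neumannOperator_graph`). -/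
def neumannOperator (Ω : Set Plane) (A : C(Plane, Plane)) : L2 Ω →ₗ.[ℂ] L2 Ω :=
  (neumannGraph Ω A).toLinearPMap

/-- The resolvent set of an unbounded operator: those `z` for which `T - z` is a bijection of the
domain onto the whole space with bounded inverse. -/
def resolventSet {E : Type*} [NormedAddCommGroup E] [NormedSpace ℂ E] (T : E →ₗ.[ℂ] E) : Set ℂ :=
  {z | ∃ S : E →L[ℂ] E,
    (∀ y : E, ∃ h : S y ∈ T.domain, T ⟨S y, h⟩ - z • S y = y) ∧
    ∀ x : T.domain, S (T x - z • (x : E)) = x}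

/-- The spectrum of an unbounded operator. -/
def spec {E : Type*} [NormedAddCommGroup E] [NormedSpace ℂ E] (T : E →ₗ.[ℂ] E) : Set ℂ :=
  (resolventSet T)ᶜ

/-- The lowest point of the (real) spectrum. -/
def lowestSpec {E : Type*} [NormedAddCommGroup E] [NormedSpace ℂ E] (T : E →ₗ.[ℂ] E) : ℝ :=
  sInf {t : ℝ | (t : ℂ) ∈ spec T}

/-- The open annulus with inner radius `Ri` and outer radius `Ro`. -/
def annulus (Ri Ro : ℝ) : Set Plane := {x | Ri < ‖x‖ ∧ ‖x‖ < Ro}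

/-- The vector potential `F(x) = (-x₂, x₁) / 2` of the uniform field `curl F = 1`. -/
def uniformPotential : C(Plane, Plane) where
  toFun x := !₂[-(x 1) / 2, x 0 / 2]
  continuous_toFun := by
    refine (PiLp.continuous_toLp 2 _).comp (continuous_pi fun j => ?_)
    fin_cases j <;> simp <;> fun_prop

/-- `ℋ(B) = (-i∇ + B F)²` with magnetic Neumann boundary condition in the annulus. -/
def annulusOperator (Ri Ro B : ℝ) : L2 (annulus Ri Ro) →ₗ.[ℂ] L2 (annulus Ri Ro) :=
  neumannOperator (annulus Ri Ro) (B • uniformPotential)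

/-- Elements of `C_c^∞(Ω)` lie in `H¹_A(Ω)`, with the classical magnetic gradient. -/
theorem IsTestFunction.hasMagneticGradient {Ω : Set Plane}
    (A : C(Plane, Plane)) {φ : Plane → ℂ} (h : IsTestFunction Ω φ) :
    HasMagneticGradient Ω A
      ((h.1.continuous.memLp_of_hasCompactSupport h.2.1 :
        MemLp φ 2 (volume.restrict Ω)).toLp φ)
      (fun j => (((h.continuous_symbol A (-Complex.I) j).memLp_of_hasCompactSupport
        (h.hasCompactSupport_symbol A (-Complex.I) j) :
        MemLp _ 2 (volume.restrict Ω)).toLp _)) := by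
  intro j ψ hψ
  have e1 : ∀ (a b : Plane → ℂ) (ha : MemLp a 2 (volume.restrict Ω)),
      ∫ x in Ω, (ha.toLp a) x * b x = ∫ x in Ω, a x * b x := by
    intro a b ha
    refine integral_congr_ae ?_
    filter_upwards [ha.coeFn_toLp] with x hx
    rw [hx]
  rw [e1, e1]
  have hφ0 : ∀ x, x ∉ Ω → φ x = 0 := fun x hx =>
    image_eq_zero_of_notMem_tsupport fun h' => hx (h.2.2 h')
  have hψ0 : ∀ x, x ∉ Ω → ψ x = 0 := fun x hx =>
    image_eq_zero_of_notMem_tsupport fun h' => hx (hψ.2.2 h')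
  rw [setIntegral_eq_integral_of_forall_compl_eq_zero (fun x hx => by simp [hφ0 x hx]),
    setIntegral_eq_integral_of_forall_compl_eq_zero (fun x hx => by simp [hψ0 x hx])]
  have cφ := h.1.continuous
  have cψ := hψ.1.continuous
  have dφ := h.continuous_partialDeriv j
  have dψ := hψ.continuous_partialDeriv j
  have i1 : Integrable (fun x => partialDeriv j φ x * ψ x) :=
    (dφ.mul cψ).integrable_of_hasCompactSupport hψ.2.1.mul_left
  have i2 : Integrable (fun x => φ x * partialDeriv j ψ x) :=
    (cφ.mul dψ).integrable_of_hasCompactSupport h.2.1.mul_right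
  have i3 : Integrable (fun x => φ x * ψ x) :=
    (cφ.mul cψ).integrable_of_hasCompactSupport h.2.1.mul_right
  have i4 : Integrable (fun x => (A x j : ℂ) * (φ x * ψ x)) := by
    refine Continuous.integrable_of_hasCompactSupport ?_ h.2.1.mul_right.mul_left
    fun_prop
  have key : ∫ x, φ x * partialDeriv j ψ x = -∫ x, partialDeriv j φ x * ψ x :=
    integral_mul_fderiv_eq_neg_fderiv_mul_of_integrable i1 i2 i3
      (fun x _ => (h.1.differentiable (by simp)) x) (fun x _ => (hψ.1.differentiable (by simp)) x)
  calc ∫ x, φ x * (Complex.I * partialDeriv j ψ x + (A x j : ℂ) * ψ x)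
      = ∫ x, (Complex.I * (φ x * partialDeriv j ψ x) + (A x j : ℂ) * (φ x * ψ x)) := by
        congr 1; ext x; ring
    _ = ∫ x, (-Complex.I * (partialDeriv j φ x * ψ x) + (A x j : ℂ) * (φ x * ψ x)) := by
        rw [integral_add (i2.const_mul _) i4, integral_add (i1.const_mul _) i4,
          integral_const_mul, integral_const_mul, key]
        ring
    _ = _ := by congr 1; ext x; ring

theorem eq_zero_of_forall_test {Ω : Set Plane} (hΩ : IsOpen Ω) (f : L2 Ω)
    (h : ∀ φ : Plane → ℂ, IsTestFunction Ω φ → ∫ x in Ω, f x * φ x = 0) : f = 0 := by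
  have hloc : LocallyIntegrableOn (fun x => f x) Ω (volume.restrict Ω) :=
    ((Lp.memLp f).locallyIntegrable (by norm_num)).locallyIntegrableOn Ω
  have := hΩ.ae_eq_zero_of_integral_contDiff_smul_eq_zero hloc fun g h1 h2 h3 => by
    have := h (fun x => (g x : ℂ)) ⟨Complex.ofRealCLM.contDiff.comp h1,
      h2.comp_left (g := fun t : ℝ => (t : ℂ)) rfl,
      (closure_mono (Function.support_comp_subset (g := fun t : ℝ => (t : ℂ)) rfl g)).trans h3⟩
    rw [← this]
    congr 1; ext x
    rw [Complex.real_smul, mul_comm]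
  rw [Lp.eq_zero_iff_ae_eq_zero]
  filter_upwards [this, ae_restrict_mem hΩ.measurableSet] with x hx hx'
  exact hx hx'

/-- For `Ω` open, `neumannGraph` is single valued, hence is the graph of `neumannOperator`. -/
theorem neumannOperator_graph {Ω : Set Plane} (hΩ : IsOpen Ω) (A : C(Plane, Plane)) :
    (neumannOperator Ω A).graph = neumannGraph Ω A := by
  refine Submodule.toLinearPMap_graph_eq _ ?_
  rintro ⟨u, f⟩ ⟨G, hG, hf⟩ hu
  obtain rfl : u = 0 := hu
  have hG0 : ∀ j, G j = 0 := fun j => eq_zero_of_forall_test hΩ _ fun φ hφ => by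
    rw [← hG j φ hφ, HasMagneticGradient.zero (A := A) j φ hφ]
    refine integral_eq_zero_of_ae ?_
    filter_upwards [Lp.coeFn_zero ℂ 2 (volume.restrict Ω)] with x hx
    rw [Pi.zero_apply, hx]; simp
  refine eq_zero_of_forall_test hΩ f fun φ hφ => ?_
  have hφ' : IsTestFunction Ω (fun x => (starRingEnd ℂ) (φ x)) :=
    ⟨Complex.conjCLE.contDiff.comp hφ.1, hφ.2.1.comp_left (g := starRingEnd ℂ) (map_zero _),
      (closure_mono (Function.support_comp_subset (map_zero (starRingEnd ℂ)) φ)).trans hφ.2.2⟩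
  have := hf _ _ (hφ'.hasMagneticGradient A)
  simp only [hG0, inner_zero_right, Finset.sum_const_zero] at this
  rw [L2.inner_def] at this
  rw [this]
  refine integral_congr_ae ?_
  filter_upwards [MemLp.coeFn_toLp (hφ'.1.continuous.memLp_of_hasCompactSupport hφ'.2.1 :
        MemLp _ 2 (volume.restrict Ω))] with x hx
  rw [hx]
  simp

theorem isOpen_annulus (Ri Ro : ℝ) : IsOpen (annulus Ri Ro) :=
  (isOpen_lt continuous_const continuous_norm).inter (isOpen_lt continuous_norm continuous_const)

end MagneticNeumann

end

/-! At $B=1$ the form splits over the angular modes $u=\sum_m u_m(r)e^{im\theta}$ into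
$2\pi\int_1^{R_o} r\,(|u_m'|^2+(m/r+r/2)^2|u_m|^2)\,dr$. The potential of mode $m$ exceeds that of
mode $-1$ by $(m+1)(m-1+r^2)/r^2$. For $1<r^2<2$ this is positive for every $m\ne-1$, so the ground
state lies in mode $-1$. It is $\psi=f(r)e^{-i\theta}$ with $f>0$, it is simple, and it is separated
by a gap from the rest of the spectrum. By Feynman–Hellmann the derivative of the energy at $B=1$ is
$2\,\mathrm{Re}\langle(-i\nabla+\mathbf F)\psi,\mathbf F\psi\rangle$ for normalised $\psi$. Only the
angular components $(r/2-1/r)f$ and $(r/2)f$ meet in this product, and it equals $4\pi\int_1^{R_o}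
r\,(r^2/4-1/2)f^2\,dr$. This is negative because $r^2<2$.

The argument is variational throughout; neither compact embeddings nor elliptic regularity is used.
(a) The bottom of the spectrum is the infimum of the Rayleigh quotient
(`lowestSpec_eq_rayleighBottom`). Changing $B$ adds a bounded multiplication operator to the
magnetic gradient, so all $\mathcal H(B)$ share the form domain of $B=1$
(`isFormOperator_annulusOperator`). (b) A ground state with a gap gives the derivative by bounds
from above and below with error $O(s^2)$ (`IsGroundState.hasDerivAt_rayleighBottom`). A sign at one
point does not give monotonicity nearby; for that, near-minimisers at one field serve as trial
states at a larger one (`IsGroundState.exists_strictAntiOn_rayleighBottom`). (c) The profile $f$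
comes from $g=rf'/f$, which solves a Riccati equation with $g=0$ at both radii (the Neumann
condition). The energy is found by shooting between $0$ and $1/4$ (`exists_isRiccatiSolution`). (d)
Completing the square with $g$ (`integral_mul_sq_sub_eq`) bounds the radial energies from below,
with a gap uniform in $m$ (`IsRadialGroundState.exists_gap`). (e) Testing the weak gradient with
suitable vector fields gives the radial equations of each Fourier mode, and Parseval's identity adds
up the bounds (`IsRadialGroundState.exists_annulus_gap`). -/

noncomputable section

open MeasureTheory
open scoped ContDiff ComplexInnerProductSpace

namespace MagneticNeumann

/-! ### Operators defined by forms: bottom of the spectrum and Rayleigh quotient -/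

section FormOperator

variable {V E K : Type*} [NormedAddCommGroup V] [InnerProductSpace ℂ V]
  [NormedAddCommGroup E] [InnerProductSpace ℂ E]
  [NormedAddCommGroup K] [InnerProductSpace ℂ K]

/-- The bottom of the Rayleigh quotient `‖N v‖² / ‖J v‖²`. -/
def rayleighBottom (J : V →L[ℂ] E) (N : V →L[ℂ] K) : ℝ :=
  sInf ((fun v => ‖N v‖ ^ 2) '' {v | ‖J v‖ = 1})

/-- `T` is the operator in `E` associated with the form `‖N v‖²` on the form domain `V`, which is
mapped to `E` by `J`. -/
def IsFormOperator (J : V →L[ℂ] E) (N : V →L[ℂ] K) (T : E →ₗ.[ℂ] E) : Prop :=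
  ∀ u f : E, (u, f) ∈ T.graph ↔ ∃ v : V, J v = u ∧ ∀ w : V, ⟪N w, N v⟫ = ⟪J w, f⟫

theorem rayleighBottom_le (J : V →L[ℂ] E) (N : V →L[ℂ] K) {v : V} (hv : ‖J v‖ = 1) :
    rayleighBottom J N ≤ ‖N v‖ ^ 2 :=
  csInf_le ⟨0, by rintro _ ⟨w, -, rfl⟩; positivity⟩ ⟨v, hv, rfl⟩

theorem rayleighBottom_nonneg (J : V →L[ℂ] E) (N : V →L[ℂ] K) : 0 ≤ rayleighBottom J N :=
  Real.sInf_nonneg (by rintro _ ⟨w, -, rfl⟩; positivity)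

theorem le_of_forall_norm_one (J : V →L[ℂ] E) (N : V →L[ℂ] K) {c : ℝ}
    (h : ∀ v, ‖J v‖ = 1 → c ≤ ‖N v‖ ^ 2) (v : V) : c * ‖J v‖ ^ 2 ≤ ‖N v‖ ^ 2 := by
  by_cases h0 : ‖J v‖ = 0
  · simp [h0]
  · have h1 := h (((‖J v‖⁻¹ : ℝ) : ℂ) • v) (by simp [norm_smul, h0])
    rw [map_smul, norm_smul, mul_pow] at h1
    simp only [Complex.norm_real, norm_inv, norm_norm, inv_pow] at h1
    have h2 : 0 < ‖J v‖ ^ 2 := by positivity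
    rwa [inv_mul_eq_div, le_div_iff₀ h2] at h1

theorem rayleighBottom_mul_le (J : V →L[ℂ] E) (N : V →L[ℂ] K) (v : V) :
    rayleighBottom J N * ‖J v‖ ^ 2 ≤ ‖N v‖ ^ 2 :=
  le_of_forall_norm_one J N (fun _ hv => rayleighBottom_le J N hv) v

theorem exists_lt_rayleighBottom_add {J : V →L[ℂ] E} {N : V →L[ℂ] K} (hJ : ∃ v, ‖J v‖ = 1)
    {ε : ℝ} (hε : 0 < ε) : ∃ v, ‖J v‖ = 1 ∧ ‖N v‖ ^ 2 < rayleighBottom J N + ε := by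
  obtain ⟨v, hv⟩ := hJ
  obtain ⟨_, ⟨w, hw, rfl⟩, h⟩ := exists_lt_of_csInf_lt
    (s := (fun v => ‖N v‖ ^ 2) '' {v | ‖J v‖ = 1}) ⟨_, v, hv, rfl⟩
    (lt_add_of_pos_right (rayleighBottom J N) hε)
  exact ⟨w, hw, h⟩

/-- Lax–Milgram: below the Rayleigh bottom the operator $A=N^*N-tJ^*J$ on the form domain is
coercive, hence invertible, and $JA^{-1}J^*$ is the resolvent at $t$. -/
theorem mem_resolventSet_of_lt [CompleteSpace V] [CompleteSpace E] [CompleteSpace K]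
    {J : V →L[ℂ] E} {N : V →L[ℂ] K} {T : E →ₗ.[ℂ] E}
    (hT : IsFormOperator J N T) {c : ℝ} (hc : 0 < c)
    (hco : ∀ v, c * ‖v‖ ^ 2 ≤ ‖N v‖ ^ 2 + ‖J v‖ ^ 2) {t : ℝ} (ht : t < rayleighBottom J N) :
    (t : ℂ) ∈ resolventSet T := by
  set Λ := rayleighBottom J N
  have hΛ : 0 ≤ Λ := rayleighBottom_nonneg J N
  let A : V →L[ℂ] V := N.adjoint ∘L N - (t : ℂ) • (J.adjoint ∘L J)
  have hA : ∀ v w, ⟪w, A v⟫ = ⟪N w, N v⟫ - t * ⟪J w, J v⟫ := fun v w => by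
    simp [A, ContinuousLinearMap.adjoint_inner_right]
  -- The form is a convex combination: the share $1-\theta$ of $\|Nv\|^2$ is bounded below by the
  -- Rayleigh bound, the share $\theta$ by `hco`. This $\theta$ is small enough for the gain
  -- $\Lambda-t$ to pay for the term $\theta\|Jv\|^2$ lost in `hco`.
  set θ : ℝ := (Λ - t) / (Λ + 1 + |t|)
  have hd : 0 < Λ + 1 + |t| := by positivity
  have hθ : 0 < θ := div_pos (by linarith) hd
  have hθe : θ * (Λ + 1 + |t|) = Λ - t := div_mul_cancel₀ _ hd.ne'
  have hθ1 : θ ≤ 1 := by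
    rw [div_le_one hd]; linarith [neg_abs_le t]
  have hcoer : ∀ v, ‖v‖ ^ 2 * (θ * c) ≤ ‖⟪A v, v⟫‖ := fun v => by
    have e : (⟪v, A v⟫ : ℂ) = ((‖N v‖ ^ 2 - t * ‖J v‖ ^ 2 : ℝ) : ℂ) := by
      rw [hA, inner_self_eq_norm_sq_to_K, inner_self_eq_norm_sq_to_K]; simp
    rw [norm_inner_symm, e, Complex.norm_real, Real.norm_eq_abs]
    refine le_trans ?_ (le_abs_self _)
    have h1 := rayleighBottom_mul_le J N v
    have h2 := hco v
    have h3 : (1 - θ) * (Λ * ‖J v‖ ^ 2) ≤ (1 - θ) * ‖N v‖ ^ 2 :=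
      mul_le_mul_of_nonneg_left h1 (by linarith)
    have h4 : θ * ‖J v‖ ^ 2 ≤ ((1 - θ) * Λ - t) * ‖J v‖ ^ 2 := by
      gcongr; nlinarith [abs_nonneg t]
    nlinarith
  have hU : IsUnit A := ContinuousLinearMap.isUnit_of_forall_le_norm_inner_map A
    (c := ⟨θ * c, by positivity⟩) (by exact_mod_cast mul_pos hθ hc) hcoer
  obtain ⟨U, hU⟩ := hU
  have hUl : ∀ v, (↑U⁻¹ : V →L[ℂ] V) (A v) = v := fun v => by
    rw [← hU]; exact DFunLike.congr_fun (U.inv_mul) v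
  have hUr : ∀ v, A ((↑U⁻¹ : V →L[ℂ] V) v) = v := fun v => by
    rw [← hU]; exact DFunLike.congr_fun (U.mul_inv) v
  refine ⟨J ∘L (↑U⁻¹ : V →L[ℂ] V) ∘L J.adjoint, fun f => ?_, fun x => ?_⟩
  · set v := (↑U⁻¹ : V →L[ℂ] V) (J.adjoint f)
    have hg : (J v, f + (t : ℂ) • J v) ∈ T.graph := by
      refine (hT _ _).2 ⟨v, rfl, fun w => ?_⟩
      have := hA v w
      rw [hUr, ContinuousLinearMap.adjoint_inner_right] at this
      rw [inner_add_right, inner_smul_right, this]; ring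
    rw [LinearPMap.mem_graph_iff] at hg
    obtain ⟨y, hy1, hy2⟩ := hg
    simp only at hy1 hy2
    refine ⟨by show J v ∈ T.domain; rw [← hy1]; exact y.2, ?_⟩
    have : (⟨J v, by rw [← hy1]; exact y.2⟩ : T.domain) = y := Subtype.ext hy1.symm
    show T ⟨J v, _⟩ - (t : ℂ) • J v = f
    rw [this, hy2]; simp
  · obtain ⟨v, hv, hw⟩ := (hT _ _).1 (T.mem_graph x)
    have : A v = J.adjoint (T x - (t : ℂ) • (x : E)) := by
      refine ext_inner_left ℂ fun w => ?_
      rw [hA, hw, ContinuousLinearMap.adjoint_inner_right, inner_sub_right, inner_smul_right, hv]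
    simp only [ContinuousLinearMap.comp_apply]
    rw [← this, hUl, hv]

/-- If $S$ inverted $T-\Lambda$, a near-minimiser $v$ would have $Jw=S(sJv)$ for some $w$ in the
form domain. For the nonnegative form $q=\|N\cdot\|^2-\Lambda\|J\cdot\|^2$ this says $q(v,w)=s$ and
$q(w)\le s^2\|S\|$. Then $q(v-w)\ge0$ gives $q(v)\ge 2s-s^2\|S\|\ge s$, against near-minimality. -/
theorem rayleighBottom_notMem_resolventSet {J : V →L[ℂ] E} {N : V →L[ℂ] K} {T : E →ₗ.[ℂ] E}
    (hT : IsFormOperator J N T) (hJ : ∃ v, ‖J v‖ = 1) :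
    ((rayleighBottom J N : ℝ) : ℂ) ∉ resolventSet T := by
  set Λ := rayleighBottom J N with hΛ
  rintro ⟨S, hS, -⟩
  set s : ℝ := 1 / (‖S‖ + 1)
  have hd : 0 < ‖S‖ + 1 := by positivity
  have hs : 0 < s := by positivity
  have hse : s * (‖S‖ + 1) = 1 := by simp only [s]; field_simp
  obtain ⟨v, hv, hlt⟩ := exists_lt_rayleighBottom_add (N := N) hJ hs
  refine absurd hlt (not_lt.2 ?_)
  obtain ⟨hdom, heq⟩ := hS ((s : ℂ) • J v)
  obtain ⟨w, hw, hwx⟩ := (hT _ _).1 (T.mem_graph ⟨_, hdom⟩)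
  rw [sub_eq_iff_eq_add] at heq
  simp only at hw
  rw [heq, ← hw] at hwx
  have h0 := rayleighBottom_mul_le J N (v - w)
  rw [map_sub, map_sub, @norm_sub_sq ℂ, @norm_sub_sq ℂ, hwx v] at h0
  have hww : ‖N w‖ ^ 2 = s * (⟪J w, J v⟫).re + Λ * ‖J w‖ ^ 2 := by
    have := congrArg Complex.re (hwx w)
    rw [inner_add_right, inner_smul_right, inner_smul_right, inner_self_eq_norm_sq_to_K,
      inner_self_eq_norm_sq_to_K] at this
    simpa [← Complex.ofReal_pow] using this
  have hvw : (⟪J v, (s : ℂ) • J v + (Λ : ℂ) • J w⟫).re = s + Λ * (⟪J v, J w⟫).re := by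
    rw [inner_add_right, inner_smul_right, inner_smul_right, inner_self_eq_norm_sq_to_K, hv]
    simp
  have hbd : (⟪J w, J v⟫).re ≤ s * ‖S‖ := by
    refine (Complex.re_le_norm _).trans ((norm_inner_le_norm _ _).trans ?_)
    rw [hv, mul_one, hw]
    refine (S.le_opNorm _).trans ?_
    rw [norm_smul, hv, Complex.norm_real, Real.norm_of_nonneg hs.le]; linarith
  simp only [RCLike.re_to_complex] at h0
  rw [hvw, hww, hv] at h0
  change _ ≤ _
  rw [← hΛ] at h0 ⊢
  have h5 : s * (⟪J w, J v⟫).re ≤ s * (s * ‖S‖) := mul_le_mul_of_nonneg_left hbd hs.le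
  have h6 : s * (s * ‖S‖) ≤ s := by nlinarith
  linarith

/-- The lowest point of the spectrum is the bottom of the Rayleigh quotient. -/
theorem lowestSpec_eq_rayleighBottom [CompleteSpace V] [CompleteSpace E] [CompleteSpace K]
    {J : V →L[ℂ] E} {N : V →L[ℂ] K} {T : E →ₗ.[ℂ] E}
    (hT : IsFormOperator J N T) {c : ℝ} (hc : 0 < c)
    (hco : ∀ v, c * ‖v‖ ^ 2 ≤ ‖N v‖ ^ 2 + ‖J v‖ ^ 2) (hJ : ∃ v, ‖J v‖ = 1) :
    lowestSpec T = rayleighBottom J N := by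
  refine IsLeast.csInf_eq ⟨rayleighBottom_notMem_resolventSet hT hJ, fun t ht => ?_⟩
  by_contra h
  exact ht (mem_resolventSet_of_lt hT hc hco (not_le.1 h))

end FormOperator

/-! ### First order perturbation of an isolated simple lowest eigenvalue -/

section Perturbation

variable {V E K : Type*} [NormedAddCommGroup V] [InnerProductSpace ℂ V]
  [NormedAddCommGroup E] [InnerProductSpace ℂ E]
  [NormedAddCommGroup K] [InnerProductSpace ℂ K]

/-- `v₀` is a normalised ground state of the form `‖N v‖²`, with energy `‖N v₀‖²` separated by a
gap `γ` from the rest of the spectrum. -/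
structure IsGroundState (J : V →L[ℂ] E) (N : V →L[ℂ] K) (v₀ : V) (γ : ℝ) : Prop where
  norm_eq : ‖J v₀‖ = 1
  gap_pos : 0 < γ
  gap_le : ∀ v, ∃ c : ℂ, ‖N v₀‖ ^ 2 * ‖J v‖ ^ 2 + γ * ‖J v - c • J v₀‖ ^ 2 ≤ ‖N v‖ ^ 2

theorem IsGroundState.gap_le_of_orthogonal {J : V →L[ℂ] E} {N : V →L[ℂ] K} {v₀ : V} {γ : ℝ}
    (h : IsGroundState J N v₀ γ) {w : V} (hw : ⟪J v₀, J w⟫ = 0) :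
    (‖N v₀‖ ^ 2 + γ) * ‖J w‖ ^ 2 ≤ ‖N w‖ ^ 2 := by
  obtain ⟨c, hc⟩ := h.gap_le w
  have h1 : ‖J w‖ ^ 2 ≤ ‖J w - c • J v₀‖ ^ 2 := by
    rw [@norm_sub_sq ℂ, inner_smul_right, ← inner_conj_symm, hw]
    simp
  have := mul_le_mul_of_nonneg_left h1 h.gap_pos.le
  linarith

/-- The weak eigenvalue equation for $v_0$: the first variation of the energy at the minimiser
vanishes in directions orthogonal to it. -/
theorem IsGroundState.inner_eq_zero {J : V →L[ℂ] E} {N : V →L[ℂ] K} {v₀ : V} {γ : ℝ}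
    (h : IsGroundState J N v₀ γ) {w : V} (hw : ⟪J v₀, J w⟫ = 0) : ⟪N v₀, N w⟫ = 0 := by
  set z : ℂ := ⟪N v₀, N w⟫ with hz
  have key : ∀ t : ℂ, 0 ≤ 2 * (t * z).re + ‖t‖ ^ 2 * ‖N w‖ ^ 2 := fun t => by
    obtain ⟨c, hc⟩ := h.gap_le (v₀ + t • w)
    have h2 : 0 ≤ γ * ‖J (v₀ + t • w) - c • J v₀‖ ^ 2 := mul_nonneg h.gap_pos.le (sq_nonneg _)
    have h3 : ‖J (v₀ + t • w)‖ ^ 2 = 1 + ‖t‖ ^ 2 * ‖J w‖ ^ 2 := by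
      rw [map_add, map_smul, @norm_add_sq ℂ, inner_smul_right, hw, h.norm_eq, norm_smul]
      simp [mul_pow]
    have h4 : ‖N (v₀ + t • w)‖ ^ 2 = ‖N v₀‖ ^ 2 + 2 * (t * z).re + ‖t‖ ^ 2 * ‖N w‖ ^ 2 := by
      rw [map_add, map_smul, @norm_add_sq ℂ, inner_smul_right, ← hz, norm_smul, mul_pow]
      rfl
    rw [h3, h4] at hc
    have h5 : 0 ≤ ‖N v₀‖ ^ 2 * (‖t‖ ^ 2 * ‖J w‖ ^ 2) := by positivity
    linarith
  set s : ℝ := 1 / (‖N w‖ ^ 2 + 1)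
  have hd : 0 < ‖N w‖ ^ 2 + 1 := by positivity
  have hs : 0 < s := by positivity
  have hse : s * (‖N w‖ ^ 2 + 1) = 1 := by simp only [s]; field_simp
  -- This multiple of $\bar z$ makes the linear term equal to $-2s|z|^2$, and $s$ is small enough
  -- for it to beat the quadratic term unless $z=0$.
  have h1 := key (-(s : ℂ) * (starRingEnd ℂ) z)
  have e1 : (-(s : ℂ) * (starRingEnd ℂ) z * z).re = -s * ‖z‖ ^ 2 := by
    rw [mul_assoc, mul_comm ((starRingEnd ℂ) z), Complex.mul_conj, Complex.normSq_eq_norm_sq,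
      ← Complex.ofReal_neg, ← Complex.ofReal_mul, Complex.ofReal_re]
  rw [e1, norm_mul, norm_neg, Complex.norm_real, Real.norm_of_nonneg hs.le, RCLike.norm_conj,
    mul_pow] at h1
  have h6 : ‖z‖ ^ 2 * s ≤ 0 := by
    have : s ^ 2 * ‖z‖ ^ 2 * ‖N w‖ ^ 2 = s * ‖z‖ ^ 2 * (1 - s) := by
      rw [← hse]; ring
    nlinarith [mul_nonneg (mul_nonneg hs.le hs.le) (sq_nonneg ‖z‖)]
  have h7 : ‖z‖ ^ 2 = 0 := by
    by_contra hne
    have : 0 < ‖z‖ ^ 2 := lt_of_le_of_ne (sq_nonneg _) (Ne.symm hne)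
    nlinarith
  exact norm_eq_zero.1 (pow_eq_zero_iff (two_ne_zero)|>.1 h7)

/-- The energy excess of a normalised vector controls the first order variation of the energy. -/
theorem IsGroundState.exists_estimate {J : V →L[ℂ] E} {N P : V →L[ℂ] K} {v₀ : V} {γ : ℝ}
    (h : IsGroundState J N v₀ γ) {m : ℝ} (hm : 0 ≤ m) (hP : ∀ v, ‖P v‖ ≤ m * ‖J v‖) :
    ∃ κ C : ℝ, 0 < κ ∧ 0 ≤ C ∧ ∀ v, ‖J v‖ = 1 → ∃ n : ℝ, 0 ≤ n ∧
      ‖N v₀‖ ^ 2 + κ * n ^ 2 ≤ ‖N v‖ ^ 2 ∧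
      |2 * (⟪N v, P v⟫).re - 2 * (⟪N v₀, P v₀⟫).re| ≤ C * (n + n ^ 2) := by
  set l := ‖N v₀‖
  set b := (⟪N v₀, P v₀⟫).re
  have hγ := h.gap_pos
  have hl : 0 ≤ l := norm_nonneg _
  -- Chosen so that $(1-\kappa)(l^2+\gamma)-l^2=\kappa$: a share $1-\kappa$ of $\|Nw\|^2$ then pays
  -- for $l^2\|Jw\|^2$ and leaves $\kappa\|Jw\|^2$, and the other share gives $\kappa\|Nw\|^2$.
  set κ := γ / (γ + l ^ 2 + 1)
  have hd : 0 < γ + l ^ 2 + 1 := by positivity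
  have hκ : 0 < κ := by positivity
  have hκe : κ * (γ + l ^ 2 + 1) = γ := by simp only [κ]; field_simp
  have hκ1 : κ ≤ 1 := by rw [div_le_one hd]; nlinarith
  refine ⟨κ, 2 * |b| + 2 * m * (l + 1), hκ, by positivity, fun v hv => ?_⟩
  set a : ℂ := ⟪J v₀, J v⟫
  set w : V := v - a • v₀
  have hvw : v = a • v₀ + w := by simp [w]
  have hJw : J w = J v - a • J v₀ := by simp [w]
  have hw : ⟪J v₀, J w⟫ = 0 := by
    rw [hJw, inner_sub_right, inner_smul_right, inner_self_eq_norm_sq_to_K, h.norm_eq]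
    simp [a]
  have hNw := h.inner_eq_zero hw
  have hgap := h.gap_le_of_orthogonal hw
  have hsum : ‖a‖ ^ 2 + ‖J w‖ ^ 2 = 1 := by
    have : ‖J v‖ ^ 2 = ‖a‖ ^ 2 + ‖J w‖ ^ 2 := by
      conv_lhs => rw [hvw]
      rw [map_add, map_smul, @norm_add_sq ℂ, inner_smul_left, hw, norm_smul, h.norm_eq]
      simp
    rw [← this, hv, one_pow]
  have hNv : ‖N v‖ ^ 2 = ‖a‖ ^ 2 * l ^ 2 + ‖N w‖ ^ 2 := by
    conv_lhs => rw [hvw]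
    rw [map_add, map_smul, @norm_add_sq ℂ, inner_smul_left, hNw, norm_smul]
    simp [mul_pow, l]
  have ha1 : ‖a‖ ≤ 1 := by nlinarith [sq_nonneg ‖J w‖, norm_nonneg a]
  have hsq : Real.sqrt (‖J w‖ ^ 2 + ‖N w‖ ^ 2) ^ 2 = ‖J w‖ ^ 2 + ‖N w‖ ^ 2 :=
    Real.sq_sqrt (by positivity)
  have hnx : ‖J w‖ ≤ Real.sqrt (‖J w‖ ^ 2 + ‖N w‖ ^ 2) := Real.le_sqrt_of_sq_le (by
    nlinarith [sq_nonneg ‖N w‖])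
  have hny : ‖N w‖ ≤ Real.sqrt (‖J w‖ ^ 2 + ‖N w‖ ^ 2) := Real.le_sqrt_of_sq_le (by
    nlinarith [sq_nonneg ‖J w‖])
  -- The excess $n$ is the graph norm of the component $w$ of $v$ orthogonal to the ground state. It
  -- bounds $\|Nw\|$ and, through `hP`, also $\|Pw\|$, so the terms mixing $v_0$ and $w$ are linear
  -- in $n$ and the remaining ones quadratic.
  set n := Real.sqrt (‖J w‖ ^ 2 + ‖N w‖ ^ 2)
  have hn : 0 ≤ n := Real.sqrt_nonneg _
  refine ⟨n, hn, ?_, ?_⟩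
  · have h3 : (1 - κ) * ((l ^ 2 + γ) * ‖J w‖ ^ 2) ≤ (1 - κ) * ‖N w‖ ^ 2 :=
      mul_le_mul_of_nonneg_left hgap (by linarith)
    have h4 : κ * ‖J w‖ ^ 2 = ((1 - κ) * (l ^ 2 + γ) - l ^ 2) * ‖J w‖ ^ 2 := by
      congr 1; linarith
    rw [hNv, hsq]
    have : ‖a‖ ^ 2 = 1 - ‖J w‖ ^ 2 := by linarith
    rw [this]; nlinarith
  · have e1 : (⟪N v, P v⟫).re = ‖a‖ ^ 2 * b +
        ((starRingEnd ℂ) a * ⟪N v₀, P w⟫ + a * ⟪N w, P v₀⟫ + ⟪N w, P w⟫).re := by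
      have : ⟪N v, P v⟫ = ((‖a‖ ^ 2 : ℝ) : ℂ) * ⟪N v₀, P v₀⟫ +
          ((starRingEnd ℂ) a * ⟪N v₀, P w⟫ + a * ⟪N w, P v₀⟫ + ⟪N w, P w⟫) := by
        conv_lhs => rw [hvw]
        rw [map_add, map_add, map_smul, map_smul, inner_add_left, inner_add_right, inner_add_right,
          inner_smul_left, inner_smul_left, inner_smul_right, inner_smul_right,
          ← Complex.normSq_eq_norm_sq, Complex.normSq_eq_conj_mul_self]
        ring
      rw [this, Complex.add_re, Complex.re_ofReal_mul]
    have b1 : ‖(starRingEnd ℂ) a * ⟪N v₀, P w⟫‖ ≤ l * (m * n) := by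
      rw [norm_mul, RCLike.norm_conj]
      calc ‖a‖ * ‖⟪N v₀, P w⟫‖ ≤ 1 * (l * (m * n)) := by
            gcongr
            exact (norm_inner_le_norm _ _).trans
              (mul_le_mul_of_nonneg_left ((hP w).trans (by gcongr)) hl)
        _ = _ := one_mul _
    have b2 : ‖a * ⟪N w, P v₀⟫‖ ≤ n * m := by
      rw [norm_mul]
      calc ‖a‖ * ‖⟪N w, P v₀⟫‖ ≤ 1 * (n * m) := by
            gcongr
            refine (norm_inner_le_norm _ _).trans ?_
            have := hP v₀
            rw [h.norm_eq, mul_one] at this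
            gcongr
        _ = _ := one_mul _
    have b3 : ‖⟪N w, P w⟫‖ ≤ n * (m * n) :=
      (norm_inner_le_norm _ _).trans (mul_le_mul hny ((hP w).trans (by gcongr))
        (norm_nonneg _) hn)
    have b4 := (Complex.abs_re_le_norm _).trans
      ((norm_add₃_le (a := (starRingEnd ℂ) a * ⟪N v₀, P w⟫) (b := a * ⟪N w, P v₀⟫)
        (c := ⟪N w, P w⟫)).trans (add_le_add (add_le_add b1 b2) b3))
    set e := ((starRingEnd ℂ) a * ⟪N v₀, P w⟫ + a * ⟪N w, P v₀⟫ + ⟪N w, P w⟫).re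
    have e2 : 2 * (⟪N v, P v⟫).re - 2 * b = -(2 * ‖J w‖ ^ 2 * b) + 2 * e := by
      rw [e1]
      have : ‖a‖ ^ 2 = 1 - ‖J w‖ ^ 2 := by linarith
      rw [this]; ring
    rw [e2]
    refine (abs_add_le _ _).trans ?_
    rw [abs_neg, abs_mul, abs_mul 2 e, abs_mul 2, abs_of_nonneg (sq_nonneg ‖J w‖)]
    simp only [abs_two]
    have hx2 : ‖J w‖ ^ 2 ≤ n ^ 2 := by gcongr
    have h8 : 2 * ‖J w‖ ^ 2 * |b| ≤ 2 * n ^ 2 * |b| := by gcongr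
    have h9 : 0 ≤ m * l * n ^ 2 := by positivity
    have h10 : 0 ≤ |b| * n := by positivity
    have h11 : 0 ≤ m * n := by positivity
    nlinarith

section

variable {J : V →L[ℂ] E} {N P : V →L[ℂ] K} {v₀ : V} {γ : ℝ}

theorem norm_add_smul_sq (N P : V →L[ℂ] K) (h : ℝ) (v : V) :
    ‖(N + (h : ℂ) • P) v‖ ^ 2 =
      ‖N v‖ ^ 2 + h * (2 * (⟪N v, P v⟫).re) + h ^ 2 * ‖P v‖ ^ 2 := by
  rw [add_apply, smul_apply, @norm_add_sq ℂ,
    inner_smul_right, norm_smul, mul_pow, Complex.norm_real, Real.norm_eq_abs, sq_abs]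
  simp only [RCLike.re_to_complex, Complex.re_ofReal_mul]
  ring

theorem IsGroundState.rayleighBottom_add_smul_le (h : IsGroundState J N v₀ γ) {m : ℝ}
    (hP : ∀ v, ‖P v‖ ≤ m * ‖J v‖) (s : ℝ) :
    rayleighBottom J (N + (s : ℂ) • P) ≤
      ‖N v₀‖ ^ 2 + s * (2 * (⟪N v₀, P v₀⟫).re) + m ^ 2 * s ^ 2 := by
  refine (rayleighBottom_le J _ h.norm_eq).trans ?_
  rw [norm_add_smul_sq]
  have := hP v₀
  rw [h.norm_eq, mul_one] at this
  have : s ^ 2 * ‖P v₀‖ ^ 2 ≤ s ^ 2 * m ^ 2 := by gcongr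
  linarith

/-- Lower bound for the perturbed energy, with the excess of the unperturbed energy. -/
theorem IsGroundState.exists_perturbed_estimate (h : IsGroundState J N v₀ γ) {m : ℝ} (hm : 0 ≤ m)
    (hP : ∀ v, ‖P v‖ ≤ m * ‖J v‖) :
    ∃ κ C ρ : ℝ, 0 < κ ∧ 0 ≤ C ∧ 0 < ρ ∧ ∀ s : ℝ, |s| ≤ ρ → ∀ v, ‖J v‖ = 1 → ∃ n : ℝ, 0 ≤ n ∧
      ‖N v₀‖ ^ 2 + s * (2 * (⟪N v₀, P v₀⟫).re) + κ * n ^ 2 - C * s ^ 2 ≤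
        ‖(N + (s : ℂ) • P) v‖ ^ 2 ∧
      2 * (⟪N v, P v⟫).re ≤ 2 * (⟪N v₀, P v₀⟫).re + C * (n + n ^ 2) := by
  obtain ⟨κ, C, hκ, hC, H⟩ := h.exists_estimate hm hP
  -- The first order error is at most $|s|C(n+n^2)$. For $|s|\le\rho$ its quadratic part is at most
  -- $\frac\kappa4n^2$; by Young's inequality its linear part is at most
  -- $\frac\kappa4n^2+\frac{C^2}\kappa s^2$. Half of $\kappa n^2$ survives.
  refine ⟨κ / 2, C ^ 2 / κ + C, κ / (4 * (C + 1)), by positivity, by positivity, by positivity,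
    fun s hs v hv => ?_⟩
  obtain ⟨n, hn, h1, h2⟩ := H v hv
  refine ⟨n, hn, ?_, ?_⟩
  · rw [norm_add_smul_sq]
    set b := 2 * (⟪N v₀, P v₀⟫).re
    set b' := 2 * (⟪N v, P v⟫).re
    have h3 : -(|s| * (C * (n + n ^ 2))) ≤ s * (b' - b) := by
      have : |s * (b' - b)| ≤ |s| * (C * (n + n ^ 2)) := by
        rw [abs_mul]; gcongr
      linarith [neg_abs_le (s * (b' - b))]
    have h4 : |s| * C ≤ κ / 4 := by
      have : |s| * (4 * (C + 1)) ≤ κ := (le_div_iff₀ (by positivity)).1 hs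
      nlinarith [abs_nonneg s]
    have h5 : |s| * C * n ≤ κ / 4 * n ^ 2 + C ^ 2 / κ * s ^ 2 := by
      have : 0 ≤ κ * (n / 2 - |s| * C / κ) ^ 2 := by positivity
      have e : κ * (n / 2 - |s| * C / κ) ^ 2 =
          κ / 4 * n ^ 2 + C ^ 2 / κ * |s| ^ 2 - |s| * C * n := by field_simp; ring
      rw [sq_abs] at e
      linarith
    have h6 : |s| * C * n ^ 2 ≤ κ / 4 * n ^ 2 := by gcongr
    have h7 : 0 ≤ s ^ 2 * ‖P v‖ ^ 2 := by positivity
    have h8 : 0 ≤ C * s ^ 2 := by positivity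
    linarith
  · have := (le_abs_self _).trans h2
    have h9 : 0 ≤ C ^ 2 / κ * (n + n ^ 2) := by positivity
    linarith

/-- First order perturbation theory for the lowest eigenvalue. -/
theorem IsGroundState.hasDerivAt_rayleighBottom (h : IsGroundState J N v₀ γ) {m : ℝ} (hm : 0 ≤ m)
    (hP : ∀ v, ‖P v‖ ≤ m * ‖J v‖) :
    HasDerivAt (fun s : ℝ => rayleighBottom J (N + (s : ℂ) • P)) (2 * (⟪N v₀, P v₀⟫).re) 0 := by
  obtain ⟨κ, C, ρ, hκ, hC, hρ, H⟩ := h.exists_perturbed_estimate hm hP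
  set b := 2 * (⟪N v₀, P v₀⟫).re
  have upper : ∀ s : ℝ, rayleighBottom J (N + (s : ℂ) • P) ≤ ‖N v₀‖ ^ 2 + s * b + m ^ 2 * s ^ 2 :=
    h.rayleighBottom_add_smul_le hP
  have lower : ∀ s : ℝ, |s| ≤ ρ →
      ‖N v₀‖ ^ 2 + s * b - C * s ^ 2 ≤ rayleighBottom J (N + (s : ℂ) • P) := fun s hs => by
    refine le_csInf ⟨_, v₀, h.norm_eq, rfl⟩ ?_
    rintro _ ⟨v, hv, rfl⟩
    obtain ⟨n, -, h1, -⟩ := H s hs v hv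
    have : 0 ≤ κ * n ^ 2 := by positivity
    simp only
    linarith
  have at0 : rayleighBottom J (N + ((0 : ℝ) : ℂ) • P) = ‖N v₀‖ ^ 2 := by
    have h1 := upper 0
    have h2 := lower 0 (by simpa using hρ.le)
    simp only [zero_mul, add_zero, ne_eq, OfNat.ofNat_ne_zero, not_false_eq_true, zero_pow,
      mul_zero, sub_zero] at h1 h2
    exact le_antisymm h1 h2
  rw [hasDerivAt_iff_isLittleO_nhds_zero]
  -- The trial state $v_0$ bounds the energy from above, the perturbed estimate from below; both
  -- bounds are $\|Nv_0\|^2+sb+O(s^2)$.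
  have hO : (fun s : ℝ => rayleighBottom J (N + ((0 + s : ℝ) : ℂ) • P) -
      rayleighBottom J (N + ((0 : ℝ) : ℂ) • P) - s • b) =O[nhds 0] fun s : ℝ => s ^ 2 := by
    refine Asymptotics.IsBigO.of_bound (m ^ 2 + C) ?_
    filter_upwards [Metric.closedBall_mem_nhds (0 : ℝ) hρ] with s hs
    have hs' : |s| ≤ ρ := by simpa using hs
    have h1 := upper s
    have h2 := lower s hs'
    rw [zero_add, at0, smul_eq_mul, Real.norm_eq_abs, Real.norm_eq_abs, abs_le,
      abs_of_nonneg (sq_nonneg s)]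
    have h3 : 0 ≤ m ^ 2 * s ^ 2 := by positivity
    have h4 : 0 ≤ C * s ^ 2 := by positivity
    constructor <;> linarith
  refine hO.trans_isLittleO ?_
  exact Asymptotics.isLittleO_pow_id (by norm_num)

/-- For $s<t$ close to $0$, a near-minimiser $v$ at $s$ has small excess $n$, so the slope
$2\,\mathrm{Re}\langle Nv,Pv\rangle$ of its own energy stays close to the negative number
$2\,\mathrm{Re}\langle Nv_0,Pv_0\rangle=-\beta$. As a trial state at $t$ it therefore lies strictly
below the bottom at $s$. -/
theorem IsGroundState.exists_strictAntiOn_rayleighBottom (h : IsGroundState J N v₀ γ) {m : ℝ}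
    (hm : 0 ≤ m) (hP : ∀ v, ‖P v‖ ≤ m * ‖J v‖) (hb : (⟪N v₀, P v₀⟫).re < 0) :
    ∃ ε : ℝ, 0 < ε ∧
      StrictAntiOn (fun s : ℝ => rayleighBottom J (N + (s : ℂ) • P)) (Set.Ioo (-ε) ε) := by
  obtain ⟨κ, C, ρ, hκ, hC, hρ, H⟩ := h.exists_perturbed_estimate hm hP
  have upper : ∀ s : ℝ, rayleighBottom J (N + (s : ℂ) • P) ≤
      ‖N v₀‖ ^ 2 + s * (2 * (⟪N v₀, P v₀⟫).re) + m ^ 2 * s ^ 2 :=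
    h.rayleighBottom_add_smul_le hP
  obtain ⟨β, hβ, hbe⟩ : ∃ β : ℝ, 0 < β ∧ 2 * (⟪N v₀, P v₀⟫).re = -β :=
    ⟨-(2 * (⟪N v₀, P v₀⟫).re), by linarith, by ring⟩
  rw [hbe] at H upper
  -- a bound for the excess `n` which makes the first order term dominate
  obtain ⟨τ, hτ, hτ1, hτC⟩ : ∃ τ : ℝ, 0 < τ ∧ τ ≤ 1 ∧ C * (2 * τ) ≤ β / 4 := by
    refine ⟨min 1 (β / (8 * (C + 1))), by positivity, min_le_left _ _, ?_⟩
    have h1 : min 1 (β / (8 * (C + 1))) * (8 * (C + 1)) ≤ β :=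
      (le_div_iff₀ (by positivity)).1 (min_le_right _ _)
    have h0 : 0 ≤ min 1 (β / (8 * (C + 1))) := by positivity
    nlinarith
  obtain ⟨ε, hε, hερ, hε1, hεC, hεm⟩ : ∃ ε : ℝ, 0 < ε ∧ ε ≤ ρ ∧ ε ≤ 1 ∧
      (C + m ^ 2) * ε ≤ κ * τ ^ 2 / 2 ∧ m ^ 2 * (8 * ε) ≤ β / 4 := by
    set ε := min (min ρ 1) (min (κ * τ ^ 2 / (2 * (C + m ^ 2 + 1))) (β / (32 * (m ^ 2 + 1))))
    have hε : 0 < ε := by positivity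
    have h1 : ε * (2 * (C + m ^ 2 + 1)) ≤ κ * τ ^ 2 := (le_div_iff₀ (by positivity)).1
      ((min_le_right _ _).trans (min_le_left _ _))
    have h2 : ε * (32 * (m ^ 2 + 1)) ≤ β := (le_div_iff₀ (by positivity)).1
      ((min_le_right _ _).trans (min_le_right _ _))
    refine ⟨ε, hε, (min_le_left _ _).trans (min_le_left _ _),
      (min_le_left _ _).trans (min_le_right _ _), ?_, ?_⟩ <;> linarith
  refine ⟨ε, hε, fun s hs t ht hst => ?_⟩
  simp only
  have hs' : |s| ≤ ε := abs_le.2 ⟨hs.1.le, hs.2.le⟩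
  set d := t - s with hd
  have hd0 : 0 < d := sub_pos.2 hst
  have hd2 : d ≤ 2 * ε := by linarith [hs.1, ht.2]
  -- The first entry keeps the excess $n$ below $\tau$. The second is a fraction of the decrease:
  -- between $s$ and $t$ the energy of $v$ falls by at least $\frac34d\beta-\frac14d\beta$, which
  -- exceeds $\eta\le\frac18d\beta$.
  set η := min (κ * τ ^ 2 / 2) (d * β / 8)
  obtain ⟨v, hv, hlt⟩ := exists_lt_rayleighBottom_add (J := J) (N := N + (s : ℂ) • P)
    ⟨v₀, h.norm_eq⟩ (show 0 < η by positivity)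
  obtain ⟨n, hn, h1, h2⟩ := H s (hs'.trans hερ) v hv
  have hss : s ^ 2 ≤ ε := by rw [← sq_abs]; nlinarith [abs_nonneg s]
  have hnτ : n ≤ τ := by
    have h3 := upper s
    have h4 : η ≤ κ * τ ^ 2 / 2 := min_le_left _ _
    have h5 : (C + m ^ 2) * s ^ 2 ≤ (C + m ^ 2) * ε := by gcongr
    have h6 : κ * n ^ 2 ≤ κ * τ ^ 2 := by linarith
    exact (sq_le_sq₀ hn hτ.le).1 (le_of_mul_le_mul_left h6 hκ)
  have hPv : ‖P v‖ ^ 2 ≤ m ^ 2 := by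
    have := hP v
    rw [hv, mul_one] at this
    gcongr
  have h7 : 2 * (⟪N v, P v⟫).re ≤ -(3 * β / 4) := by
    have : C * (n + n ^ 2) ≤ C * (2 * τ) := by
      gcongr; nlinarith
    linarith
  have hle := rayleighBottom_le J (N + (t : ℂ) • P) hv
  rw [norm_add_smul_sq] at hle hlt
  have e : t = s + d := by simp [d]
  have h8 : η ≤ d * β / 8 := min_le_right _ _
  have h9 : d * (2 * (⟪N v, P v⟫).re) ≤ d * (-(3 * β / 4)) := by gcongr
  have h10 : (t ^ 2 - s ^ 2) * ‖P v‖ ^ 2 ≤ d * (β / 4) := by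
    have : t ^ 2 - s ^ 2 = d * (t + s) := by rw [hd]; ring
    rw [this, mul_assoc]
    gcongr
    calc (t + s) * ‖P v‖ ^ 2 ≤ (2 * ε) * m ^ 2 := by
          gcongr; linarith [hs.2, ht.2]
      _ ≤ β / 4 := by nlinarith [mul_nonneg (sq_nonneg m) hε.le]
  have h11 : t * (2 * (⟪N v, P v⟫).re) =
      s * (2 * (⟪N v, P v⟫).re) + d * (2 * (⟪N v, P v⟫).re) := by rw [hd]; ring
  have h12 : 0 < d * β := by positivity
  linarith

end

end Perturbation

/-! ### The radial ground state by shooting in the Riccati equation -/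

section Riccati

open Set

/-- The Riccati equation for `g = r f' / f`, where `f` is a radial profile of angular momentum `-1`
and energy `l` in the unit magnetic field. -/
def IsRiccatiSolution (R l : ℝ) (g : ℝ → ℝ) : Prop :=
  ∀ r ∈ Icc 1 R,
    HasDerivWithinAt g (r * ((r / 2 - 1 / r) ^ 2 - l) - g r ^ 2 / r) (Icc 1 R) r

/-- Recovers the profile from its logarithmic derivative as $f=\exp\int_1^r g(s)/s\,ds$. Extending
$g/r$ by constants beyond $[1,R]$ makes $f$ positive and differentiable on the whole line. -/
theorem exists_exp_integral {R : ℝ} (hR : 1 ≤ R) {g : ℝ → ℝ} (hg : ContinuousOn g (Icc 1 R)) :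
    ∃ f φ : ℝ → ℝ, Continuous φ ∧ (∀ r, 0 < f r) ∧ (∀ r, HasDerivAt f (φ r * f r) r) ∧
      ∀ r ∈ Icc 1 R, φ r = g r / r := by
  have hc : ContinuousOn (fun r => g r / r) (Icc 1 R) :=
    hg.div continuousOn_id fun r hr => by linarith [hr.1]
  set φ : ℝ → ℝ := IccExtend hR ((Icc 1 R).domRestrict fun r => g r / r)
  have hφ : Continuous φ := (continuousOn_iff_continuous_domRestrict.1 hc).Icc_extend'
  refine ⟨fun r => Real.exp (∫ s in (1 : ℝ)..r, φ s), φ, hφ, fun r => Real.exp_pos _,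
    fun r => ?_, fun r hr => ?_⟩
  · have := (hφ.integral_hasStrictDerivAt 1 r).hasDerivAt.exp
    rwa [mul_comm] at this
  · simp only [φ]
    rw [IccExtend_of_mem _ _ hr, domRestrict_apply]

/-- Since $fg=rf'$, this is the linear radial equation $(rf')'=r\,((r/2-1/r)^2-l)f$ in divergence
form. -/
theorem IsRiccatiSolution.hasDerivAt_mul {R l : ℝ} {g f φ : ℝ → ℝ} (hg : IsRiccatiSolution R l g)
    (hf : ∀ r, HasDerivAt f (φ r * f r) r) (hφ : ∀ r ∈ Icc 1 R, φ r = g r / r) {r : ℝ}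
    (hr : r ∈ Ioo 1 R) :
    HasDerivAt (fun r => f r * g r) (f r * (r * ((r / 2 - 1 / r) ^ 2 - l))) r := by
  have h1 := (hg r (Ioo_subset_Icc_self hr)).hasDerivAt (Icc_mem_nhds hr.1 hr.2)
  have h2 := (hf r).mul h1
  rw [hφ r (Ioo_subset_Icc_self hr)] at h2
  convert! h2 using 1
  have : r ≠ 0 := by linarith [hr.1]
  field_simp
  ring

/-- The function $r/2-1/r$ increases from $-1/2$ at $r=1$ to $0$ at $r=\sqrt2$. The value $1/4$ is
the upper end of the shooting interval for the energy. -/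
theorem radialPotential_le {r : ℝ} (h1 : 1 ≤ r) (h2 : r ^ 2 ≤ 2) : (r / 2 - 1 / r) ^ 2 ≤ 1 / 4 := by
  have h0 : 0 < r := by linarith
  have h3 : r / 2 - 1 / r ≤ 1 / 2 := by
    rw [div_sub_div _ _ two_ne_zero h0.ne', div_le_div_iff₀ (by positivity) two_pos]; nlinarith
  have h4 : -(1 / 2) ≤ r / 2 - 1 / r := by
    have : 1 / r ≤ 1 := by rw [div_le_one h0]; exact h1
    linarith
  nlinarith

theorem sq_le_two_of_le {r R : ℝ} (h1 : 1 ≤ r) (hR : R < Real.sqrt 2) (hr : r ≤ R) : r ^ 2 ≤ 2 := by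
  have := Real.sq_sqrt (show (0 : ℝ) ≤ 2 by norm_num)
  nlinarith [Real.sqrt_nonneg 2]

/-- At energy $0$ the flux $rf'=fg$ is nondecreasing and starts from $0$. -/
theorem IsRiccatiSolution.nonneg_of_zero {R : ℝ} (hR : 1 ≤ R) {g : ℝ → ℝ}
    (hg : IsRiccatiSolution R 0 g) (h1 : g 1 = 0) : 0 ≤ g R := by
  have hgc : ContinuousOn g (Icc 1 R) := fun r hr => (hg r hr).continuousWithinAt
  obtain ⟨f, φ, -, hpos, hf, hφ⟩ := exists_exp_integral hR hgc
  have hmono : MonotoneOn (fun r => f r * g r) (Icc 1 R) := by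
    refine monotoneOn_of_deriv_nonneg (convex_Icc _ _)
      ((continuous_iff_continuousAt.2 fun r => (hf r).continuousAt).continuousOn.mul hgc) ?_ ?_
    · rw [interior_Icc]
      exact fun r hr => (hg.hasDerivAt_mul hf hφ hr).differentiableAt.differentiableWithinAt
    · rw [interior_Icc]
      intro r hr
      rw [(hg.hasDerivAt_mul hf hφ hr).deriv]
      have := hpos r
      have : 0 < r := by linarith [hr.1]
      rw [sub_zero]; positivity
  have := hmono (left_mem_Icc.2 hR) (right_mem_Icc.2 hR) hR
  simp only [h1, mul_zero] at this
  exact nonneg_of_mul_nonneg_right this (hpos R)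

/-- At energy $1/4$, which is at least the potential everywhere, the flux $rf'=fg$ is nonincreasing
and starts from $0$. -/
theorem IsRiccatiSolution.nonpos_of_quarter {R : ℝ} (hR : 1 ≤ R) (hR2 : R < Real.sqrt 2)
    {g : ℝ → ℝ} (hg : IsRiccatiSolution R (1 / 4) g) (h1 : g 1 = 0) : g R ≤ 0 := by
  have hgc : ContinuousOn g (Icc 1 R) := fun r hr => (hg r hr).continuousWithinAt
  obtain ⟨f, φ, -, hpos, hf, hφ⟩ := exists_exp_integral hR hgc
  have hanti : AntitoneOn (fun r => f r * g r) (Icc 1 R) := by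
    refine antitoneOn_of_deriv_nonpos (convex_Icc _ _)
      ((continuous_iff_continuousAt.2 fun r => (hf r).continuousAt).continuousOn.mul hgc) ?_ ?_
    · rw [interior_Icc]
      exact fun r hr => (hg.hasDerivAt_mul hf hφ hr).differentiableAt.differentiableWithinAt
    · rw [interior_Icc]
      intro r hr
      rw [(hg.hasDerivAt_mul hf hφ hr).deriv]
      have h0 : 0 < r := by linarith [hr.1]
      have := radialPotential_le hr.1.le (sq_le_two_of_le hr.1.le hR2 hr.2.le)
      exact mul_nonpos_of_nonneg_of_nonpos (hpos r).le
        (mul_nonpos_of_nonneg_of_nonpos h0.le (by linarith))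
  have := hanti (left_mem_Icc.2 hR) (right_mem_Icc.2 hR) hR
  simp only [h1, mul_zero] at this
  exact nonpos_of_mul_nonpos_right this (hpos R)

/-- The Riccati vector field, with the energy `1 / 8 + x.2 / 2` as a second state variable. -/
def riccatiField (t : ℝ) (x : ℝ × ℝ) : ℝ × ℝ :=
  (t * ((t / 2 - 1 / t) ^ 2 - (1 / 8 + x.2 / 2)) - x.1 ^ 2 / t, 0)

/-- Carrying the energy as a constant second component turns dependence on a parameter into
dependence on initial data. Initial data within $1/4$ of the origin cover exactly the energies in
$[0,1/4]$. On the ball of radius $7/10$ the field is at most $21/20$, and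
$\frac{21}{20}(\sqrt2-1)<\frac7{10}-\frac14$, so one local flow reaches $R$ and no continuation or
blow-up analysis is needed. -/
theorem isPicardLindelof_riccatiField {R : ℝ} (hR : 1 < R) (hR2 : R < Real.sqrt 2) :
    IsPicardLindelof riccatiField (tmin := 1) (tmax := R) ⟨1, left_mem_Icc.2 hR.le⟩ (0, 0)
      (7 / 10) (1 / 4) (21 / 20) 3 := by
  have hs2 : Real.sqrt 2 < 1.4143 := by
    rw [Real.sqrt_lt' (by norm_num)]; norm_num
  have hball : ∀ x : ℝ × ℝ, x ∈ Metric.closedBall ((0, 0) : ℝ × ℝ) ((7 / 10 : NNReal) : ℝ) →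
      |x.1| ≤ 7 / 10 ∧ |x.2| ≤ 7 / 10 := fun x hx => by
    rw [mem_closedBall_iff_norm, show ((0, 0) : ℝ × ℝ) = 0 from rfl, sub_zero, Prod.norm_def,
      max_le_iff] at hx
    simpa using hx
  refine ⟨fun t ht => ?_, fun x _ => ?_, fun t ht x hx => ?_, ?_⟩
  · refine LipschitzOnWith.of_dist_le_mul fun x hx y hy => ?_
    obtain ⟨hx1, -⟩ := hball x hx
    obtain ⟨hy1, -⟩ := hball y hy
    have ht0 : 0 < t := by linarith [ht.1]
    have h1 : |x.1 - y.1| ≤ dist x y := by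
      rw [Prod.dist_eq, ← Real.dist_eq]; exact le_max_left _ _
    have h2 : |x.2 - y.2| ≤ dist x y := by
      rw [Prod.dist_eq, ← Real.dist_eq]; exact le_max_right _ _
    rw [dist_eq_norm (riccatiField t x), Prod.norm_def]
    simp only [riccatiField, Prod.mk_sub_mk, sub_self, norm_zero]
    rw [max_eq_left (norm_nonneg _), Real.norm_eq_abs]
    have e : t * ((t / 2 - 1 / t) ^ 2 - (1 / 8 + x.2 / 2)) - x.1 ^ 2 / t -
        (t * ((t / 2 - 1 / t) ^ 2 - (1 / 8 + y.2 / 2)) - y.1 ^ 2 / t) =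
        -(t / 2 * (x.2 - y.2)) + -((x.1 + y.1) / t * (x.1 - y.1)) := by
      field_simp; ring
    rw [e]
    refine (abs_add_le _ _).trans ?_
    rw [abs_neg, abs_neg, abs_mul, abs_mul, abs_of_pos (half_pos ht0), abs_div, abs_of_pos ht0]
    have h3 : t / 2 ≤ 1 := by linarith [ht.2]
    have h4 : |x.1 + y.1| / t ≤ 2 := by
      rw [div_le_iff₀ ht0]
      linarith [abs_add_le x.1 y.1, ht.1]
    calc t / 2 * |x.2 - y.2| + |x.1 + y.1| / t * |x.1 - y.1|
        ≤ 1 * dist x y + 2 * dist x y := by gcongr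
      _ = ((3 : NNReal) : ℝ) * dist x y := by simp; ring
  · have hne : ∀ t ∈ Icc 1 R, t ≠ 0 := fun t ht => by linarith [ht.1]
    unfold riccatiField
    refine ContinuousOn.prodMk ?_ continuousOn_const
    fun_prop (disch := assumption)
  · obtain ⟨hx1, hx2⟩ := hball x hx
    have ht0 : 0 < t := by linarith [ht.1]
    have hV := radialPotential_le ht.1 (sq_le_two_of_le ht.1 hR2 ht.2)
    rw [Prod.norm_def]
    simp only [riccatiField, norm_zero]
    rw [max_eq_left (norm_nonneg _), Real.norm_eq_abs]
    have hsq : x.1 ^ 2 ≤ (7 / 10) ^ 2 := by rw [← sq_abs]; gcongr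
    have hx2' := abs_le.1 hx2
    have hV0 : 0 ≤ (t / 2 - 1 / t) ^ 2 := sq_nonneg _
    have hxt : 0 ≤ x.1 ^ 2 / t := by positivity
    have hxt' : x.1 ^ 2 / t ≤ (7 / 10) ^ 2 / t := by gcongr
    have h5 : (7 / 10) ^ 2 / t ≤ 21 / 20 - 19 / 40 * t := by
      rw [div_le_iff₀ ht0]; nlinarith [ht.1, ht.2]
    rw [show (((21 / 20 : NNReal)) : ℝ) = 21 / 20 by simp, abs_le]
    constructor
    · nlinarith
    · nlinarith [ht.1, ht.2]
  · rw [max_eq_left (by simp; linarith)]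
    simp
    norm_num
    linarith

/-- Shooting: the end value $g(R)$ depends continuously on the energy, is nonnegative at energy $0$
and nonpositive at $1/4$, so it vanishes for some energy between them. -/
theorem exists_isRiccatiSolution {R : ℝ} (hR : 1 < R) (hR2 : R < Real.sqrt 2) :
    ∃ (l : ℝ) (g : ℝ → ℝ), 0 ≤ l ∧ IsRiccatiSolution R l g ∧ g 1 = 0 ∧ g R = 0 := by
  obtain ⟨α, hα, hcont⟩ := (isPicardLindelof_riccatiField hR hR2)
    |>.exists_forall_mem_closedBall_eq_hasDerivWithinAt_continuousOn
  simp only at hα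
  have hmem : ∀ s ∈ Icc (-(1 / 4) : ℝ) (1 / 4),
      ((0, s) : ℝ × ℝ) ∈ Metric.closedBall ((0, 0) : ℝ × ℝ) ((1 / 4 : NNReal) : ℝ) := fun s hs => by
    rw [mem_closedBall_iff_norm, show ((0, 0) : ℝ × ℝ) = 0 from rfl, sub_zero, Prod.norm_def,
      max_le_iff]
    simpa using abs_le.2 hs
  have hsol : ∀ s ∈ Icc (-(1 / 4) : ℝ) (1 / 4),
      IsRiccatiSolution R (1 / 8 + s / 2) (fun t => (α ((0, s), t)).1) ∧
        (α ((0, s), 1)).1 = 0 := fun s hs => by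
    obtain ⟨h1, h2⟩ := hα _ (hmem s hs)
    have hfst : ∀ t ∈ Icc 1 R, HasDerivWithinAt (fun t => (α ((0, s), t)).1)
        (riccatiField t (α ((0, s), t))).1 (Icc 1 R) t := fun t ht =>
      (ContinuousLinearMap.fst ℝ ℝ ℝ).hasFDerivAt.comp_hasDerivWithinAt t (h2 t ht)
    have hsnd : ∀ t ∈ Icc 1 R, HasDerivWithinAt (fun t => (α ((0, s), t)).2) 0 (Icc 1 R) t :=
      fun t ht => (ContinuousLinearMap.snd ℝ ℝ ℝ).hasFDerivAt.comp_hasDerivWithinAt t (h2 t ht)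
    have hconst : ∀ t ∈ Icc 1 R, (α ((0, s), t)).2 = s := fun t ht => by
      have := constant_of_derivWithin_zero (f := fun t => (α ((0, s), t)).2) (a := 1) (b := R)
        (fun t ht => (hsnd t ht).differentiableWithinAt) (fun t ht =>
          (hsnd t (Ico_subset_Icc_self ht)).derivWithin
            (uniqueDiffOn_Icc hR t (Ico_subset_Icc_self ht))) t ht
      rw [this, h1]
    refine ⟨fun t ht => ?_, by rw [h1]⟩
    have := hfst t ht
    simp only [riccatiField, hconst t ht] at this
    exact this
  have hc : ContinuousOn (fun s => (α ((0, s), R)).1) (Icc (-(1 / 4) : ℝ) (1 / 4)) := by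
    refine continuous_fst.comp_continuousOn (hcont.comp (by fun_prop) fun s hs => ?_)
    exact ⟨hmem s hs, right_mem_Icc.2 hR.le⟩
  have hle : (-(1 / 4) : ℝ) ≤ 1 / 4 := by norm_num
  obtain ⟨hl1, hl2⟩ := hsol _ (left_mem_Icc.2 hle)
  obtain ⟨hr1, hr2⟩ := hsol _ (right_mem_Icc.2 hle)
  -- The end parameters $s=\mp1/4$ become the energies $0$ and $1/4$.
  norm_num at hl1 hr1
  obtain ⟨s, hs, hs0⟩ := intermediate_value_Icc' hle hc
    ⟨hr1.nonpos_of_quarter hR.le hR2 hr2, hl1.nonneg_of_zero hR.le hl2⟩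
  exact ⟨1 / 8 + s / 2, _, by linarith [hs.1], (hsol s hs).1, (hsol s hs).2, hs0⟩

end Riccati

/-! ### Weak derivatives on an interval and absolute continuity -/

section Primitive

open Set

/-- `h` is absolutely continuous on `[a, b]` with integrable derivative `k`. -/
def IsPrimitiveOn (a b : ℝ) (h k : ℝ → ℝ) : Prop :=
  IntervalIntegrable k volume a b ∧ ∀ x ∈ Icc a b, h x = h a + ∫ t in a..x, k t

theorem IsPrimitiveOn.intervalIntegrable {a b : ℝ} {h k : ℝ → ℝ} (H : IsPrimitiveOn a b h k)
    {x : ℝ} (hx : x ∈ Icc a b) : IntervalIntegrable k volume a x :=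
  H.1.mono_set (by
    rw [uIcc_of_le hx.1, uIcc_of_le (hx.1.trans hx.2)]; exact Icc_subset_Icc_right hx.2)

theorem IsPrimitiveOn.continuousOn {a b : ℝ} {h k : ℝ → ℝ} (H : IsPrimitiveOn a b h k) :
    ContinuousOn h (Icc a b) := by
  by_cases hab : a ≤ b
  · have h1 : ContinuousOn (fun x => h a + ∫ t in a..x, k t) (Icc a b) := by
      rw [← uIcc_of_le hab]
      exact continuousOn_const.add (intervalIntegral.continuousOn_primitive_interval'
        H.1 left_mem_uIcc)
    exact h1.congr H.2
  · rw [Icc_eq_empty hab]; exact continuousOn_empty _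

theorem IsPrimitiveOn.of_hasDerivWithinAt {a b : ℝ} {h k : ℝ → ℝ} (hab : a ≤ b)
    (hd : ∀ x ∈ Icc a b, HasDerivWithinAt h (k x) (Icc a b) x) (hk : ContinuousOn k (Icc a b)) :
    IsPrimitiveOn a b h k := by
  have hi : IntervalIntegrable k volume a b := by
    rw [← uIcc_of_le hab] at hk; exact hk.intervalIntegrable
  refine ⟨hi, fun x hx => ?_⟩
  have := intervalIntegral.integral_eq_sub_of_hasDeriv_right_of_le hx.1
    (fun y hy => ((hd y ⟨hy.1, hy.2.trans hx.2⟩).continuousWithinAt).mono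
      (Icc_subset_Icc_right hx.2))
    (fun y hy => ((hd y ⟨hy.1.le, hy.2.le.trans hx.2⟩).hasDerivAt
      (Icc_mem_nhds hy.1 (hy.2.trans_le hx.2))).hasDerivWithinAt)
    (hi.mono_set (by
      rw [uIcc_of_le hx.1, uIcc_of_le hab]; exact Icc_subset_Icc_right hx.2))
  linarith

theorem IsPrimitiveOn.mul {a b : ℝ} {h₁ k₁ h₂ k₂ : ℝ → ℝ} (hab : a ≤ b)
    (H₁ : IsPrimitiveOn a b h₁ k₁) (H₂ : IsPrimitiveOn a b h₂ k₂) :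
    IsPrimitiveOn a b (fun x => h₁ x * h₂ x) (fun x => k₁ x * h₂ x + h₁ x * k₂ x) := by
  have hi : IntervalIntegrable (fun x => k₁ x * h₂ x + h₁ x * k₂ x) volume a b := by
    have c1 := H₁.continuousOn
    have c2 := H₂.continuousOn
    rw [← uIcc_of_le hab] at c1 c2
    exact (H₁.1.mul_continuousOn c2).add (H₂.1.continuousOn_mul c1)
  refine ⟨hi, fun x hx => ?_⟩
  have ac : ∀ {h k : ℝ → ℝ}, IsPrimitiveOn a b h k → AbsolutelyContinuousOnInterval
      (fun y => h a + ∫ t in a..y, k t) a x := fun {h k} H =>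
    (((LipschitzWith.const (h a)).lipschitzOnWith (s := uIcc a x)).absolutelyContinuousOnInterval).add
      ((H.intervalIntegrable hx).absolutelyContinuousOnInterval_intervalIntegral left_mem_uIcc)
  have key := (ac H₁).integral_deriv_mul_eq_sub (ac H₂)
  rw [← H₁.2 x hx, ← H₂.2 x hx] at key
  simp only [intervalIntegral.integral_same, add_zero] at key
  have e : ∫ t in a..x, (k₁ t * h₂ t + h₁ t * k₂ t) = h₁ x * h₂ x - h₁ a * h₂ a := by
    rw [← key]
    refine intervalIntegral.integral_congr_ae ?_
    filter_upwards [(H₁.intervalIntegrable hx).ae_hasDerivAt_integral,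
      (H₂.intervalIntegrable hx).ae_hasDerivAt_integral] with t h1 h2 ht
    have ht' := uIoc_subset_uIcc ht
    have ht'' : t ∈ Icc a b := by
      rw [uIcc_of_le hx.1] at ht'; exact ⟨ht'.1, ht'.2.trans hx.2⟩
    rw [((h1 ht' a left_mem_uIcc).const_add (h₁ a)).deriv,
      ((h2 ht' a left_mem_uIcc).const_add (h₂ a)).deriv, ← H₁.2 t ht'', ← H₂.2 t ht'']
  linarith

theorem _root_.MeasureTheory.IntegrableOn.mul_of_hasCompactSupport {s : Set ℝ} {h ψ : ℝ → ℝ}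
    (hh : IntegrableOn h s) (hψ : Continuous ψ) (hc : HasCompactSupport ψ) :
    IntegrableOn (fun x => h x * ψ x) s := by
  obtain ⟨C, hC⟩ := hc.exists_bound_of_continuous hψ
  exact hh.mul_bdd hψ.aestronglyMeasurable (Filter.Eventually.of_forall hC)

/-- The primitive of $\sigma$ from $a$ vanishes to the left of the support, and to the right of it
because the total integral is $0$; so it is itself a test function. -/
theorem exists_deriv_eq_of_integral_eq_zero {a b : ℝ} (hab : a < b) {σ : ℝ → ℝ}
    (hσ : ContDiff ℝ ∞ σ) (hc : HasCompactSupport σ) (hs : tsupport σ ⊆ Ioo a b)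
    (h0 : ∫ x, σ x = 0) :
    ∃ ξ : ℝ → ℝ, ContDiff ℝ ∞ ξ ∧ HasCompactSupport ξ ∧ tsupport ξ ⊆ Ioo a b ∧ deriv ξ = σ := by
  have hm : (a + b) / 2 ∈ Ioo a b := ⟨by linarith, by linarith⟩
  -- The midpoint is inserted so that the compact set is nonempty, and has least and greatest
  -- elements, even if $\sigma=0$.
  have hK : IsCompact (insert ((a + b) / 2) (tsupport σ)) := IsCompact.insert hc _
  have hKs : insert ((a + b) / 2) (tsupport σ) ⊆ Ioo a b := insert_subset hm hs
  obtain ⟨a', ha', hal⟩ := hK.exists_isLeast (insert_nonempty _ _)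
  obtain ⟨b', hb', hbg⟩ := hK.exists_isGreatest (insert_nonempty _ _)
  have hσ0 : ∀ x, x ∉ Icc a' b' → σ x = 0 := fun x hx => by
    by_contra hne
    have hx' : x ∈ insert ((a + b) / 2) (tsupport σ) :=
      mem_insert_of_mem _ (subset_tsupport σ hne)
    exact hx ⟨hal hx', hbg hx'⟩
  have hd : ∀ x, HasDerivAt (fun x => ∫ t in a..x, σ t) (σ x) x := fun x =>
    (hσ.continuous.integral_hasStrictDerivAt a x).hasDerivAt
  have hsub : tsupport (fun x => ∫ t in a..x, σ t) ⊆ Icc a' b' := by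
    refine closure_minimal (fun x hx => ?_) isClosed_Icc
    by_contra hx'
    refine hx ?_
    rw [mem_Icc, not_and_or, not_le, not_le] at hx'
    rcases hx' with hx' | hx'
    · refine intervalIntegral.integral_zero_ae (Filter.Eventually.of_forall fun t ht => hσ0 t ?_)
      rw [mem_uIoc] at ht
      have := (hKs ha').1
      rcases ht with ht | ht
      · exact fun h => absurd (ht.2.trans_lt hx') (not_lt.2 h.1)
      · exact fun h => absurd (ht.2.trans_lt this) (not_lt.2 h.1)
    · show ∫ t in a..x, σ t = 0
      rw [intervalIntegral.integral_eq_integral_of_support_subset, h0]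
      intro t ht
      have : t ∈ Icc a' b' := by by_contra h; exact ht (hσ0 t h)
      exact ⟨(hKs ha').1.trans_le this.1, this.2.trans hx'.le⟩
  have hder : deriv (fun x => ∫ t in a..x, σ t) = σ := funext fun x => (hd x).deriv
  refine ⟨fun x => ∫ t in a..x, σ t, ?_, HasCompactSupport.of_support_subset_isCompact
    (K := Icc a' b') isCompact_Icc ((subset_tsupport _).trans hsub),
    hsub.trans fun x hx => ⟨(hKs ha').1.trans_le hx.1, hx.2.trans_lt (hKs hb').2⟩, hder⟩
  rw [contDiff_infty_iff_deriv, hder]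
  exact ⟨fun x => (hd x).differentiableAt, hσ⟩

/-- The du Bois-Reymond lemma. -/
theorem ae_eq_const_of_integral_mul_deriv_eq_zero {a b : ℝ} (hab : a < b) {h : ℝ → ℝ}
    (hi : IntegrableOn h (Ioo a b))
    (hw : ∀ ξ : ℝ → ℝ, ContDiff ℝ ∞ ξ → HasCompactSupport ξ → tsupport ξ ⊆ Ioo a b →
      ∫ x in Ioo a b, h x * deriv ξ x = 0) :
    ∃ c, ∀ᵐ x, x ∈ Ioo a b → h x = c := by
  obtain ⟨ρ, hρs, hρc, hρ, hρr, hρ1⟩ := exists_contDiff_tsupport_subset (E := ℝ) (n := ⊤)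
    (isOpen_Ioo.mem_nhds (show (a + b) / 2 ∈ Ioo a b from ⟨by linarith, by linarith⟩))
  have hI : 0 < ∫ x, ρ x := hρ.continuous.integral_pos_of_hasCompactSupport_nonneg_nonzero hρc
    (fun x => (hρr (mem_range_self x)).1) (x := (a + b) / 2) (by rw [hρ1]; exact one_ne_zero)
  have hint : ∀ ψ : ℝ → ℝ, Continuous ψ → HasCompactSupport ψ →
      IntegrableOn (fun x => h x * ψ x) (Ioo a b) := fun ψ h1 h2 =>
    hi.mul_of_hasCompactSupport h1 h2
  set c := (∫ x in Ioo a b, h x * ρ x) / ∫ x, ρ x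
  refine ⟨c, ?_⟩
  have := isOpen_Ioo.ae_eq_zero_of_integral_contDiff_smul_eq_zero (μ := volume.restrict (Ioo a b))
    (U := Ioo a b) (f := fun x => h x - c)
    ((hi.sub (integrable_const c)).locallyIntegrable.locallyIntegrableOn _) fun ψ hψ hψc hψs => ?_
  · rw [ae_restrict_iff' measurableSet_Ioo] at this
    filter_upwards [this] with x hx hx'
    exact sub_eq_zero.1 (hx hx' hx')
  · set I := ∫ x, ψ x
    -- Subtracting the multiple of $\rho$ with the same integral as $\psi$ leaves a function of mean
    -- zero, hence the derivative of a test function.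
    obtain ⟨ξ, h1, h2, h3, h4⟩ := exists_deriv_eq_of_integral_eq_zero hab
      (σ := fun x => ψ x - (I / ∫ x, ρ x) * ρ x)
      (hψ.sub (contDiff_const.mul hρ)) (hψc.sub hρc.mul_left)
      ((tsupport_sub _ _).trans (union_subset hψs ((tsupport_mul_subset_right).trans hρs)))
      (by
        rw [integral_sub (hψ.continuous.integrable_of_hasCompactSupport hψc)
          ((hρ.continuous.integrable_of_hasCompactSupport hρc).const_mul _), integral_const_mul]
        field_simp
        simp [I])
    have h5 := hw ξ h1 h2 h3
    rw [h4] at h5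
    have e1 : ∫ x in Ioo a b, h x * (ψ x - (I / ∫ x, ρ x) * ρ x) =
        (∫ x in Ioo a b, h x * ψ x) - (I / ∫ x, ρ x) * ∫ x in Ioo a b, h x * ρ x := by
      rw [← integral_const_mul, ← integral_sub (hint ψ hψ.continuous hψc)
        ((hint ρ hρ.continuous hρc).const_mul _)]
      congr 1; ext x; ring
    have e2 : ∫ x in Ioo a b, ψ x = I :=
      setIntegral_eq_integral_of_forall_compl_eq_zero fun x hx =>
        image_eq_zero_of_notMem_tsupport fun h' => hx (hψs h')
    have e3 : ∫ x in Ioo a b, ψ x • (h x - c) = (∫ x in Ioo a b, h x * ψ x) - c * I := by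
      rw [← e2, ← integral_const_mul, ← integral_sub (hint ψ hψ.continuous hψc)
        ((hψ.continuous.integrable_of_hasCompactSupport hψc).restrict.const_mul _)]
      congr 1; ext x; simp only [smul_eq_mul]; ring
    rw [e3]
    rw [e1] at h5
    simp only [c]
    rw [← h5]; ring

/-- A function with an integrable weak derivative is absolutely continuous. -/
theorem exists_isPrimitiveOn_of_weak {a b : ℝ} (hab : a < b) {h k : ℝ → ℝ}
    (hi : IntegrableOn h (Ioo a b)) (hk : IntegrableOn k (Ioo a b))
    (hw : ∀ ξ : ℝ → ℝ, ContDiff ℝ ∞ ξ → HasCompactSupport ξ → tsupport ξ ⊆ Ioo a b →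
      ∫ x in Ioo a b, h x * deriv ξ x = -∫ x in Ioo a b, k x * ξ x) :
    ∃ h' : ℝ → ℝ, IsPrimitiveOn a b h' k ∧ ∀ᵐ x, x ∈ Ioo a b → h x = h' x := by
  have hk' : IntervalIntegrable k volume a b :=
    (intervalIntegrable_iff_integrableOn_Ioo_of_le hab.le).2 hk
  set p : ℝ → ℝ := fun x => ∫ t in a..x, k t
  have hp : IsPrimitiveOn a b p k := ⟨hk', fun x _ => by simp [p]⟩
  have hpi : IntegrableOn p (Ioo a b) :=
    (hp.continuousOn.integrableOn_Icc).mono_set Ioo_subset_Icc_self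
  -- The difference of $h$ and the primitive $p$ of $k$ has weak derivative zero, by integration by
  -- parts for $p\,\xi$.
  obtain ⟨c, hc⟩ := ae_eq_const_of_integral_mul_deriv_eq_zero hab (h := fun x => h x - p x)
    (hi.sub hpi) fun ξ h1 h2 h3 => by
      have hξ : IsPrimitiveOn a b ξ (deriv ξ) := IsPrimitiveOn.of_hasDerivWithinAt hab.le
        (fun x _ => ((h1.differentiable (by simp)) x).hasDerivAt.hasDerivWithinAt)
        (h1.continuous_deriv (by simp)).continuousOn
      have hz : ∀ x, x ∉ Ioo a b → ξ x = 0 := fun x hx =>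
        image_eq_zero_of_notMem_tsupport fun h' => hx (h3 h')
      have hdc := h1.continuous_deriv (by simp : (1 : WithTop ℕ∞) ≤ ∞)
      have e := (hp.mul hab.le hξ).2 b (right_mem_Icc.2 hab.le)
      simp only at e
      rw [hz a (by simp), hz b (by simp), mul_zero, mul_zero, zero_add,
        intervalIntegral.integral_of_le hab.le, integral_Ioc_eq_integral_Ioo,
        integral_add (hk.mul_of_hasCompactSupport h1.continuous h2)
          (hpi.mul_of_hasCompactSupport hdc h2.deriv)] at e
      simp only [sub_mul]
      rw [integral_sub (hi.mul_of_hasCompactSupport hdc h2.deriv)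
        (hpi.mul_of_hasCompactSupport hdc h2.deriv), hw ξ h1 h2 h3]
      linarith
  refine ⟨fun x => c + p x, ⟨hk', fun x _ => by simp [p]⟩, ?_⟩
  filter_upwards [hc] with x hx hx'
  linarith [hx hx']

end Primitive

/-! ### Lower bounds and gaps for the radial energies -/

section RadialEnergy

open Set

variable {R : ℝ}

/-- Jacobi's completion of the square. The cross term is $-2Ghk=-G\,(h^2)'$; integrating by parts
leaves $G'h^2$, with no boundary terms since $G$ vanishes at both ends. No boundary condition on $h$
is needed, as befits the Neumann form. -/
theorem integral_mul_sq_sub_eq (hR : 1 ≤ R) {h k G G' : ℝ → ℝ} (hh : IsPrimitiveOn 1 R h k)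
    (hk : IntervalIntegrable (fun r => k r ^ 2) volume 1 R) (hG : IsPrimitiveOn 1 R G G')
    (hG' : ContinuousOn G' (Icc 1 R)) (h1 : G 1 = 0) (h2 : G R = 0) :
    IntervalIntegrable (fun r => r * (k r - G r / r * h r) ^ 2) volume 1 R ∧
    ∫ r in (1 : ℝ)..R, r * (k r - G r / r * h r) ^ 2 =
      (∫ r in (1 : ℝ)..R, r * k r ^ 2) + ∫ r in (1 : ℝ)..R, (G' r + G r ^ 2 / r) * h r ^ 2 := by
  have hu : uIcc 1 R = Icc 1 R := uIcc_of_le hR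
  have hne : ∀ r ∈ Icc 1 R, r ≠ 0 := fun r hr => by linarith [hr.1]
  have ch := hh.continuousOn
  have cG := hG.continuousOn
  have i1 : IntervalIntegrable (fun r => r * k r ^ 2) volume 1 R :=
    hk.continuousOn_mul continuousOn_id
  have i2 : IntervalIntegrable (fun r => 2 * G r * h r * k r) volume 1 R :=
    hh.1.continuousOn_mul (by rw [hu]; fun_prop)
  have i3 : IntervalIntegrable (fun r => G r ^ 2 / r * h r ^ 2) volume 1 R := by
    refine ContinuousOn.intervalIntegrable ?_
    rw [hu]; fun_prop (disch := assumption)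
  have i4 : IntervalIntegrable (fun r => G' r * h r ^ 2) volume 1 R := by
    refine ContinuousOn.intervalIntegrable ?_
    rw [hu]; fun_prop
  have e0 := (hG.mul hR (hh.mul hR hh)).2 R (right_mem_Icc.2 hR)
  simp only [h1, h2, zero_mul, zero_add] at e0
  have e1 : (∫ r in (1 : ℝ)..R, G' r * h r ^ 2) + ∫ r in (1 : ℝ)..R, 2 * G r * h r * k r = 0 := by
    rw [← intervalIntegral.integral_add i4 i2, e0]
    congr 1; ext r; ring
  have e2 : EqOn (fun r => r * (k r - G r / r * h r) ^ 2)
      (fun r => r * k r ^ 2 - 2 * G r * h r * k r + G r ^ 2 / r * h r ^ 2) (uIcc 1 R) := by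
    intro r hr
    have := hne r (hu ▸ hr)
    simp only; field_simp; ring
  refine ⟨((i1.sub i2).add i3).congr (fun r hr => (e2 (uIoc_subset_uIcc hr)).symm), ?_⟩
  rw [intervalIntegral.integral_congr e2, intervalIntegral.integral_add (i1.sub i2) i3,
    intervalIntegral.integral_sub i1 i2]
  have e3 : ∫ r in (1 : ℝ)..R, (G' r + G r ^ 2 / r) * h r ^ 2 =
      (∫ r in (1 : ℝ)..R, G' r * h r ^ 2) + ∫ r in (1 : ℝ)..R, G r ^ 2 / r * h r ^ 2 := by
    rw [← intervalIntegral.integral_add i4 i3]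
    congr 1; ext r; ring
  rw [e3]; linarith

/-- A lower bound for a radial energy from a supersolution of the Riccati equation. -/
theorem le_integral_of_riccati_le (hR : 1 ≤ R) {h k G G' W : ℝ → ℝ} (hh : IsPrimitiveOn 1 R h k)
    (hk : IntervalIntegrable (fun r => k r ^ 2) volume 1 R) (hG : IsPrimitiveOn 1 R G G')
    (hG' : ContinuousOn G' (Icc 1 R)) (h1 : G 1 = 0) (h2 : G R = 0)
    (hW : ContinuousOn W (Icc 1 R)) {a : ℝ}
    (hle : ∀ r ∈ Icc 1 R, G' r + G r ^ 2 / r ≤ r * (W r - a)) :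
    a * ∫ r in (1 : ℝ)..R, r * h r ^ 2 ≤ ∫ r in (1 : ℝ)..R, r * (k r ^ 2 + W r * h r ^ 2) := by
  have hu : uIcc 1 R = Icc 1 R := uIcc_of_le hR
  have hne : ∀ r ∈ Icc 1 R, r ≠ 0 := fun r hr => by linarith [hr.1]
  have ch := hh.continuousOn
  have cG := hG.continuousOn
  obtain ⟨-, e⟩ := integral_mul_sq_sub_eq hR hh hk hG hG' h1 h2
  have p : 0 ≤ ∫ r in (1 : ℝ)..R, r * (k r - G r / r * h r) ^ 2 :=
    intervalIntegral.integral_nonneg hR fun r hr => by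
      have : 0 ≤ r := by linarith [hr.1]
      positivity
  have i1 : IntervalIntegrable (fun r => r * k r ^ 2) volume 1 R :=
    hk.continuousOn_mul continuousOn_id
  have i2 : IntervalIntegrable (fun r => r * W r * h r ^ 2) volume 1 R := by
    refine ContinuousOn.intervalIntegrable ?_
    rw [hu]; fun_prop
  have i3 : IntervalIntegrable (fun r => r * h r ^ 2) volume 1 R := by
    refine ContinuousOn.intervalIntegrable ?_
    rw [hu]; fun_prop
  have i4 : IntervalIntegrable (fun r => (G' r + G r ^ 2 / r) * h r ^ 2) volume 1 R := by
    refine ContinuousOn.intervalIntegrable ?_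
    rw [hu]; fun_prop (disch := assumption)
  have m : ∫ r in (1 : ℝ)..R, (G' r + G r ^ 2 / r) * h r ^ 2 ≤
      ∫ r in (1 : ℝ)..R, (r * W r * h r ^ 2 - a * (r * h r ^ 2)) :=
    intervalIntegral.integral_mono_on hR i4 (i2.sub (i3.const_mul a)) fun r hr => by
      have := mul_le_mul_of_nonneg_right (hle r hr) (sq_nonneg (h r))
      linarith
  rw [intervalIntegral.integral_sub i2 (i3.const_mul a), intervalIntegral.integral_const_mul] at m
  have e2 : ∫ r in (1 : ℝ)..R, r * (k r ^ 2 + W r * h r ^ 2) =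
      (∫ r in (1 : ℝ)..R, r * k r ^ 2) + ∫ r in (1 : ℝ)..R, r * W r * h r ^ 2 := by
    rw [← intervalIntegral.integral_add i1 i2]
    congr 1; ext r; ring
  linarith

/-- With $d=w(r)-w(1)$, expanding $\int_1^r(w'-d)^2\ge0$ gives $(3-r)d^2\le\int_1^r w'^2$, and
$3-r\ge1$. -/
theorem sq_sub_le_integral_sq {w w' : ℝ → ℝ} (hR2 : R ≤ 2) (hw : IsPrimitiveOn 1 R w w')
    (hi : IntervalIntegrable (fun r => w' r ^ 2) volume 1 R) {r : ℝ} (hr : r ∈ Icc 1 R) :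
    (w r - w 1) ^ 2 ≤ ∫ t in (1 : ℝ)..R, w' t ^ 2 := by
  have hR : 1 ≤ R := hr.1.trans hr.2
  set d := w r - w 1
  have hd : ∫ t in (1 : ℝ)..r, w' t = d := by
    have := hw.2 r hr
    simp only [d]; linarith
  have i1 : IntervalIntegrable (fun t => w' t ^ 2) volume 1 r := hi.mono_set (by
    rw [uIcc_of_le hr.1, uIcc_of_le hR]; exact Icc_subset_Icc_right hr.2)
  have i2 := hw.intervalIntegrable hr
  have h0 : 0 ≤ ∫ t in (1 : ℝ)..r, (w' t ^ 2 - 2 * d * w' t + d ^ 2) :=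
    intervalIntegral.integral_nonneg hr.1 fun t _ => by nlinarith [sq_nonneg (w' t - d)]
  rw [intervalIntegral.integral_add (i1.sub (i2.const_mul _)) (by simp),
    intervalIntegral.integral_sub i1 (i2.const_mul _), intervalIntegral.integral_const_mul, hd,
    intervalIntegral.integral_const, smul_eq_mul] at h0
  have h1 : ∫ t in (1 : ℝ)..r, w' t ^ 2 ≤ ∫ t in (1 : ℝ)..R, w' t ^ 2 :=
    intervalIntegral.integral_mono_interval le_rfl hr.1 hr.2
      (Filter.Eventually.of_forall fun t => sq_nonneg _) hi
  nlinarith [hr.1, hr.2, sq_nonneg d]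

/-- The data of a radial ground state of angular momentum `-1`: its energy `l`, its profile `f` and
the logarithmic derivative `g = r f' / f`. -/
structure IsRadialGroundState (R l : ℝ) (g f φ : ℝ → ℝ) : Prop where
  nonneg : 0 ≤ l
  riccati : IsRiccatiSolution R l g
  left : g 1 = 0
  right : g R = 0
  pos : ∀ r, 0 < f r
  hasDerivAt : ∀ r, HasDerivAt f (φ r * f r) r
  continuous_log_deriv : Continuous φ
  log_deriv : ∀ r ∈ Icc 1 R, φ r = g r / r

theorem exists_isRadialGroundState (hR : 1 < R) (hR2 : R < Real.sqrt 2) :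
    ∃ l g f φ, IsRadialGroundState R l g f φ := by
  obtain ⟨l, g, hl, hg, h1, h2⟩ := exists_isRiccatiSolution hR hR2
  obtain ⟨f, φ, hφ, hpos, hf, hφg⟩ := exists_exp_integral hR.le
    (fun r hr => (hg r hr).continuousWithinAt)
  exact ⟨l, g, f, φ, hl, hg, h1, h2, hpos, hf, hφ, hφg⟩

variable {l : ℝ} {g f φ : ℝ → ℝ}

theorem IsRadialGroundState.continuous (H : IsRadialGroundState R l g f φ) : Continuous f :=
  continuous_iff_continuousAt.2 fun r => (H.hasDerivAt r).continuousAt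

theorem IsRadialGroundState.continuousOn_riccati (H : IsRadialGroundState R l g f φ) :
    ContinuousOn g (Icc 1 R) := fun r hr => (H.riccati r hr).continuousWithinAt

theorem IsRadialGroundState.continuousOn_deriv (H : IsRadialGroundState R l g f φ) :
    ContinuousOn (fun r => r * ((r / 2 - 1 / r) ^ 2 - l) - g r ^ 2 / r) (Icc 1 R) := by
  have hne : ∀ r ∈ Icc 1 R, r ≠ 0 := fun r hr => by linarith [hr.1]
  have := H.continuousOn_riccati
  fun_prop (disch := assumption)

theorem IsRadialGroundState.isPrimitiveOn (H : IsRadialGroundState R l g f φ) (hR : 1 ≤ R) :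
    IsPrimitiveOn 1 R g (fun r => r * ((r / 2 - 1 / r) ^ 2 - l) - g r ^ 2 / r) :=
  IsPrimitiveOn.of_hasDerivWithinAt hR H.riccati H.continuousOn_deriv

/-- Angular momentum `-1`: the gap above the ground state. -/
theorem IsRadialGroundState.exists_gap_self (H : IsRadialGroundState R l g f φ) (hR : 1 ≤ R)
    (hR2 : R ≤ 2) : ∃ γ : ℝ, 0 < γ ∧ ∀ h k : ℝ → ℝ, IsPrimitiveOn 1 R h k →
      IntervalIntegrable (fun r => k r ^ 2) volume 1 R → ∃ c : ℝ,
      l * (∫ r in (1 : ℝ)..R, r * h r ^ 2) + γ * ∫ r in (1 : ℝ)..R, r * (h r - c * f r) ^ 2 ≤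
        ∫ r in (1 : ℝ)..R, r * (k r ^ 2 + (r / 2 - 1 / r) ^ 2 * h r ^ 2) := by
  have hu : uIcc 1 R = Icc 1 R := uIcc_of_le hR
  have hne : ∀ r ∈ Icc 1 R, r ≠ 0 := fun r hr => by linarith [hr.1]
  obtain ⟨x, -, hx⟩ := isCompact_Icc.exists_isMinOn (nonempty_Icc.2 hR) H.continuous.continuousOn
  obtain ⟨y, -, hy⟩ := isCompact_Icc.exists_isMaxOn (nonempty_Icc.2 hR) H.continuous.continuousOn
  have hfx := H.pos x
  have hfy := H.pos y
  -- Write $h=fw$. The energy above $l$ is $\int r f^2w'^2$, and $w-w(1)$ is controlled pointwise by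
  -- $\int w'^2$; this explains $c=h(1)/f(1)$. The constant is $\min f^2/(2\max f^2)$, with $2$
  -- bounding the weight $r$.
  refine ⟨f x ^ 2 / (2 * f y ^ 2), by positivity, fun h k hh hk => ⟨h 1 / f 1, ?_⟩⟩
  have ch := hh.continuousOn
  have cf : ContinuousOn f (Icc 1 R) := H.continuous.continuousOn
  have cφ : ContinuousOn φ (Icc 1 R) := H.continuous_log_deriv.continuousOn
  have hfne : ∀ r ∈ Icc 1 R, f r ≠ 0 := fun r _ => (H.pos r).ne'
  obtain ⟨iE, eE⟩ := integral_mul_sq_sub_eq hR hh hk (H.isPrimitiveOn hR) H.continuousOn_deriv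
    H.left H.right
  set E := ∫ r in (1 : ℝ)..R, r * (k r - g r / r * h r) ^ 2
  have i1 : IntervalIntegrable (fun r => r * k r ^ 2) volume 1 R :=
    hk.continuousOn_mul continuousOn_id
  have i2 : IntervalIntegrable (fun r => r * (r / 2 - 1 / r) ^ 2 * h r ^ 2) volume 1 R := by
    refine ContinuousOn.intervalIntegrable ?_
    rw [hu]; fun_prop (disch := assumption)
  have i3 : IntervalIntegrable (fun r => r * h r ^ 2) volume 1 R := by
    refine ContinuousOn.intervalIntegrable ?_
    rw [hu]; fun_prop
  have e1 : ∫ r in (1 : ℝ)..R, r * (k r ^ 2 + (r / 2 - 1 / r) ^ 2 * h r ^ 2) =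
      E + l * ∫ r in (1 : ℝ)..R, r * h r ^ 2 := by
    have e2 : ∫ r in (1 : ℝ)..R,
        (r * ((r / 2 - 1 / r) ^ 2 - l) - g r ^ 2 / r + g r ^ 2 / r) * h r ^ 2 =
        (∫ r in (1 : ℝ)..R, r * (r / 2 - 1 / r) ^ 2 * h r ^ 2) -
          l * ∫ r in (1 : ℝ)..R, r * h r ^ 2 := by
      rw [← intervalIntegral.integral_const_mul, ← intervalIntegral.integral_sub i2
        (i3.const_mul l)]
      congr 1; ext r; ring
    have e3 : ∫ r in (1 : ℝ)..R, r * (k r ^ 2 + (r / 2 - 1 / r) ^ 2 * h r ^ 2) =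
        (∫ r in (1 : ℝ)..R, r * k r ^ 2) +
          ∫ r in (1 : ℝ)..R, r * (r / 2 - 1 / r) ^ 2 * h r ^ 2 := by
      rw [← intervalIntegral.integral_add i1 i2]
      congr 1; ext r; ring
    rw [e2] at eE
    linarith
  have hinv : IsPrimitiveOn 1 R (fun r => (f r)⁻¹) (fun r => -(φ r * f r) / f r ^ 2) :=
    IsPrimitiveOn.of_hasDerivWithinAt hR
      (fun r _ => ((H.hasDerivAt r).inv (H.pos r).ne').hasDerivWithinAt)
      (by
        have : ∀ r ∈ Icc 1 R, f r ^ 2 ≠ 0 := fun r _ => (pow_pos (H.pos r) 2).ne'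
        fun_prop (disch := assumption))
  have hw := hh.mul hR hinv
  have ew : EqOn (fun r => (k r * (f r)⁻¹ + h r * (-(φ r * f r) / f r ^ 2)) ^ 2)
      (fun r => (r * f r ^ 2)⁻¹ * (r * (k r - g r / r * h r) ^ 2)) (uIcc 1 R) := by
    intro r hr
    rw [hu] at hr
    have h1 := hne r hr
    have h2 := hfne r hr
    simp only
    rw [H.log_deriv r hr]
    field_simp
    ring
  have iw : IntervalIntegrable
      (fun r => (k r * (f r)⁻¹ + h r * (-(φ r * f r) / f r ^ 2)) ^ 2) volume 1 R := by
    refine IntervalIntegrable.congr (f := fun r => (r * f r ^ 2)⁻¹ * (r * (k r - g r / r * h r) ^ 2))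
      (fun r hr => (ew (uIoc_subset_uIcc hr)).symm) (iE.continuousOn_mul ?_)
    rw [hu]
    have : ∀ r ∈ Icc 1 R, r * f r ^ 2 ≠ 0 := fun r hr =>
      mul_ne_zero (hne r hr) (pow_pos (H.pos r) 2).ne'
    fun_prop (disch := assumption)
  have hwE : ∫ r in (1 : ℝ)..R, (k r * (f r)⁻¹ + h r * (-(φ r * f r) / f r ^ 2)) ^ 2 ≤
      (f x ^ 2)⁻¹ * E := by
    rw [← intervalIntegral.integral_const_mul]
    refine intervalIntegral.integral_mono_on hR iw (iE.const_mul _) fun r hr => ?_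
    refine (ew (hu ▸ hr : r ∈ uIcc 1 R)).trans_le ?_
    have hr0 : 0 < r := by linarith [hr.1]
    have hfr : f x ≤ f r := hx hr
    simp only
    gcongr
    nlinarith [hr.1, pow_le_pow_left₀ hfx.le hfr 2, pow_pos (H.pos r) 2]
  have hE0 : 0 ≤ E := intervalIntegral.integral_nonneg hR fun r hr => by
    have : 0 ≤ r := by linarith [hr.1]
    positivity
  have hpt : ∀ r ∈ Icc 1 R,
      r * (h r - h 1 / f 1 * f r) ^ 2 ≤ 2 * (f y ^ 2 * ((f x ^ 2)⁻¹ * E)) := fun r hr => by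
    have h1 := (sq_sub_le_integral_sq hR2 hw iw hr).trans hwE
    have hfr : f r ≤ f y := hy hr
    have hf0 := H.pos r
    have hf1 := H.pos 1
    have e : h r - h 1 / f 1 * f r = f r * (h r * (f r)⁻¹ - h 1 * (f 1)⁻¹) := by
      field_simp
    have hr0 : 0 < r := by linarith [hr.1]
    rw [e, mul_pow]
    gcongr
    linarith [hr.2]
  have hfin : ∫ r in (1 : ℝ)..R, r * (h r - h 1 / f 1 * f r) ^ 2 ≤
      2 * (f y ^ 2 * ((f x ^ 2)⁻¹ * E)) := by
    have := intervalIntegral.integral_mono_on hR (μ := volume)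
      (f := fun r => r * (h r - h 1 / f 1 * f r) ^ 2)
      (g := fun _ => 2 * (f y ^ 2 * ((f x ^ 2)⁻¹ * E))) (by
        refine ContinuousOn.intervalIntegrable ?_
        rw [hu]; fun_prop) (by simp) hpt
    rw [intervalIntegral.integral_const, smul_eq_mul] at this
    have h0 : 0 ≤ 2 * (f y ^ 2 * ((f x ^ 2)⁻¹ * E)) := by positivity
    nlinarith
  rw [e1]
  have : f x ^ 2 / (2 * f y ^ 2) * ∫ r in (1 : ℝ)..R, r * (h r - h 1 / f 1 * f r) ^ 2 ≤ E := by
    calc _ ≤ f x ^ 2 / (2 * f y ^ 2) * (2 * (f y ^ 2 * ((f x ^ 2)⁻¹ * E))) := by gcongr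
      _ = E := by field_simp
  linarith

/-- Angular momentum `0`. -/
theorem IsRadialGroundState.exists_gap_zero (H : IsRadialGroundState R l g f φ) (hR : 1 < R)
    (hR2 : R ≤ 2) : ∃ γ : ℝ, 0 < γ ∧ ∀ h k : ℝ → ℝ, IsPrimitiveOn 1 R h k →
      IntervalIntegrable (fun r => k r ^ 2) volume 1 R →
      (l + γ) * (∫ r in (1 : ℝ)..R, r * h r ^ 2) ≤
        ∫ r in (1 : ℝ)..R, r * (k r ^ 2 + (r / 2) ^ 2 * h r ^ 2) := by
  obtain ⟨K, hK⟩ := isCompact_Icc.exists_bound_of_continuousOn H.continuousOn_riccati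
  have hK0 : 0 ≤ K := (norm_nonneg _).trans (hK 1 (left_mem_Icc.2 hR.le))
  -- With $K$ bounding $|g|$, the error terms created by the correction add up to
  -- $\delta(3+2K)(r-1)=r-1$, exactly the gain available below.
  set δ := 1 / (3 + 2 * K)
  have hd : 0 < 3 + 2 * K := by positivity
  have hδ : 0 < δ := by positivity
  have hδe : δ * (3 + 2 * K) = 1 := by simp only [δ]; field_simp
  have hδ1 : δ ≤ 1 := by nlinarith
  have hD : 0 < R - 1 := by linarith
  refine ⟨δ * (R - 1) / 2, by positivity, fun h k hh hk => ?_⟩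
  -- Replacing mode $-1$ by mode $0$ gains $r-1/r\ge r-1$ on the right of the Riccati inequality,
  -- which degenerates at $r=1$. The correction $\delta(r-1)(r-R)$ keeps the end values of $g$ and
  -- has slope $-\delta(R-1)$ at $r=1$. It thus shifts part of the gain to the inner circle and
  -- makes it uniform.
  refine le_integral_of_riccati_le hR.le hh hk
    (G := fun r => g r + δ * ((r - 1) * (r - R)))
    (G' := fun r => r * ((r / 2 - 1 / r) ^ 2 - l) - g r ^ 2 / r + δ * (2 * r - 1 - R))
    (IsPrimitiveOn.of_hasDerivWithinAt hR.le (fun r hr => ?_) ?_) ?_ (by simp [H.left])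
    (by simp [H.right]) (by fun_prop) fun r hr => ?_
  · refine (H.riccati r hr).add (HasDerivAt.hasDerivWithinAt ?_)
    convert! (((hasDerivAt_id r).sub_const 1).mul ((hasDerivAt_id r).sub_const R)).const_mul δ
      using 1
    simp only [id_eq]; ring
  · exact H.continuousOn_deriv.add (by fun_prop)
  · exact H.continuousOn_deriv.add (by fun_prop)
  · have hr0 : 0 < r := by linarith [hr.1]
    have hgr := abs_le.1 (hK r hr)
    set p := (r - 1) * (r - R)
    have hx0 : 0 ≤ r - 1 := by linarith [hr.1]
    have hp0 : p ≤ 0 := mul_nonpos_of_nonneg_of_nonpos hx0 (by linarith [hr.2])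
    have hp1 : -(r - 1) ≤ p := by simp only [p]; nlinarith [hr.1, hr.2]
    have e : r * ((r / 2 - 1 / r) ^ 2 - l) - g r ^ 2 / r + δ * (2 * r - 1 - R) +
        (g r + δ * p) ^ 2 / r = r * ((r / 2) ^ 2 - l) + (1 / r - r) +
          δ * (2 * (r - 1) - (R - 1)) + (2 * δ * p * g r + δ ^ 2 * p ^ 2) / r := by
      field_simp
      ring
    rw [e]
    have b1 : 1 / r - r ≤ -(r - 1) := by
      have : 1 / r ≤ 1 := by rw [div_le_one hr0]; exact hr.1
      linarith
    have b2 : p * g r ≤ K * (r - 1) := by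
      nlinarith
    have b3 : δ * p ^ 2 ≤ r - 1 := by
      have : p ^ 2 ≤ r - 1 := by nlinarith [hr.2]
      nlinarith [sq_nonneg p]
    have b4 : (2 * δ * p * g r + δ ^ 2 * p ^ 2) / r ≤ δ * (2 * K + 1) * (r - 1) := by
      have h0 : 0 ≤ δ * (2 * K + 1) * (r - 1) := by positivity
      rw [div_le_iff₀ hr0]
      calc 2 * δ * p * g r + δ ^ 2 * p ^ 2 = δ * (2 * (p * g r) + δ * p ^ 2) := by ring
        _ ≤ δ * (2 * (K * (r - 1)) + (r - 1)) := by gcongr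
        _ = δ * (2 * K + 1) * (r - 1) * 1 := by ring
        _ ≤ _ := by gcongr; exact hr.1
    have b5 : δ * (3 + 2 * K) * (r - 1) = r - 1 := by rw [hδe, one_mul]
    have b6 : r * (δ * (R - 1) / 2) ≤ δ * (R - 1) := by
      have : 0 ≤ δ * (R - 1) := by positivity
      nlinarith [hr.2]
    nlinarith

/-- Angular momenta different from `0` and `-1`. -/
theorem radialPotential_gap {r : ℝ} (hr : r ∈ Icc 1 R) (hR2 : R < Real.sqrt 2) {m : ℤ}
    (h0 : m ≠ 0) (h1 : m ≠ -1) : (r / 2 - 1 / r) ^ 2 + 1 / 2 ≤ ((m : ℝ) / r + r / 2) ^ 2 := by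
  have hr0 : 0 < r := by linarith [hr.1]
  have hr2 := sq_le_two_of_le hr.1 hR2 hr.2
  have hr1 : 1 ≤ r ^ 2 := by nlinarith [hr.1]
  have e : ((m : ℝ) / r + r / 2) ^ 2 - ((r / 2 - 1 / r) ^ 2 + 1 / 2) =
      ((m + 1) * ((m - 1) + r ^ 2) - r ^ 2 / 2) / r ^ 2 := by
    field_simp; ring
  rw [← sub_nonneg, e]
  refine div_nonneg ?_ (by positivity)
  have hm : 1 ≤ m ∨ m ≤ -2 := by omega
  rcases hm with hm | hm
  · have : (1 : ℝ) ≤ m := by exact_mod_cast hm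
    nlinarith
  · have : (m : ℝ) ≤ -2 := by exact_mod_cast hm
    nlinarith

/-- One gap for all angular momenta, as summation over the modes requires. Only $m=-1$ contains the
ground state, and only $m=0$ has a potential touching that of $m=-1$ at $r=1$; all other modes lie
higher by at least $1/2$. -/
theorem IsRadialGroundState.exists_gap (H : IsRadialGroundState R l g f φ) (hR : 1 < R)
    (hR2 : R < Real.sqrt 2) : ∃ γ : ℝ, 0 < γ ∧ ∀ (m : ℤ) (h k : ℝ → ℝ), IsPrimitiveOn 1 R h k →
      IntervalIntegrable (fun r => k r ^ 2) volume 1 R → ∃ c : ℝ, (m ≠ -1 → c = 0) ∧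
      l * (∫ r in (1 : ℝ)..R, r * h r ^ 2) + γ * ∫ r in (1 : ℝ)..R, r * (h r - c * f r) ^ 2 ≤
        ∫ r in (1 : ℝ)..R, r * (k r ^ 2 + ((m : ℝ) / r + r / 2) ^ 2 * h r ^ 2) := by
  have hR2' : R ≤ 2 := by
    have := sq_le_two_of_le hR.le hR2 le_rfl
    nlinarith
  obtain ⟨γ₁, hγ₁, H₁⟩ := H.exists_gap_self hR.le hR2'
  obtain ⟨γ₂, hγ₂, H₂⟩ := H.exists_gap_zero hR hR2'
  have hnn : ∀ q : ℝ → ℝ, 0 ≤ ∫ r in (1 : ℝ)..R, r * q r ^ 2 := fun q =>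
    intervalIntegral.integral_nonneg hR.le fun r hr => by
      have : 0 ≤ r := by linarith [hr.1]
      positivity
  refine ⟨min (min γ₁ γ₂) (1 / 2), by positivity, fun m h k hh hk => ?_⟩
  set γ := min (min γ₁ γ₂) (1 / 2)
  have g1 : γ ≤ γ₁ := (min_le_left _ _).trans (min_le_left _ _)
  have g2 : γ ≤ γ₂ := (min_le_left _ _).trans (min_le_right _ _)
  have g3 : γ ≤ 1 / 2 := min_le_right _ _
  by_cases hm1 : m = -1
  · obtain ⟨c, hc⟩ := H₁ h k hh hk
    refine ⟨c, fun h => absurd hm1 h, ?_⟩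
    have e : ∀ r : ℝ, ((m : ℝ) / r + r / 2) ^ 2 = (r / 2 - 1 / r) ^ 2 := fun r => by
      rw [hm1]; push_cast; ring
    simp only [e]
    have := mul_le_mul_of_nonneg_right g1 (hnn fun r => h r - c * f r)
    linarith
  refine ⟨0, fun _ => rfl, ?_⟩
  simp only [zero_mul, sub_zero]
  rw [← add_mul]
  by_cases hm0 : m = 0
  · have := mul_le_mul_of_nonneg_right (add_le_add_right g2 l) (hnn h)
    refine this.trans ?_
    simpa [hm0] using H₂ h k hh hk
  -- The Riccati solution of mode $-1$ also serves here: the larger potential leaves room for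
  -- raising the energy by $\gamma\le1/2$.
  · refine le_integral_of_riccati_le hR.le hh hk (H.isPrimitiveOn hR.le) H.continuousOn_deriv
      H.left H.right ?_ fun r hr => ?_
    · have hne : ∀ r ∈ Icc 1 R, r ≠ 0 := fun r hr => by linarith [hr.1]
      fun_prop (disch := assumption)
    · have hr0 : 0 < r := by linarith [hr.1]
      rw [sub_add_cancel]
      refine mul_le_mul_of_nonneg_left ?_ hr0.le
      linarith [radialPotential_gap hr hR2 hm0 hm1]

end RadialEnergy

/-! ### Polar coordinates and Parseval's identity on circles -/

section Polar

open Set Real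

/-- Polar coordinates in the plane. -/
def polarMap (p : ℝ × ℝ) : Plane := !₂[p.1 * cos p.2, p.1 * sin p.2]

@[simp] theorem polarMap_zero (p : ℝ × ℝ) : polarMap p 0 = p.1 * cos p.2 := rfl

@[simp] theorem polarMap_one (p : ℝ × ℝ) : polarMap p 1 = p.1 * sin p.2 := rfl

/-- The measure `r dr` on `(1, R)`. -/
def radialMeasure (R : ℝ) : Measure ℝ :=
  (volume.restrict (Ioo 1 R)).withDensity fun r => ENNReal.ofReal r

instance (R : ℝ) : SFinite (radialMeasure R) := by unfold radialMeasure; infer_instance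

/-- The measure `dθ` on `(-π, π)`. -/
abbrev angularMeasure : Measure ℝ := volume.restrict (Ioo (-π) π)

theorem norm_sq_plane (x : Plane) : ‖x‖ ^ 2 = x 0 ^ 2 + x 1 ^ 2 := by
  simp [EuclideanSpace.norm_sq_eq, Fin.sum_univ_two]

theorem norm_polarMap {p : ℝ × ℝ} (hp : 0 ≤ p.1) : ‖polarMap p‖ = p.1 := by
  have : ‖polarMap p‖ ^ 2 = p.1 ^ 2 := by
    rw [norm_sq_plane]; simp only [polarMap_zero, polarMap_one]
    nlinarith [sin_sq_add_cos_sq p.2]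
  exact (pow_left_inj₀ (norm_nonneg _) hp two_ne_zero).1 this

theorem continuous_polarMap : Continuous polarMap := by
  refine (PiLp.continuous_toLp 2 _).comp (continuous_pi fun j => ?_)
  fin_cases j <;> simp <;> fun_prop

/-- The polar change of variables, with the Jacobian $r$ absorbed in the radial measure. Restricting
the angle to $(-\pi,\pi)$ loses only a half-line of measure zero. -/
theorem measurePreserving_polarMap (R : ℝ) :
    MeasurePreserving polarMap ((radialMeasure R).prod angularMeasure)
      (volume.restrict (annulus 1 R)) := by
  refine ⟨continuous_polarMap.measurable, ?_⟩
  have hE : MeasurePreserving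
      (fun p : ℝ × ℝ => (!₂[p.1, p.2] : Plane)) volume volume :=
    (EuclideanSpace.volume_preserving_symm_measurableEquiv_toLp (Fin 2)).symm.comp
      ((volume_preserving_finTwoArrow ℝ).symm _)
  have hΩ : MeasurableSet (annulus 1 R) := (isOpen_annulus 1 R).measurableSet
  refine Measure.ext_of_lintegral _ fun F hF => ?_
  rw [lintegral_map hF continuous_polarMap.measurable, ← lintegral_indicator hΩ,
    ← hE.lintegral_comp (hF.indicator hΩ), ← lintegral_comp_polarCoord_symm]
  unfold radialMeasure
  rw [prod_withDensity_left (by fun_prop), lintegral_withDensity_eq_lintegral_mul _ (by fun_prop)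
    (show Measurable fun p => F (polarMap p) from hF.comp continuous_polarMap.measurable),
    Measure.prod_restrict]
  have hsub : Ioo 1 R ×ˢ Ioo (-π) π ⊆ polarCoord.target := fun p hp =>
    ⟨zero_lt_one.trans hp.1.1, hp.2⟩
  rw [← lintegral_indicator (measurableSet_Ioo.prod measurableSet_Ioo),
    ← lintegral_indicator polarCoord.open_target.measurableSet]
  refine lintegral_congr fun p => ?_
  by_cases hp : p ∈ polarCoord.target
  · have hp0 : 0 < p.1 := hp.1
    have e : (!₂[(polarCoord.symm p).1, (polarCoord.symm p).2] : Plane) = polarMap p := rfl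
    have hiff : polarMap p ∈ annulus 1 R ↔ p ∈ Ioo 1 R ×ˢ Ioo (-π) π := by
      simp only [annulus, mem_ofPred_eq, norm_polarMap hp0.le, mem_prod, mem_Ioo]
      exact ⟨fun h => ⟨h, hp.2⟩, fun h => h.1⟩
    rw [indicator_of_mem hp, e]
    by_cases hp2 : p ∈ Ioo 1 R ×ˢ Ioo (-π) π
    · rw [indicator_of_mem hp2, indicator_of_mem (hiff.2 hp2)]; rfl
    · rw [indicator_of_notMem hp2, indicator_of_notMem (mt hiff.1 hp2)]; simp
  · rw [indicator_of_notMem hp, indicator_of_notMem (fun h => hp (hsub h))]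

/-- The angular Fourier coefficient of order `m`, as a function of the radius. -/
def angularMode (m : ℤ) (v : Plane → ℂ) (r : ℝ) : ℂ :=
  (2 * π : ℝ)⁻¹ • ∫ θ in Ioo (-π) π, Complex.exp (-(m * θ * Complex.I)) * v (polarMap (r, θ))

/-- Makes Parseval's identity for Fourier series available on each circle. -/
theorem angularMode_eq_fourierCoeffOn (m : ℤ) (v : Plane → ℂ) (r : ℝ) :
    angularMode m v r = fourierCoeffOn (show -π < π by linarith [pi_pos])
      (fun θ => v (polarMap (r, θ))) m := by
  rw [fourierCoeffOn_eq_integral, angularMode, intervalIntegral.integral_of_le (by linarith [pi_pos]),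
    integral_Ioc_eq_integral_Ioo]
  congr 1
  · rw [one_div]; congr 1; ring
  · congr 1; ext θ
    rw [fourier_coe_apply, smul_eq_mul]
    congr 2
    push_cast
    have : (π : ℂ) ≠ 0 := by exact_mod_cast pi_pos.ne'
    rw [sub_neg_eq_add, ← two_mul]
    field_simp

theorem lintegral_polar {R : ℝ} {F : Plane → ENNReal}
    (hF : AEMeasurable F (volume.restrict (annulus 1 R))) :
    ∫⁻ x in annulus 1 R, F x =
      ∫⁻ r, ∫⁻ θ, F (polarMap (r, θ)) ∂angularMeasure ∂radialMeasure R := by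
  have hP := measurePreserving_polarMap R
  rw [← hP.map_eq, lintegral_map' (by rwa [hP.map_eq]) hP.aemeasurable,
    lintegral_prod (fun p => F (polarMap p))
      ((hP.map_eq ▸ hF : AEMeasurable F (Measure.map polarMap _)).comp_aemeasurable
        hP.aemeasurable)]

variable {R : ℝ} {v : Plane → ℂ}

theorem aestronglyMeasurable_comp_polarMap
    (hv : AEStronglyMeasurable v (volume.restrict (annulus 1 R))) :
    AEStronglyMeasurable (fun p => v (polarMap p)) ((radialMeasure R).prod angularMeasure) :=
  hv.comp_measurePreserving (measurePreserving_polarMap R)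

/-- Tonelli: the squared norms on the circles have a finite integral over the radius, so almost all
of them are finite. -/
theorem ae_memLp_polar (hv : MemLp v 2 (volume.restrict (annulus 1 R))) :
    ∀ᵐ r ∂radialMeasure R, MemLp (fun θ => v (polarMap (r, θ))) 2 angularMeasure := by
  have h1 := (aestronglyMeasurable_comp_polarMap hv.1).prodMk_left
  have hfin : ∫⁻ r, ∫⁻ θ, ‖v (polarMap (r, θ))‖ₑ ^ 2 ∂angularMeasure ∂radialMeasure R ≠ ⊤ := by
    rw [← lintegral_polar (F := fun x => ‖v x‖ₑ ^ 2) (hv.1.enorm.pow_const 2)]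
    have := (memLp_two_iff_integrable_sq_norm hv.1).1 hv
    have h2 := this.2
    rw [hasFiniteIntegral_iff_enorm] at h2
    simpa using h2.ne
  have h3 := ae_lt_top' (AEMeasurable.lintegral_prod_right'
    (f := fun p : ℝ × ℝ => ‖v (polarMap p)‖ₑ ^ 2)
    ((aestronglyMeasurable_comp_polarMap hv.1).enorm.pow_const 2)) hfin
  filter_upwards [h1, h3] with r hr1 hr2
  rw [memLp_two_iff_integrable_sq_norm hr1]
  refine ⟨(hr1.norm.pow 2), ?_⟩
  rw [hasFiniteIntegral_iff_enorm]
  simpa using hr2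

theorem aestronglyMeasurable_angularMode (m : ℤ)
    (hv : AEStronglyMeasurable v (volume.restrict (annulus 1 R))) :
    AEStronglyMeasurable (angularMode m v) (radialMeasure R) := by
  suffices AEStronglyMeasurable (fun r => ∫ θ in Ioo (-π) π,
      Complex.exp (-(m * θ * Complex.I)) * v (polarMap (r, θ))) (radialMeasure R) from
    this.const_smul ((2 * π : ℝ)⁻¹)
  refine AEStronglyMeasurable.integral_prod_right'
    (f := fun p : ℝ × ℝ => Complex.exp (-(m * p.2 * Complex.I)) * v (polarMap p)) ?_
  refine AEStronglyMeasurable.mul (Continuous.aestronglyMeasurable (by fun_prop))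
    (aestronglyMeasurable_comp_polarMap hv)

/-- Parseval's identity for the angular Fourier series. -/
theorem lintegral_enorm_sq_eq_tsum (hv : MemLp v 2 (volume.restrict (annulus 1 R))) :
    ∫⁻ x in annulus 1 R, ‖v x‖ₑ ^ 2 =
      ∑' m : ℤ, ENNReal.ofReal (2 * π) * ∫⁻ r, ‖angularMode m v r‖ₑ ^ 2 ∂radialMeasure R := by
  rw [lintegral_polar (F := fun x => ‖v x‖ₑ ^ 2) (hv.1.enorm.pow_const 2)]
  simp_rw [← lintegral_const_mul' _ _ ENNReal.ofReal_ne_top]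
  rw [← lintegral_tsum fun m =>
    ((aestronglyMeasurable_angularMode m hv.1).enorm.pow_const 2).const_mul _]
  refine lintegral_congr_ae ?_
  filter_upwards [ae_memLp_polar hv] with r hr
  have hππ : -π < π := by linarith [pi_pos]
  have hr' : MemLp (fun θ => v (polarMap (r, θ))) 2 (volume.restrict (Ioc (-π) π)) := by
    rwa [← Measure.restrict_congr_set (Ioo_ae_eq_Ioc)]
  have hs := hasSum_sq_fourierCoeffOn hππ hr'
  simp only [← angularMode_eq_fourierCoeffOn] at hs
  have hs2 := hs.mul_left (2 * π)
  have e1 : 2 * π * ((π - -π)⁻¹ • ∫ θ in (-π)..π, ‖v (polarMap (r, θ))‖ ^ 2) =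
      ∫ θ, ‖v (polarMap (r, θ))‖ ^ 2 ∂angularMeasure := by
    rw [intervalIntegral.integral_of_le hππ.le, integral_Ioc_eq_integral_Ioo, smul_eq_mul]
    have := pi_pos
    field_simp
    ring
  rw [e1] at hs2
  have e2 : ∫⁻ θ, ‖v (polarMap (r, θ))‖ₑ ^ 2 ∂angularMeasure =
      ENNReal.ofReal (∫ θ, ‖v (polarMap (r, θ))‖ ^ 2 ∂angularMeasure) := by
    rw [ofReal_integral_eq_lintegral_ofReal ((memLp_two_iff_integrable_sq_norm hr.1).1 hr)
      (Filter.Eventually.of_forall fun _ => by positivity)]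
    refine lintegral_congr fun θ => ?_
    rw [ENNReal.ofReal_pow (norm_nonneg _), ofReal_norm]
  rw [e2, ← hs2.tsum_eq, ENNReal.ofReal_tsum_of_nonneg (fun m => by positivity) hs2.summable]
  refine tsum_congr fun m => ?_
  rw [ENNReal.ofReal_mul (by positivity), ENNReal.ofReal_pow (norm_nonneg _), ofReal_norm]

theorem lintegral_radialMeasure (F : ℝ → ENNReal)
    (hF : AEMeasurable F (volume.restrict (Ioo 1 R))) :
    ∫⁻ r, F r ∂radialMeasure R = ∫⁻ r in Ioo 1 R, ENNReal.ofReal r * F r := by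
  unfold radialMeasure
  rw [lintegral_withDensity_eq_lintegral_mul₀ (by fun_prop) hF]
  rfl

theorem ae_radialMeasure_iff {p : ℝ → Prop} :
    (∀ᵐ r ∂radialMeasure R, p r) ↔ ∀ᵐ r ∂volume.restrict (Ioo 1 R), p r := by
  unfold radialMeasure
  rw [ae_withDensity_iff (by fun_prop)]
  refine ⟨fun h => ?_, fun h => h.mono fun r hr _ => hr⟩
  filter_upwards [h, ae_restrict_mem measurableSet_Ioo] with r hr hr'
  exact hr (by simpa using zero_lt_one.trans hr'.1)

theorem absolutelyContinuous_radialMeasure :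
    volume.restrict (Ioo 1 R) ≪ radialMeasure R := fun _ hs =>
  ae_radialMeasure_iff.1 (measure_eq_zero_iff_ae_notMem.1 hs) |> measure_eq_zero_iff_ae_notMem.2

end Polar

/-! ### Angular modes of square integrable functions -/

section AngularModes

open Set Real

variable {R : ℝ} {v : Plane → ℂ}

instance (R : ℝ) : IsFiniteMeasure (volume.restrict (annulus 1 R)) :=
  ⟨by
    rw [Measure.restrict_apply_univ]
    exact (measure_mono (fun x hx => mem_ball_zero_iff.2 hx.2 : annulus 1 R ⊆ Metric.ball 0 R)).trans_lt
      measure_ball_lt_top⟩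

theorem lintegral_enorm_sq_lt_top (hv : MemLp v 2 (volume.restrict (annulus 1 R))) :
    ∫⁻ x in annulus 1 R, ‖v x‖ₑ ^ 2 < ⊤ := by
  have h2 := ((memLp_two_iff_integrable_sq_norm hv.1).1 hv).2
  rw [hasFiniteIntegral_iff_enorm] at h2
  simpa using h2

theorem lintegral_angularMode_lt_top (m : ℤ) (hv : MemLp v 2 (volume.restrict (annulus 1 R))) :
    ∫⁻ r, ‖angularMode m v r‖ₑ ^ 2 ∂radialMeasure R < ⊤ := by
  have h := lintegral_enorm_sq_lt_top hv
  rw [lintegral_enorm_sq_eq_tsum hv] at h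
  have h2 := ENNReal.ne_top_of_tsum_ne_top h.ne m
  rw [lt_top_iff_ne_top]
  intro h3
  rw [h3] at h2
  exact h2 (ENNReal.mul_top (by simpa using pi_pos))

theorem lintegral_radialMeasure_eq {q : ℝ → ℂ} :
    AEStronglyMeasurable q (volume.restrict (Ioo 1 R)) →
    ∫⁻ r, ‖q r‖ₑ ^ 2 ∂radialMeasure R = ∫⁻ r in Ioo 1 R, ENNReal.ofReal (r * ‖q r‖ ^ 2) := by
  intro hq
  rw [lintegral_radialMeasure _ (hq.enorm.pow_const 2)]
  refine setLIntegral_congr_fun measurableSet_Ioo fun r hr => ?_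
  have : 0 ≤ r := by linarith [hr.1]
  rw [ENNReal.ofReal_mul this, ENNReal.ofReal_pow (norm_nonneg _), ofReal_norm]

theorem aestronglyMeasurable_angularMode_volume (m : ℤ)
    (hv : AEStronglyMeasurable v (volume.restrict (annulus 1 R))) :
    AEStronglyMeasurable (angularMode m v) (volume.restrict (Ioo 1 R)) :=
  (aestronglyMeasurable_angularMode m hv).mono_ac absolutelyContinuous_radialMeasure

theorem memLp_angularMode (m : ℤ) (hv : MemLp v 2 (volume.restrict (annulus 1 R))) :
    MemLp (angularMode m v) 2 (volume.restrict (Ioo 1 R)) := by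
  have hm := aestronglyMeasurable_angularMode_volume m hv.1
  rw [memLp_two_iff_integrable_sq_norm hm]
  refine ⟨hm.norm.pow 2, ?_⟩
  rw [hasFiniteIntegral_iff_enorm]
  refine lt_of_le_of_lt ?_ (lintegral_angularMode_lt_top m hv)
  rw [lintegral_radialMeasure _ (hm.enorm.pow_const 2)]
  refine setLIntegral_mono' measurableSet_Ioo fun r hr => ?_
  rw [enorm_pow, enorm_norm]
  refine le_mul_of_one_le_left zero_le ?_
  rw [ENNReal.one_le_ofReal]
  exact hr.1.le

theorem hasSum_angularMode (hR : 1 ≤ R) (hv : MemLp v 2 (volume.restrict (annulus 1 R))) :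
    HasSum (fun m : ℤ => 2 * π * ∫ r in (1 : ℝ)..R, r * ‖angularMode m v r‖ ^ 2)
      (∫ x in annulus 1 R, ‖v x‖ ^ 2) := by
  have h := lintegral_enorm_sq_lt_top hv
  have e1 : ∫ x in annulus 1 R, ‖v x‖ ^ 2 = (∫⁻ x in annulus 1 R, ‖v x‖ₑ ^ 2).toReal := by
    rw [integral_eq_lintegral_of_nonneg_ae (Filter.Eventually.of_forall fun _ => by positivity)
      (show AEStronglyMeasurable (fun x => ‖v x‖ ^ 2) _ from hv.1.norm.pow 2)]
    congr 1
    refine lintegral_congr fun x => ?_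
    rw [ENNReal.ofReal_pow (norm_nonneg _), ofReal_norm]
  rw [lintegral_enorm_sq_eq_tsum hv] at h e1
  have hs := ENNReal.hasSum_toReal h.ne
  rw [← ENNReal.tsum_toReal_eq fun m => ENNReal.ne_top_of_tsum_ne_top h.ne m, ← e1] at hs
  convert! hs using 2 with m
  have hm := aestronglyMeasurable_angularMode_volume m hv.1
  rw [ENNReal.toReal_mul, ENNReal.toReal_ofReal (by positivity), lintegral_radialMeasure_eq hm,
    intervalIntegral.integral_of_le hR, integral_Ioc_eq_integral_Ioo,
    integral_eq_lintegral_of_nonneg_ae ?_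
      (show AEStronglyMeasurable (fun r => r * ‖angularMode m v r‖ ^ 2) _ from
        AEStronglyMeasurable.mul continuous_id.aestronglyMeasurable (hm.norm.pow 2))]
  filter_upwards [ae_restrict_mem measurableSet_Ioo] with r hr
  have : 0 ≤ r := by linarith [hr.1]
  simp only [Pi.zero_apply]
  positivity

/-- The complex conjugate `x₁ - i x₂` of the point `x`. -/
def conjCoord (x : Plane) : ℂ := (x 0 : ℂ) - Complex.I * (x 1 : ℂ)

theorem continuous_conjCoord : Continuous conjCoord := by unfold conjCoord; fun_prop

theorem norm_conjCoord (x : Plane) : ‖conjCoord x‖ = ‖x‖ := by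
  have h : ‖conjCoord x‖ ^ 2 = ‖x‖ ^ 2 := by
    rw [norm_sq_plane, ← Complex.normSq_eq_norm_sq, Complex.normSq_apply]
    simp [conjCoord]; ring
  exact (pow_left_inj₀ (norm_nonneg _) (norm_nonneg _) two_ne_zero).1 h

theorem conjCoord_polarMap (r θ : ℝ) :
    conjCoord (polarMap (r, θ)) = r * Complex.exp (-(θ * Complex.I)) := by
  rw [← neg_mul, Complex.exp_mul_I, Complex.cos_neg, Complex.sin_neg]
  simp [conjCoord]; ring

theorem conjCoord_ne_zero {x : Plane} (hx : x ∈ annulus 1 R) : conjCoord x ≠ 0 := by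
  rw [← norm_ne_zero_iff, norm_conjCoord]
  linarith [hx.1]

theorem continuousOn_radial_mul_zpow {ψ : ℝ → ℂ} (hψ : ContinuousOn ψ (Icc 1 R)) (m : ℤ) :
    ContinuousOn (fun x : Plane => ψ ‖x‖ * conjCoord x ^ m) (annulus 1 R) := by
  refine ContinuousOn.mul (hψ.comp continuous_norm.continuousOn fun x hx => ⟨hx.1.le, hx.2.le⟩) ?_
  exact continuous_conjCoord.continuousOn.zpow₀ m fun x hx => Or.inl (conjCoord_ne_zero hx)

theorem integrableOn_mul_radial (hv : MemLp v 2 (volume.restrict (annulus 1 R))) {ψ : ℝ → ℂ}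
    (hψ : ContinuousOn ψ (Icc 1 R)) (m : ℤ) :
    IntegrableOn (fun x => v x * (ψ ‖x‖ * conjCoord x ^ m)) (annulus 1 R) := by
  have hne : ∀ r ∈ Icc 1 R, r ≠ 0 ∨ 0 ≤ m := fun r hr => Or.inl (by linarith [hr.1])
  obtain ⟨C, hC⟩ := isCompact_Icc.exists_bound_of_continuousOn
    (f := fun r : ℝ => ‖ψ r‖ * r ^ m) (s := Icc 1 R)
    (hψ.norm.mul (continuousOn_id.zpow₀ m hne))
  have hi : Integrable v (volume.restrict (annulus 1 R)) := hv.integrable (by norm_num)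
  refine hi.mul_bdd (c := C) ((continuousOn_radial_mul_zpow hψ m).aestronglyMeasurable
    (isOpen_annulus 1 R).measurableSet) ?_
  filter_upwards [ae_restrict_mem (isOpen_annulus 1 R).measurableSet] with x hx
  have := hC ‖x‖ ⟨hx.1.le, hx.2.le⟩
  simpa [norm_conjCoord] using this

/-- Integration of an `L²` function against `ψ(r) rᵐ e^{-imθ}`. -/
theorem setIntegral_mul_radial (hv : MemLp v 2 (volume.restrict (annulus 1 R))) {ψ : ℝ → ℂ}
    (hψ : ContinuousOn ψ (Icc 1 R)) (m : ℤ) :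
    ∫ x in annulus 1 R, v x * (ψ ‖x‖ * conjCoord x ^ m) =
      (2 * π : ℝ) • ∫ r in Ioo 1 R, angularMode m v r * ((r : ℂ) ^ (m + 1) * ψ r) := by
  have hP := measurePreserving_polarMap R
  have hint := integrableOn_mul_radial hv hψ m
  have hint2 : Integrable (fun p => v (polarMap p) * (ψ ‖polarMap p‖ * conjCoord (polarMap p) ^ m))
      ((radialMeasure R).prod angularMeasure) := hP.integrable_comp_of_integrable hint
  have e0 : ∫ x in annulus 1 R, v x * (ψ ‖x‖ * conjCoord x ^ m) =
      ∫ p, v (polarMap p) * (ψ ‖polarMap p‖ * conjCoord (polarMap p) ^ m)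
        ∂((radialMeasure R).prod angularMeasure) := by
    conv_lhs => rw [← hP.map_eq]
    exact integral_map hP.aemeasurable (by rw [hP.map_eq]; exact hint.1)
  rw [e0, integral_prod _ hint2, ← integral_smul]
  unfold radialMeasure
  rw [integral_withDensity_eq_integral_toReal_smul (by fun_prop) (by simp)]
  refine setIntegral_congr_fun measurableSet_Ioo fun r hr => ?_
  have hr0 : 0 < r := by linarith [hr.1]
  have hrc : (r : ℂ) ≠ 0 := by exact_mod_cast hr0.ne'
  have e1 : ∀ θ : ℝ, v (polarMap (r, θ)) * (ψ ‖polarMap (r, θ)‖ * conjCoord (polarMap (r, θ)) ^ m) =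
      ((r : ℂ) ^ m * ψ r) * (Complex.exp (-(m * θ * Complex.I)) * v (polarMap (r, θ))) := fun θ => by
    rw [norm_polarMap hr0.le, conjCoord_polarMap, mul_zpow, ← Complex.exp_int_mul,
      show (m : ℂ) * -(θ * Complex.I) = -(m * θ * Complex.I) by ring]
    ring
  simp only [e1]
  rw [integral_const_mul, ENNReal.toReal_ofReal hr0.le, angularMode, zpow_add_one₀ hrc]
  simp only [Complex.real_smul]
  have : (π : ℂ) ≠ 0 := by exact_mod_cast pi_pos.ne'
  generalize (∫ θ in Ioo (-π) π, Complex.exp (-(m * θ * Complex.I)) * v (polarMap (r, θ))) = z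
  push_cast
  field_simp

/-- Linearity holds only on circles where both functions are integrable, that is, for almost every
radius. -/
theorem angularMode_sub_ae (m : ℤ) {w : Plane → ℂ}
    (hv : MemLp v 2 (volume.restrict (annulus 1 R)))
    (hw : MemLp w 2 (volume.restrict (annulus 1 R))) :
    ∀ᵐ r ∂volume.restrict (Ioo 1 R),
      angularMode m (fun x => v x - w x) r = angularMode m v r - angularMode m w r := by
  have hi : ∀ {q : Plane → ℂ} {r : ℝ}, MemLp (fun θ => q (polarMap (r, θ))) 2 angularMeasure →
      Integrable (fun θ : ℝ => Complex.exp (-(m * θ * Complex.I)) * q (polarMap (r, θ)))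
        angularMeasure := fun {q r} hq =>
    (hq.integrable (by norm_num)).bdd_mul (c := 1)
      (Continuous.aestronglyMeasurable (by fun_prop)) (Filter.Eventually.of_forall fun θ => by
        rw [show -((m : ℂ) * θ * Complex.I) = ((-(m * θ) : ℝ) : ℂ) * Complex.I by push_cast; ring,
          Complex.norm_exp_ofReal_mul_I])
  filter_upwards [ae_radialMeasure_iff.1 (ae_memLp_polar hv),
    ae_radialMeasure_iff.1 (ae_memLp_polar hw)] with r h1 h2
  simp only [angularMode]
  rw [← smul_sub, ← integral_sub (hi h1) (hi h2)]
  congr 2; ext θ; ring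

theorem integral_exp_int_mul (n : ℤ) :
    ∫ θ in Ioo (-π) π, Complex.exp (n * θ * Complex.I) = if n = 0 then (2 * π : ℂ) else 0 := by
  rw [← integral_Ioc_eq_integral_Ioo, ← intervalIntegral.integral_of_le (by linarith [pi_pos])]
  split_ifs with hn
  · simp [hn]; ring
  · have h1 : (n : ℂ) * Complex.I ≠ 0 := mul_ne_zero (by exact_mod_cast hn) Complex.I_ne_zero
    have e : ∀ θ : ℝ, (n : ℂ) * θ * Complex.I = (n * Complex.I) * θ := fun θ => by ring
    simp only [e]
    rw [integral_exp_mul_complex h1]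
    have : Complex.exp (n * Complex.I * (π : ℝ)) = Complex.exp (n * Complex.I * (-π : ℝ)) := by
      rw [Complex.exp_eq_exp_iff_exists_int]
      exact ⟨n, by push_cast; ring⟩
    rw [this, sub_self, zero_div]

/-- The angular modes of `ρ(r) e^{-iθ}`. -/
theorem angularMode_radial (m : ℤ) (ρ : ℝ → ℂ) {r : ℝ} (hr : 0 < r) :
    angularMode m (fun x => ρ ‖x‖ * (conjCoord x / ‖x‖)) r = if m = -1 then ρ r else 0 := by
  have hrc : (r : ℂ) ≠ 0 := by exact_mod_cast hr.ne'
  have hπ : (π : ℂ) ≠ 0 := by exact_mod_cast pi_pos.ne'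
  have e : ∀ θ : ℝ, Complex.exp (-(m * θ * Complex.I)) *
      (ρ ‖polarMap (r, θ)‖ * (conjCoord (polarMap (r, θ)) / ‖polarMap (r, θ)‖)) =
      ρ r * Complex.exp ((-(m + 1) : ℤ) * θ * Complex.I) := fun θ => by
    rw [norm_polarMap hr.le, conjCoord_polarMap]
    simp only
    rw [mul_div_cancel_left₀ _ hrc, show ((-(m + 1) : ℤ) : ℂ) * θ * Complex.I =
        -(m * θ * Complex.I) + -(θ * Complex.I) by push_cast; ring, Complex.exp_add]
    ring
  simp only [angularMode, e]
  rw [integral_const_mul, integral_exp_int_mul, Complex.real_smul]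
  by_cases hm : m = -1
  · simp [hm]; field_simp
  · rw [if_neg hm, if_neg (by omega)]; simp

end AngularModes

/-! ### Test fields of fixed angular momentum -/

section TestFunctions

open Set Real

variable {R : ℝ}

theorem contDiff_of_forall_tsupport {E F : Type*} [NormedAddCommGroup E] [NormedSpace ℝ E]
    [NormedAddCommGroup F] [NormedSpace ℝ F] {f : E → F}
    (h : ∀ x ∈ tsupport f, ContDiffAt ℝ ∞ f x) : ContDiff ℝ ∞ f := by
  rw [contDiff_iff_contDiffAt]
  intro x
  by_cases hx : x ∈ tsupport f
  · exact h x hx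
  · exact contDiffAt_const.congr_of_eventuallyEq (notMem_tsupport_iff_eventuallyEq.1 hx)

/-- The coordinate `x₁ - i x₂` as a continuous linear map. -/
def conjCoordCLM : Plane →L[ℝ] ℂ :=
  Complex.ofRealCLM ∘L EuclideanSpace.proj 0 -
    Complex.I • (Complex.ofRealCLM ∘L EuclideanSpace.proj 1)

theorem conjCoordCLM_apply (x : Plane) : conjCoordCLM x = conjCoord x := by
  simp [conjCoordCLM, conjCoord]

/-- Rotation by a right angle. -/
def rot (x : Plane) : Plane := !₂[-(x 1), x 0]

theorem contDiffAt_conjCoord_zpow {x : Plane} (hx : conjCoord x ≠ 0) (m : ℤ) :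
    ContDiffAt ℝ ∞ (fun x => conjCoord x ^ m) x := by
  have h1 : ContDiffAt ℝ ∞ (fun z : ℂ => z ^ m) (conjCoord x) :=
    ((analyticAt_id.zpow (n := m) hx).contDiffAt (𝕜 := ℂ)).restrict_scalars ℝ
  have h2 : ContDiffAt ℝ ∞ conjCoord x := by
    have : conjCoord = conjCoordCLM := funext fun x => (conjCoordCLM_apply x).symm
    rw [this]; exact conjCoordCLM.contDiff.contDiffAt
  exact h1.comp x h2

/-- The function `η(r) rᵐ e^{-imθ}`. -/
def modeFunction (m : ℤ) (η : ℝ → ℝ) (x : Plane) : ℂ := (η ‖x‖ : ℂ) * conjCoord x ^ m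

theorem tsupport_comp_norm_subset (η : ℝ → ℝ) :
    tsupport (fun x : Plane => (η ‖x‖ : ℂ)) ⊆ {x | ‖x‖ ∈ tsupport η} := by
  refine closure_minimal (fun x hx => subset_tsupport η fun h => hx ?_)
    ((isClosed_tsupport η).preimage continuous_norm)
  simp [h]

theorem tsupport_modeFunction_subset (m : ℤ) (η : ℝ → ℝ) :
    tsupport (modeFunction m η) ⊆ {x | ‖x‖ ∈ tsupport η} :=
  tsupport_mul_subset_left.trans (tsupport_comp_norm_subset η)

/-- The norm and the negative powers of $x_1-ix_2$ are singular only at the origin, from which the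
support of $\eta(|x|)$ stays away. The linear factor $c$ allows for the components of the fields $x$
and its rotation. -/
theorem isTestFunction_mul_modeFunction (m : ℤ) {η : ℝ → ℝ} (hη : ContDiff ℝ ∞ η)
    (hs : tsupport η ⊆ Ioo 1 R) (c : Plane →L[ℝ] ℝ) :
    IsTestFunction (annulus 1 R) (fun x => (c x : ℂ) * modeFunction m η x) := by
  have hsub : tsupport (fun x => (c x : ℂ) * modeFunction m η x) ⊆ {x | ‖x‖ ∈ tsupport η} :=
    tsupport_mul_subset_right.trans (tsupport_modeFunction_subset m η)
  have hΩ : tsupport (fun x => (c x : ℂ) * modeFunction m η x) ⊆ annulus 1 R :=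
    hsub.trans fun x hx => hs hx
  refine ⟨contDiff_of_forall_tsupport fun x hx => ?_, ?_, hΩ⟩
  · have hx' := hΩ hx
    have hx0 : x ≠ 0 := norm_ne_zero_iff.1 (by linarith [hx'.1])
    have h1 : ContDiffAt ℝ ∞ (fun x : Plane => (η ‖x‖ : ℂ)) x :=
      Complex.ofRealCLM.contDiff.contDiffAt.comp x
        (hη.contDiffAt.comp x (contDiffAt_norm ℝ hx0))
    have h2 : ContDiffAt ℝ ∞ (fun x : Plane => (c x : ℂ)) x :=
      (Complex.ofRealCLM.contDiff.comp c.contDiff).contDiffAt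
    exact h2.mul (h1.mul (contDiffAt_conjCoord_zpow (conjCoord_ne_zero hx') m))
  · refine HasCompactSupport.of_support_subset_isCompact (isCompact_closedBall (0 : Plane) R)
      ((subset_tsupport _).trans (hΩ.trans fun x hx => ?_))
    exact mem_closedBall_zero_iff.2 hx.2.le

theorem hasFDerivAt_norm_plane {x : Plane} (hx : x ≠ 0) :
    HasFDerivAt (fun x : Plane => ‖x‖) (‖x‖⁻¹ • innerSL ℝ x) x := by
  have hx' := norm_pos_iff.2 hx
  have h := (hasStrictFDerivAt_norm_sq x).hasFDerivAt.sqrt (by positivity)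
  simp only [Real.sqrt_sq (norm_nonneg _)] at h
  convert! h using 1
  ext v
  simp
  field_simp

/-- The derivatives along $x$ and along its rotation are $r\partial_r$ and $\partial_\theta$, which
act on $\eta(r)r^me^{-im\theta}$ by explicit factors. These two directions suffice for the
divergences needed below. -/
theorem hasFDerivAt_modeFunction (m : ℤ) {η : ℝ → ℝ} {η' : ℝ} {x : Plane}
    (hη : HasDerivAt η η' ‖x‖) (hx : x ∈ annulus 1 R) :
    ∃ L : Plane →L[ℝ] ℂ, HasFDerivAt (modeFunction m η) L x ∧
      L x = ((m : ℂ) * η ‖x‖ + ‖x‖ * η') * conjCoord x ^ m ∧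
      L (rot x) = -Complex.I * m * modeFunction m η x := by
  have hx0 : x ≠ 0 := norm_ne_zero_iff.1 (by linarith [hx.1])
  have hz := conjCoord_ne_zero hx
  have hn : (‖x‖ : ℂ) ≠ 0 := by exact_mod_cast norm_ne_zero_iff.2 hx0
  have h1 := Complex.ofRealCLM.hasFDerivAt.comp x (hη.comp_hasFDerivAt x
    (hasFDerivAt_norm_plane hx0))
  have h2 : HasFDerivAt (fun x => conjCoord x ^ m)
      (((m : ℂ) * conjCoord x ^ (m - 1)) • conjCoordCLM) x := by
    have h3 : HasFDerivAt conjCoord conjCoordCLM x := by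
      have : conjCoord = conjCoordCLM := funext fun x => (conjCoordCLM_apply x).symm
      rw [this]; exact conjCoordCLM.hasFDerivAt
    exact (hasDerivAt_zpow m (conjCoord x) (Or.inl hz)).comp_hasFDerivAt x h3
  have h4 := h1.mul h2
  have hzm : conjCoord x ^ (m - 1) * conjCoord x = conjCoord x ^ m := by
    rw [← zpow_add_one₀ hz, sub_add_cancel]
  refine ⟨_, h4, ?_, ?_⟩
  · simp [conjCoordCLM_apply]
    rw [← hzm]
    field_simp
  · have e1 : conjCoord (rot x) = -Complex.I * conjCoord x := by
      simp [conjCoord, rot]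
      linear_combination -(x 1 : ℂ) * Complex.I_sq
    have e2 : (inner ℝ x (rot x) : ℝ) = 0 := by
      simp [rot, PiLp.inner_apply, Fin.sum_univ_two]; ring
    simp [conjCoordCLM_apply, e1, e2, modeFunction]
    rw [← hzm]
    ring

theorem partialDeriv_mul_modeFunction {m : ℤ} {η : ℝ → ℝ} {x : Plane} {L : Plane →L[ℝ] ℂ}
    (hL : HasFDerivAt (modeFunction m η) L x) (c : Plane →L[ℝ] ℝ) (j : Fin 2) :
    partialDeriv j (fun x => (c x : ℂ) * modeFunction m η x) x =
      (c (EuclideanSpace.single j 1) : ℂ) * modeFunction m η x +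
        (c x : ℂ) * L (EuclideanSpace.single j 1) := by
  have h1 : HasFDerivAt (fun x => (c x : ℂ)) (Complex.ofRealCLM ∘L c) x :=
    (Complex.ofRealCLM ∘L c).hasFDerivAt
  rw [partialDeriv, (h1.fun_mul hL).fderiv]
  simp
  ring

theorem plane_eq_sum (x : Plane) :
    x = x 0 • EuclideanSpace.single 0 1 + x 1 • EuclideanSpace.single 1 1 := by
  ext j; fin_cases j <;> simp

theorem rot_eq_sum (x : Plane) :
    rot x = -(x 1) • EuclideanSpace.single 0 1 + x 0 • EuclideanSpace.single 1 1 := by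
  ext j; fin_cases j <;> simp [rot]

/-- The coordinate functionals. -/
abbrev coordCLM (j : Fin 2) : Plane →L[ℝ] ℝ := EuclideanSpace.proj j

variable {u : L2 (annulus 1 R)} {G : Fin 2 → L2 (annulus 1 R)}

theorem HasMagneticGradient.sum_test (h : HasMagneticGradient (annulus 1 R) uniformPotential u G)
    {φ : Fin 2 → Plane → ℂ} (hφ : ∀ j, IsTestFunction (annulus 1 R) (φ j)) :
    ∫ x in annulus 1 R, (G 0 x * φ 0 x + G 1 x * φ 1 x) =
      ∫ x in annulus 1 R, u x * (Complex.I * (partialDeriv 0 (φ 0) x + partialDeriv 1 (φ 1) x) +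
        ((-(x 1) / 2 : ℝ) : ℂ) * φ 0 x + ((x 0 / 2 : ℝ) : ℂ) * φ 1 x) := by
  have hG := fun j => integrable_mul_of_hasCompactSupport (G j) (hφ j).1.continuous (hφ j).2.1
  have hu := fun j => integrable_mul_of_hasCompactSupport u
    ((hφ j).continuous_symbol uniformPotential Complex.I j)
    ((hφ j).hasCompactSupport_symbol uniformPotential Complex.I j)
  rw [integral_add (hG 0) (hG 1), ← h 0 _ (hφ 0), ← h 1 _ (hφ 1), ← integral_add (hu 0) (hu 1)]
  congr 1; ext x
  have e0 : uniformPotential x 0 = -(x 1) / 2 := rfl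
  have e1 : uniformPotential x 1 = x 0 / 2 := rfl
  rw [e0, e1]
  ring

/-- Tests with the field $x\,\eta(r)\bar z^m$, where $\bar z=x_1-ix_2$. Its divergence is
$((m+2)\eta+r\eta')\bar z^m$, and the potential drops out because $\mathbf F(x)\cdot x=0$. -/
theorem HasMagneticGradient.radial_test (h : HasMagneticGradient (annulus 1 R) uniformPotential u G)
    (m : ℤ) {η : ℝ → ℝ} (hη : ContDiff ℝ ∞ η) (hs : tsupport η ⊆ Ioo 1 R) :
    ∫ x in annulus 1 R, (G 0 x * x 0 + G 1 x * x 1) * modeFunction m η x =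
      ∫ x in annulus 1 R, u x * (Complex.I * (((m : ℂ) + 2) * η ‖x‖ + ‖x‖ * deriv η ‖x‖) *
        conjCoord x ^ m) := by
  have key := h.sum_test (φ := fun j x => (coordCLM j x : ℂ) * modeFunction m η x)
    fun j => isTestFunction_mul_modeFunction m hη hs (coordCLM j)
  have hΩ := (isOpen_annulus 1 R).measurableSet
  calc _ = _ := ?_
    _ = _ := key
    _ = _ := ?_
  · congr 1; ext x; simp; ring
  · refine setIntegral_congr_fun hΩ fun x hx => ?_
    obtain ⟨L, hL, hLx, -⟩ := hasFDerivAt_modeFunction (R := R) m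
      ((hη.differentiable (by simp)) ‖x‖).hasDerivAt hx
    simp only [partialDeriv_mul_modeFunction hL]
    have e : L x = x 0 * L (EuclideanSpace.single 0 1) + x 1 * L (EuclideanSpace.single 1 1) := by
      conv_lhs => rw [plane_eq_sum x]
      simp
    rw [hLx] at e
    simp [modeFunction]
    left
    linear_combination (-Complex.I) * e

/-- Tests with the rotated field $(-x_2,x_1)\,\eta(r)\bar z^m$. As $(-x_2,x_1)$ is divergence free,
only the angular derivative of $\bar z^m$ remains, and $\mathbf F(x)\cdot(-x_2,x_1)=r^2/2$. -/
theorem HasMagneticGradient.angular_test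
    (h : HasMagneticGradient (annulus 1 R) uniformPotential u G)
    (m : ℤ) {η : ℝ → ℝ} (hη : ContDiff ℝ ∞ η) (hs : tsupport η ⊆ Ioo 1 R) :
    ∫ x in annulus 1 R, (-(G 0 x * x 1) + G 1 x * x 0) * modeFunction m η x =
      ∫ x in annulus 1 R, u x * ((((m : ℂ) + ‖x‖ ^ 2 / 2) * η ‖x‖) * conjCoord x ^ m) := by
  have key := h.sum_test
    (φ := ![fun x => ((-coordCLM 1) x : ℂ) * modeFunction m η x,
      fun x => (coordCLM 0 x : ℂ) * modeFunction m η x])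
    (Fin.forall_fin_two.2 ⟨isTestFunction_mul_modeFunction m hη hs (-coordCLM 1),
      isTestFunction_mul_modeFunction m hη hs (coordCLM 0)⟩)
  have hΩ := (isOpen_annulus 1 R).measurableSet
  calc _ = _ := ?_
    _ = _ := key
    _ = _ := ?_
  · congr 1; ext x; simp; ring
  · refine setIntegral_congr_fun hΩ fun x hx => ?_
    obtain ⟨L, hL, -, hLx⟩ := hasFDerivAt_modeFunction (R := R) m
      ((hη.differentiable (by simp)) ‖x‖).hasDerivAt hx
    simp only [Matrix.cons_val_zero, Matrix.cons_val_one, partialDeriv_mul_modeFunction hL]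
    have e : L (rot x) = -(x 1) * L (EuclideanSpace.single 0 1) +
        x 0 * L (EuclideanSpace.single 1 1) := by
      conv_lhs => rw [rot_eq_sum x]
      simp
    rw [hLx] at e
    have en : (‖x‖ : ℂ) ^ 2 = (x 0 : ℂ) ^ 2 + (x 1 : ℂ) ^ 2 := by
      exact_mod_cast norm_sq_plane x
    rw [en]
    simp [modeFunction] at e ⊢
    left
    linear_combination (-Complex.I) * e - m * (η ‖x‖ : ℂ) * conjCoord x ^ m * Complex.I_sq

end TestFunctions

/-! ### The radial equations satisfied by each mode -/

section ModeEquations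

open Set Real

variable {R : ℝ}

theorem contDiff_zpow_mul {ξ : ℝ → ℝ} (hξ : ContDiff ℝ ∞ ξ) (hs : tsupport ξ ⊆ Ioo 1 R) (n : ℤ) :
    ContDiff ℝ ∞ (fun r => r ^ n * ξ r) := by
  refine contDiff_of_forall_tsupport fun r hr => ?_
  have hr' := hs (tsupport_mul_subset_right hr)
  have hr0 : r ≠ 0 := by linarith [hr'.1]
  exact ((analyticAt_id.zpow (n := n) hr0).contDiffAt (𝕜 := ℝ)).mul hξ.contDiffAt

theorem deriv_zpow_mul {ξ : ℝ → ℝ} (hξ : ContDiff ℝ ∞ ξ) (n : ℤ) {r : ℝ} (hr : r ≠ 0) :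
    deriv (fun r => r ^ n * ξ r) r = n * r ^ (n - 1) * ξ r + r ^ n * deriv ξ r :=
  ((hasDerivAt_zpow n r (Or.inl hr)).fun_mul
    ((hξ.differentiable (by simp)) r).hasDerivAt).deriv

/-- The radial component of a vector field. -/
def radialPart (G : Fin 2 → Plane → ℂ) (x : Plane) : ℂ :=
  (G 0 x * x 0 + G 1 x * x 1) / ‖x‖

/-- The angular component of a vector field. -/
def angularPart (G : Fin 2 → Plane → ℂ) (x : Plane) : ℂ :=
  (-(G 0 x * x 1) + G 1 x * x 0) / ‖x‖

theorem norm_sq_radialPart_add (G : Fin 2 → Plane → ℂ) {x : Plane} (hx : x ≠ 0) :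
    ‖radialPart G x‖ ^ 2 + ‖angularPart G x‖ ^ 2 = ‖G 0 x‖ ^ 2 + ‖G 1 x‖ ^ 2 := by
  have hn : 0 < ‖x‖ := norm_pos_iff.2 hx
  have h2 := norm_sq_plane x
  rw [radialPart, angularPart, norm_div, norm_div, div_pow, div_pow, Complex.norm_real, norm_norm,
    ← add_div, div_eq_iff (by positivity), h2]
  simp only [← Complex.normSq_eq_norm_sq, Complex.normSq_apply]
  simp
  ring

theorem norm_coord_le (x : Plane) (j : Fin 2) : |x j| ≤ ‖x‖ := by
  simpa using EuclideanSpace.norm_eq x ▸ PiLp.norm_apply_le x j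

theorem memLp_radialPart {G : Fin 2 → Plane → ℂ} {s : Set Plane}
    (hG : ∀ j, MemLp (G j) 2 (volume.restrict s)) :
    MemLp (radialPart G) 2 (volume.restrict s) ∧ MemLp (angularPart G) 2 (volume.restrict s) := by
  have h0 := (hG 0).1
  have h1 := (hG 1).1
  have hc : ∀ j, AEStronglyMeasurable (fun x : Plane => (x j : ℂ)) (volume.restrict s) := fun j =>
    Continuous.aestronglyMeasurable (by fun_prop)
  have hn : AEStronglyMeasurable (fun x : Plane => ((‖x‖ : ℂ))⁻¹) (volume.restrict s) :=
    (by fun_prop : Measurable fun x : Plane => ((‖x‖ : ℂ))⁻¹).aestronglyMeasurable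
  have hsum : MemLp (fun x => ‖G 0 x‖ + ‖G 1 x‖) 2 (volume.restrict s) := (hG 0).norm.add (hG 1).norm
  have hb : ∀ (a b : ℂ) (x : Plane) (i j : Fin 2),
      ‖(a * (x i : ℂ) + b * (x j : ℂ)) / ‖x‖‖ ≤ ‖a‖ + ‖b‖ := fun a b x i j => by
    rw [norm_div, Complex.norm_real, norm_norm]
    refine div_le_of_le_mul₀ (norm_nonneg _) (by positivity) ((norm_add_le _ _).trans ?_)
    rw [norm_mul, norm_mul, Complex.norm_real, Complex.norm_real, Real.norm_eq_abs,
      Real.norm_eq_abs, add_mul]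
    gcongr <;> exact norm_coord_le x _
  constructor
  · refine hsum.of_le (((h0.mul (hc 0)).add (h1.mul (hc 1))).mul hn)
      (Filter.Eventually.of_forall fun x => ?_)
    rw [Real.norm_of_nonneg (by positivity : 0 ≤ ‖G 0 x‖ + ‖G 1 x‖)]
    exact hb _ _ x 0 1
  · refine hsum.of_le (((h0.mul (hc 1)).neg.add (h1.mul (hc 0))).mul hn)
      (Filter.Eventually.of_forall fun x => ?_)
    rw [Real.norm_of_nonneg (by positivity : 0 ≤ ‖G 0 x‖ + ‖G 1 x‖)]
    have := hb (-(G 0 x)) (G 1 x) x 1 0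
    rw [norm_neg, neg_mul] at this
    exact this

variable {u : L2 (annulus 1 R)} {G : Fin 2 → L2 (annulus 1 R)}

/-- The weak form of $u_m'=iG_{r,m}$, since the radial component of the magnetic gradient is
$-i\partial_ru$. -/
theorem HasMagneticGradient.radial_mode
    (h : HasMagneticGradient (annulus 1 R) uniformPotential u G) (m : ℤ) {ξ : ℝ → ℝ}
    (hξ : ContDiff ℝ ∞ ξ) (hs : tsupport ξ ⊆ Ioo 1 R) :
    ∫ r in Ioo 1 R, angularMode m u r * ((deriv ξ r : ℝ) : ℂ) =
      -∫ r in Ioo 1 R, (Complex.I * angularMode m (radialPart fun j => G j) r) * (ξ r : ℂ) := by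
  -- The exponent $-(m+2)$ cancels $r^{m+1}$ from polar integration and the extra $r$ of the field
  -- $x$. It also makes the zero order terms in $(m+2)\eta+r\eta'$ cancel, leaving only $\xi'$.
  have hη := contDiff_zpow_mul hξ hs (-(m + 2))
  set η : ℝ → ℝ := fun r => r ^ (-(m + 2)) * ξ r with hηdef
  have hηs : tsupport η ⊆ Ioo 1 R := tsupport_mul_subset_right.trans hs
  have hΩ := (isOpen_annulus 1 R).measurableSet
  have key := h.radial_test m hη hηs
  have e1 : ∫ x in annulus 1 R, ((G 0 x * x 0 + G 1 x * x 1) * modeFunction m η x) =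
      ∫ x in annulus 1 R, radialPart (fun j => G j) x *
        ((fun r : ℝ => (r : ℂ) * (η r : ℂ)) ‖x‖ * conjCoord x ^ m) := by
    refine setIntegral_congr_fun hΩ fun x hx => ?_
    have hn : (‖x‖ : ℂ) ≠ 0 := by exact_mod_cast (zero_lt_one.trans hx.1).ne'
    simp only [radialPart, modeFunction]
    field_simp
  have e2 : ∫ x in annulus 1 R, u x * (Complex.I * (((m : ℂ) + 2) * η ‖x‖ + ‖x‖ * deriv η ‖x‖) *
        conjCoord x ^ m) = ∫ x in annulus 1 R, u x *
        ((fun r : ℝ => Complex.I * (((m : ℂ) + 2) * η r + r * deriv η r)) ‖x‖ * conjCoord x ^ m) := rfl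
  have hηc := hη.continuous
  have hηd := hη.continuous_deriv (by simp)
  rw [e1, e2, setIntegral_mul_radial (ψ := fun r : ℝ => (r : ℂ) * (η r : ℂ))
      (memLp_radialPart fun j => Lp.memLp (G j)).1 (by fun_prop) m,
    setIntegral_mul_radial (ψ := fun r : ℝ => Complex.I * (((m : ℂ) + 2) * η r + r * deriv η r))
      (Lp.memLp u) (by fun_prop) m] at key
  have key2 := smul_right_injective ℂ (show (2 * π : ℝ) ≠ 0 by positivity) key
  have e3 : ∫ r in Ioo 1 R, angularMode m (radialPart fun j => G j) r *
      ((r : ℂ) ^ (m + 1) * ((r : ℂ) * (η r : ℂ))) =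
      ∫ r in Ioo 1 R, angularMode m (radialPart fun j => G j) r * (ξ r : ℂ) := by
    refine setIntegral_congr_fun measurableSet_Ioo fun r hr => ?_
    have hr0 : (r : ℂ) ≠ 0 := by exact_mod_cast (zero_lt_one.trans hr.1).ne'
    simp only [hηdef]
    push_cast
    have : (r : ℂ) ^ (m + 1) * (r * (r ^ (-(m + 2)) * ξ r)) = ξ r := by
      rw [← mul_assoc, ← zpow_add_one₀ hr0, ← mul_assoc, ← zpow_add₀ hr0,
        show m + 1 + 1 + -(m + 2) = 0 by ring, zpow_zero, one_mul]
    rw [this]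
  have e4 : ∫ r in Ioo 1 R, angularMode m u r *
      ((r : ℂ) ^ (m + 1) * (Complex.I * (((m : ℂ) + 2) * η r + r * deriv η r))) =
      ∫ r in Ioo 1 R, Complex.I * (angularMode m u r * ((deriv ξ r : ℝ) : ℂ)) := by
    refine setIntegral_congr_fun measurableSet_Ioo fun r hr => ?_
    have hr0' : r ≠ 0 := (zero_lt_one.trans hr.1).ne'
    have hr0 : (r : ℂ) ≠ 0 := by exact_mod_cast hr0'
    simp only [hηdef, deriv_zpow_mul hξ _ hr0']
    have h1 : (r : ℂ) ^ (m + 1) * r ^ (-(m + 2)) = (r : ℂ)⁻¹ := by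
      rw [← zpow_add₀ hr0, show m + 1 + -(m + 2) = -1 by ring, zpow_neg_one]
    have h2 : (r : ℂ) ^ (-(m + 2) - 1) = r ^ (-(m + 2)) * (r : ℂ)⁻¹ := zpow_sub_one₀ hr0 _
    push_cast
    rw [h2]
    have : (r : ℂ) ^ (m + 1) * (Complex.I * (((m : ℂ) + 2) * (r ^ (-(m + 2)) * ξ r) +
        r * (-(m + 2) * (r ^ (-(m + 2)) * (r : ℂ)⁻¹) * ξ r + r ^ (-(m + 2)) * deriv ξ r))) =
        ((r : ℂ) ^ (m + 1) * r ^ (-(m + 2))) * r * (Complex.I * (deriv ξ r : ℝ)) := by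
      field_simp
      ring
    rw [this, h1, inv_mul_cancel₀ hr0]
    ring
  rw [e3, e4, integral_const_mul] at key2
  have e5 : ∫ r in Ioo 1 R, (Complex.I * angularMode m (radialPart fun j => G j) r) * (ξ r : ℂ) =
      Complex.I * ∫ r in Ioo 1 R, angularMode m (radialPart fun j => G j) r * (ξ r : ℂ) := by
    rw [← integral_const_mul]
    congr 1; ext r; ring
  rw [e5, key2, ← mul_assoc, Complex.I_mul_I]
  ring

/-- The angular derivative acts on mode $m$ as a multiplier, so the tested equation contains no
radial derivative and can be localised to almost every radius. -/
theorem HasMagneticGradient.angular_mode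
    (h : HasMagneticGradient (annulus 1 R) uniformPotential u G) (m : ℤ) :
    ∀ᵐ r ∂volume.restrict (Ioo 1 R), angularMode m (angularPart fun j => G j) r =
      (((m : ℝ) / r + r / 2 : ℝ) : ℂ) * angularMode m u r := by
  have hΩ := (isOpen_annulus 1 R).measurableSet
  have hA := memLp_angularMode m (memLp_radialPart fun j => Lp.memLp (G j)).2
  have hU := memLp_angularMode m (Lp.memLp u)
  have hAi := hA.integrable (by norm_num)
  have hUi := hU.integrable (by norm_num)
  have hne : ∀ r ∈ Icc 1 R, r ≠ 0 := fun r hr => by linarith [hr.1]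
  have hcont : ContinuousOn (fun r : ℝ => (((m : ℝ) / r + r / 2 : ℝ) : ℂ)) (Icc 1 R) := by
    refine Complex.continuous_ofReal.comp_continuousOn ?_
    fun_prop (disch := assumption)
  have hWi : Integrable (fun r => (((m : ℝ) / r + r / 2 : ℝ) : ℂ) * angularMode m u r)
      (volume.restrict (Ioo 1 R)) := by
    obtain ⟨C, hC⟩ := isCompact_Icc.exists_bound_of_continuousOn hcont
    refine hUi.bdd_mul (c := C) ((hcont.mono Ioo_subset_Icc_self).aestronglyMeasurable
      measurableSet_Ioo) ?_
    filter_upwards [ae_restrict_mem measurableSet_Ioo] with r hr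
    exact hC r (Ioo_subset_Icc_self hr)
  have := isOpen_Ioo.ae_eq_zero_of_integral_contDiff_smul_eq_zero (μ := volume.restrict (Ioo 1 R))
    (U := Ioo 1 R) (f := fun r => angularMode m (angularPart fun j => G j) r -
      (((m : ℝ) / r + r / 2 : ℝ) : ℂ) * angularMode m u r)
    ((hAi.sub hWi).locallyIntegrable.locallyIntegrableOn _) fun ξ hξ hξc hs => ?_
  · filter_upwards [this, ae_restrict_mem measurableSet_Ioo] with r hr hr'
    exact sub_eq_zero.1 (hr hr')
  have hη := contDiff_zpow_mul hξ hs (-(m + 2))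
  set η : ℝ → ℝ := fun r => r ^ (-(m + 2)) * ξ r with hηdef
  have hηs : tsupport η ⊆ Ioo 1 R := tsupport_mul_subset_right.trans hs
  have key := h.angular_test m hη hηs
  have e1 : ∫ x in annulus 1 R, ((-(G 0 x * x 1) + G 1 x * x 0) * modeFunction m η x) =
      ∫ x in annulus 1 R, angularPart (fun j => G j) x *
        ((fun r : ℝ => (r : ℂ) * (η r : ℂ)) ‖x‖ * conjCoord x ^ m) := by
    refine setIntegral_congr_fun hΩ fun x hx => ?_
    have hn : (‖x‖ : ℂ) ≠ 0 := by exact_mod_cast (zero_lt_one.trans hx.1).ne'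
    simp only [angularPart, modeFunction]
    field_simp
  have e2 : ∫ x in annulus 1 R, u x * ((((m : ℂ) + ‖x‖ ^ 2 / 2) * η ‖x‖) * conjCoord x ^ m) =
      ∫ x in annulus 1 R, u x *
        ((fun r : ℝ => ((m : ℂ) + r ^ 2 / 2) * η r) ‖x‖ * conjCoord x ^ m) := rfl
  have hηc := hη.continuous
  rw [e1, e2, setIntegral_mul_radial (ψ := fun r : ℝ => (r : ℂ) * (η r : ℂ))
      (memLp_radialPart fun j => Lp.memLp (G j)).2 (by fun_prop) m,
    setIntegral_mul_radial (ψ := fun r : ℝ => ((m : ℂ) + r ^ 2 / 2) * η r)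
      (Lp.memLp u) (by fun_prop) m] at key
  have key2 := smul_right_injective ℂ (show (2 * π : ℝ) ≠ 0 by positivity) key
  have e3 : ∫ r in Ioo 1 R, angularMode m (angularPart fun j => G j) r *
      ((r : ℂ) ^ (m + 1) * ((r : ℂ) * (η r : ℂ))) =
      ∫ r in Ioo 1 R, ξ r • angularMode m (angularPart fun j => G j) r := by
    refine setIntegral_congr_fun measurableSet_Ioo fun r hr => ?_
    have hr0 : (r : ℂ) ≠ 0 := by exact_mod_cast (zero_lt_one.trans hr.1).ne'
    simp only [hηdef]
    push_cast
    have : (r : ℂ) ^ (m + 1) * (r * (r ^ (-(m + 2)) * ξ r)) = ξ r := by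
      rw [← mul_assoc, ← zpow_add_one₀ hr0, ← mul_assoc, ← zpow_add₀ hr0,
        show m + 1 + 1 + -(m + 2) = 0 by ring, zpow_zero, one_mul]
    rw [this, Complex.real_smul, mul_comm]
  have e4 : ∫ r in Ioo 1 R, angularMode m u r *
      ((r : ℂ) ^ (m + 1) * (((m : ℂ) + r ^ 2 / 2) * η r)) =
      ∫ r in Ioo 1 R, ξ r • ((((m : ℝ) / r + r / 2 : ℝ) : ℂ) * angularMode m u r) := by
    refine setIntegral_congr_fun measurableSet_Ioo fun r hr => ?_
    have hr0 : (r : ℂ) ≠ 0 := by exact_mod_cast (zero_lt_one.trans hr.1).ne'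
    simp only [hηdef]
    have h1 : (r : ℂ) ^ (m + 1) * r ^ (-(m + 2)) = (r : ℂ)⁻¹ := by
      rw [← zpow_add₀ hr0, show m + 1 + -(m + 2) = -1 by ring, zpow_neg_one]
    push_cast
    have : (r : ℂ) ^ (m + 1) * (((m : ℂ) + r ^ 2 / 2) * (r ^ (-(m + 2)) * ξ r)) =
        ((r : ℂ) ^ (m + 1) * r ^ (-(m + 2))) * (((m : ℂ) + r ^ 2 / 2) * ξ r) := by ring
    rw [this, h1, Complex.real_smul]
    field_simp
  rw [e3, e4] at key2
  simp only [smul_sub]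
  obtain ⟨C, hC⟩ := hξc.exists_bound_of_continuous hξ.continuous
  have hsm : ∀ {q : ℝ → ℂ}, Integrable q (volume.restrict (Ioo 1 R)) →
      Integrable (fun r => ξ r • q r) (volume.restrict (Ioo 1 R)) := fun hq =>
    hq.bdd_smul C hξ.continuous.aestronglyMeasurable (Filter.Eventually.of_forall hC)
  rw [integral_sub (hsm hAi) (hsm hWi), key2, sub_self]

end ModeEquations

/-! ### The gap for complex modes with weak derivatives -/

section ModeGap

open Set Real

variable {R : ℝ} {l : ℝ} {g f φ : ℝ → ℝ}

theorem intervalIntegrable_mul_norm_sq {E : Type*} [NormedAddCommGroup E] (hR : 1 ≤ R) {w : ℝ → ℝ}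
    (hw : ContinuousOn w (Icc 1 R)) {h : ℝ → E} (hh : MemLp h 2 (volume.restrict (Ioo 1 R))) :
    IntervalIntegrable (fun r => w r * ‖h r‖ ^ 2) volume 1 R := by
  obtain ⟨C, hC⟩ := isCompact_Icc.exists_bound_of_continuousOn hw
  rw [intervalIntegrable_iff_integrableOn_Ioo_of_le hR]
  refine (hh.integrable_norm_pow (by norm_num)).bdd_mul (c := C)
    ((hw.mono Ioo_subset_Icc_self).aestronglyMeasurable measurableSet_Ioo) ?_
  filter_upwards [ae_restrict_mem measurableSet_Ioo] with r hr
  exact hC r (Ioo_subset_Icc_self hr)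

theorem intervalIntegral_congr_Ioo_ae {E : Type*} [NormedAddCommGroup E] [NormedSpace ℝ E]
    (hR : 1 ≤ R) {p q : ℝ → E} (h : ∀ᵐ r ∂volume.restrict (Ioo 1 R), p r = q r) :
    ∫ r in (1 : ℝ)..R, p r = ∫ r in (1 : ℝ)..R, q r := by
  rw [intervalIntegral.integral_of_le hR, intervalIntegral.integral_of_le hR,
    integral_Ioc_eq_integral_Ioo, integral_Ioc_eq_integral_Ioo]
  exact integral_congr_ae h

/-- The functions `h` and `k` satisfy `h' = k` on `(1, R)` in the sense of distributions. -/
def HasWeakDeriv {E : Type*} [NormedAddCommGroup E] [NormedSpace ℝ E] (R : ℝ) (h k : ℝ → E) :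
    Prop :=
  ∀ ξ : ℝ → ℝ, ContDiff ℝ ∞ ξ → HasCompactSupport ξ → tsupport ξ ⊆ Ioo 1 R →
    ∫ x in Ioo 1 R, deriv ξ x • h x = -∫ x in Ioo 1 R, ξ x • k x

theorem HasWeakDeriv.clm_apply {h k : ℝ → ℂ} (H : HasWeakDeriv R h k) (L : ℂ →L[ℝ] ℝ)
    (hh : MemLp h 2 (volume.restrict (Ioo 1 R))) (hk : MemLp k 2 (volume.restrict (Ioo 1 R))) :
    HasWeakDeriv R (fun r => L (h r)) (fun r => L (k r)) := by
  intro ξ h1 h2 h3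
  have hi : ∀ {ζ : ℝ → ℝ}, Continuous ζ → HasCompactSupport ζ → ∀ {q : ℝ → ℂ},
      MemLp q 2 (volume.restrict (Ioo 1 R)) →
      ∫ x in Ioo 1 R, ζ x • L (q x) = L (∫ x in Ioo 1 R, ζ x • q x) := fun {ζ} c1 c2 q hq => by
    obtain ⟨C, hC⟩ := c2.exists_bound_of_continuous c1
    have hi : Integrable (fun x => ζ x • q x) (volume.restrict (Ioo 1 R)) :=
      (hq.integrable (by norm_num)).bdd_smul C c1.aestronglyMeasurable
        (Filter.Eventually.of_forall hC)
    rw [← L.integral_comp_comm hi]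
    simp only [map_smul]
  rw [hi (h1.continuous_deriv (by simp)) h2.deriv hh, hi h1.continuous h2 hk, H ξ h1 h2 h3, map_neg]

/-- The lower bound, with a gap, for the form of the angular mode `m` at the function `h` with weak
derivative `k`. -/
theorem IsRadialGroundState.exists_gap_of_hasWeakDeriv (H : IsRadialGroundState R l g f φ)
    (hR : 1 < R) (hR2 : R < √2) : ∃ γ : ℝ, 0 < γ ∧ ∀ (m : ℤ) (h k : ℝ → ℝ),
      MemLp h 2 (volume.restrict (Ioo 1 R)) → MemLp k 2 (volume.restrict (Ioo 1 R)) →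
      HasWeakDeriv R h k → ∃ c : ℝ, (m ≠ -1 → c = 0) ∧
      l * (∫ r in (1 : ℝ)..R, r * h r ^ 2) + γ * ∫ r in (1 : ℝ)..R, r * (h r - c * f r) ^ 2 ≤
        (∫ r in (1 : ℝ)..R, r * k r ^ 2) +
          ∫ r in (1 : ℝ)..R, r * (((m : ℝ) / r + r / 2) ^ 2 * h r ^ 2) := by
  obtain ⟨γ, hγ, hgap⟩ := H.exists_gap hR hR2
  refine ⟨γ, hγ, fun m h k hh hk hw => ?_⟩
  -- The radial bounds are applied to the absolutely continuous representative of $h$, and the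
  -- integrals do not see the change.
  obtain ⟨h', hp, hae⟩ := exists_isPrimitiveOn_of_weak hR (hh.integrable (by norm_num))
    (hk.integrable (by norm_num)) fun ξ h1 h2 h3 => by
      simpa only [smul_eq_mul, mul_comm] using hw ξ h1 h2 h3
  have hae' : ∀ᵐ r ∂volume.restrict (Ioo 1 R), h r = h' r :=
    (ae_restrict_iff' measurableSet_Ioo).2 hae
  have hne : ∀ r ∈ Icc 1 R, r ≠ 0 := fun r hr => by linarith [hr.1]
  have hk2 : IntervalIntegrable (fun r => k r ^ 2) volume 1 R := by
    simpa using intervalIntegrable_mul_norm_sq hR.le (w := fun _ => 1) continuousOn_const hk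
  obtain ⟨c, hc, hle⟩ := hgap m h' k hp hk2
  refine ⟨c, hc, ?_⟩
  have e1 : ∫ r in (1 : ℝ)..R, r * h r ^ 2 = ∫ r in (1 : ℝ)..R, r * h' r ^ 2 :=
    intervalIntegral_congr_Ioo_ae hR.le (hae'.mono fun r hr => by rw [hr])
  have e2 : ∫ r in (1 : ℝ)..R, r * (h r - c * f r) ^ 2 =
      ∫ r in (1 : ℝ)..R, r * (h' r - c * f r) ^ 2 :=
    intervalIntegral_congr_Ioo_ae hR.le (hae'.mono fun r hr => by rw [hr])
  have i1 : IntervalIntegrable (fun r => r * k r ^ 2) volume 1 R := by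
    simpa using intervalIntegrable_mul_norm_sq hR.le (w := fun r => r) continuousOn_id hk
  have i2 : IntervalIntegrable (fun r => r * (((m : ℝ) / r + r / 2) ^ 2 * h r ^ 2)) volume 1 R := by
    have hc : ContinuousOn (fun r : ℝ => r * ((m : ℝ) / r + r / 2) ^ 2) (Icc 1 R) := by
      fun_prop (disch := assumption)
    simpa [mul_assoc] using intervalIntegrable_mul_norm_sq hR.le hc hh
  rw [e1, e2, ← intervalIntegral.integral_add i1 i2]
  refine hle.trans (le_of_eq (intervalIntegral_congr_Ioo_ae hR.le (hae'.mono fun r hr => ?_)))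
  rw [hr]; ring

/-- The form has real coefficients, so real and imaginary parts decouple; their constants $a$ and
$b$ combine to $c=a+ib$. -/
theorem IsRadialGroundState.exists_complex_gap (H : IsRadialGroundState R l g f φ)
    (hR : 1 < R) (hR2 : R < √2) : ∃ γ : ℝ, 0 < γ ∧ ∀ (m : ℤ) (h k : ℝ → ℂ),
      MemLp h 2 (volume.restrict (Ioo 1 R)) → MemLp k 2 (volume.restrict (Ioo 1 R)) →
      HasWeakDeriv R h k → ∃ c : ℂ, (m ≠ -1 → c = 0) ∧
      l * (∫ r in (1 : ℝ)..R, r * ‖h r‖ ^ 2) + γ * ∫ r in (1 : ℝ)..R, r * ‖h r - c * f r‖ ^ 2 ≤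
        (∫ r in (1 : ℝ)..R, r * ‖k r‖ ^ 2) +
          ∫ r in (1 : ℝ)..R, r * ‖(((m : ℝ) / r + r / 2 : ℝ) : ℂ) * h r‖ ^ 2 := by
  obtain ⟨γ, hγ, hgap⟩ := H.exists_gap_of_hasWeakDeriv hR hR2
  refine ⟨γ, hγ, fun m h k hh hk hw => ?_⟩
  have hne : ∀ r ∈ Icc 1 R, r ≠ 0 := fun r hr => by linarith [hr.1]
  have hre : ∀ {q : ℝ → ℂ}, MemLp q 2 (volume.restrict (Ioo 1 R)) →
      MemLp (fun r => (q r).re) 2 (volume.restrict (Ioo 1 R)) := fun hq => hq.re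
  have him : ∀ {q : ℝ → ℂ}, MemLp q 2 (volume.restrict (Ioo 1 R)) →
      MemLp (fun r => (q r).im) 2 (volume.restrict (Ioo 1 R)) := fun hq => hq.im
  have split : ∀ {w : ℝ → ℝ} {q : ℝ → ℂ}, ContinuousOn w (Icc 1 R) →
      MemLp q 2 (volume.restrict (Ioo 1 R)) → ∫ r in (1 : ℝ)..R, w r * ‖q r‖ ^ 2 =
        (∫ r in (1 : ℝ)..R, w r * (q r).re ^ 2) + ∫ r in (1 : ℝ)..R, w r * (q r).im ^ 2 := by
    intro w q hw hq
    have i1 := intervalIntegrable_mul_norm_sq hR.le hw (hre hq)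
    have i2 := intervalIntegrable_mul_norm_sq hR.le hw (him hq)
    simp only [Real.norm_eq_abs, sq_abs] at i1 i2
    rw [← intervalIntegral.integral_add i1 i2]
    congr 1; ext r
    rw [← Complex.normSq_eq_norm_sq, Complex.normSq_apply]
    ring
  obtain ⟨a, ha, hla⟩ := hgap m _ _ (hre hh) (hre hk) (hw.clm_apply Complex.reCLM hh hk)
  obtain ⟨b, hb, hlb⟩ := hgap m _ _ (him hh) (him hk) (hw.clm_apply Complex.imCLM hh hk)
  refine ⟨a + b * Complex.I, fun hm => by simp [ha hm, hb hm], ?_⟩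
  have hf : MemLp (fun r : ℝ => ((a + b * Complex.I : ℂ)) * f r) 2 (volume.restrict (Ioo 1 R)) := by
    have hc : Continuous fun r : ℝ => ((a + b * Complex.I : ℂ)) * f r := by
      have := H.continuous
      fun_prop
    obtain ⟨C, hC⟩ := isCompact_Icc.exists_bound_of_continuousOn (s := Icc 1 R) hc.continuousOn
    refine MemLp.of_bound hc.aestronglyMeasurable C ?_
    filter_upwards [ae_restrict_mem measurableSet_Ioo] with r hr
    exact hC r (Ioo_subset_Icc_self hr)
  have hW : ContinuousOn (fun r : ℝ => r * ((m : ℝ) / r + r / 2) ^ 2) (Icc 1 R) := by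
    fun_prop (disch := assumption)
  have e1 := split (w := fun r => r) continuousOn_id hh
  have e2 := split (w := fun r => r) continuousOn_id hk
  have e3 := split (w := fun r => r) continuousOn_id (hh.sub hf)
  have e4 := split hW hh
  simp only [Pi.sub_apply, Complex.sub_re, Complex.sub_im, Complex.mul_re, Complex.mul_im,
    Complex.add_re, Complex.add_im, Complex.ofReal_re, Complex.ofReal_im, Complex.I_re,
    Complex.I_im, mul_zero, mul_one, sub_zero, add_zero, zero_add, sub_self] at e3
  simp only [norm_mul, mul_pow, Complex.norm_real, Real.norm_eq_abs, sq_abs, ← mul_assoc] at hla hlb e4 ⊢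
  rw [e1, e2, e3, e4]
  linarith

end ModeGap

/-! ### Summation over the modes: the gap in the annulus -/

section AnnulusGap

open Set Real

variable {R : ℝ} {l : ℝ} {g f φ : ℝ → ℝ}

/-- The function `f(r) e^{-iθ}`. -/
def radialMode (f : ℝ → ℝ) (x : Plane) : ℂ := (f ‖x‖ : ℂ) * (conjCoord x / ‖x‖)

theorem norm_radialMode (f : ℝ → ℝ) {x : Plane} (hx : x ≠ 0) : ‖radialMode f x‖ = |f ‖x‖| := by
  have := norm_ne_zero_iff.2 hx
  rw [radialMode, norm_mul, norm_div, norm_conjCoord, Complex.norm_real, Complex.norm_real,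
    norm_norm, div_self this, mul_one, Real.norm_eq_abs]

theorem HasMagneticGradient.hasWeakDeriv {u : L2 (annulus 1 R)} {G : Fin 2 → L2 (annulus 1 R)}
    (h : HasMagneticGradient (annulus 1 R) uniformPotential u G) (m : ℤ) :
    HasWeakDeriv R (angularMode m u)
      (fun r => Complex.I * angularMode m (radialPart fun j => G j) r) := by
  intro ξ h1 _ h3
  simp only [Complex.real_smul]
  have := h.radial_mode m h1 h3
  simp only [mul_comm _ (Complex.ofReal _)] at this ⊢
  exact this

theorem memLp_radialMode (hf : ContinuousOn f (Icc 1 R)) :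
    MemLp (radialMode f) 2 (volume.restrict (annulus 1 R)) := by
  have hm : ContinuousOn (radialMode f) (annulus 1 R) := by
    have h1 : ContinuousOn (fun x : Plane => (f ‖x‖ : ℂ)) (annulus 1 R) :=
      Complex.continuous_ofReal.comp_continuousOn
        (hf.comp continuous_norm.continuousOn fun x hx => ⟨hx.1.le, hx.2.le⟩)
    refine h1.mul (continuous_conjCoord.continuousOn.div (by fun_prop) fun x hx => ?_)
    exact_mod_cast (zero_lt_one.trans hx.1).ne'
  obtain ⟨C, hC⟩ := isCompact_Icc.exists_bound_of_continuousOn hf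
  have hΩ := (isOpen_annulus 1 R).measurableSet
  refine MemLp.of_bound (hm.aestronglyMeasurable hΩ) C ?_
  filter_upwards [ae_restrict_mem hΩ] with x hx
  rw [norm_radialMode f (norm_ne_zero_iff.1 (by linarith [hx.1]))]
  exact hC _ ⟨hx.1.le, hx.2.le⟩

/-- The magnetic form of the annulus is bounded below by `l`, with a gap above the mode
`f(r) e^{-iθ}`. -/
theorem IsRadialGroundState.exists_annulus_gap (H : IsRadialGroundState R l g f φ)
    (hR : 1 < R) (hR2 : R < √2) : ∃ γ : ℝ, 0 < γ ∧ ∀ (u : L2 (annulus 1 R))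
      (G : Fin 2 → L2 (annulus 1 R)), HasMagneticGradient (annulus 1 R) uniformPotential u G →
      ∃ c : ℂ, l * (∫ x in annulus 1 R, ‖u x‖ ^ 2) +
        γ * (∫ x in annulus 1 R, ‖u x - c * radialMode f x‖ ^ 2) ≤
        (∫ x in annulus 1 R, ‖G 0 x‖ ^ 2) + ∫ x in annulus 1 R, ‖G 1 x‖ ^ 2 := by
  obtain ⟨γ, hγ, hgap⟩ := H.exists_complex_gap hR hR2
  refine ⟨γ, hγ, fun u G hG => ?_⟩
  have hu := Lp.memLp u
  have hrad := memLp_radialPart fun j => Lp.memLp (G j)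
  have hmode : ∀ m : ℤ, ∃ c : ℂ, (m ≠ -1 → c = 0) ∧
      l * (∫ r in (1 : ℝ)..R, r * ‖angularMode m u r‖ ^ 2) +
        γ * (∫ r in (1 : ℝ)..R, r * ‖angularMode m u r - c * f r‖ ^ 2) ≤
        (∫ r in (1 : ℝ)..R, r * ‖angularMode m (radialPart fun j => G j) r‖ ^ 2) +
          ∫ r in (1 : ℝ)..R, r * ‖angularMode m (angularPart fun j => G j) r‖ ^ 2 := fun m => by
    obtain ⟨c, hc, hle⟩ := hgap m _ _ (memLp_angularMode m hu)
      ((memLp_angularMode m hrad.1).const_mul Complex.I) (hG.hasWeakDeriv m)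
    refine ⟨c, hc, hle.trans (le_of_eq ?_)⟩
    congr 1
    · simp
    · exact intervalIntegral_congr_Ioo_ae hR.le
        ((hG.angular_mode m).mono fun r hr => by rw [hr])
  choose c hc hle using hmode
  refine ⟨c (-1), ?_⟩
  have hw : MemLp (fun x => c (-1) * radialMode f x) 2 (volume.restrict (annulus 1 R)) :=
    (memLp_radialMode H.continuous.continuousOn).const_mul _
  have s1 := hasSum_angularMode hR.le hu
  have s2 := hasSum_angularMode hR.le (hu.sub hw)
  have s3 := hasSum_angularMode hR.le hrad.1
  have s4 := hasSum_angularMode hR.le hrad.2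
  -- The subtracted function has the single mode $-1$. Elsewhere its coefficient is $0$, in
  -- agreement with $c_m=0$ for $m\ne-1$.
  have hcoef : ∀ m : ℤ, ∫ r in (1 : ℝ)..R,
      r * ‖angularMode m (u - fun x => c (-1) * radialMode f x) r‖ ^ 2 =
      ∫ r in (1 : ℝ)..R, r * ‖angularMode m u r - c m * f r‖ ^ 2 := fun m => by
    refine intervalIntegral_congr_Ioo_ae hR.le ?_
    filter_upwards [angularMode_sub_ae m hu hw, ae_restrict_mem measurableSet_Ioo] with r hr hr'
    have h1 : angularMode m (fun x => c (-1) * radialMode f x) r = c m * f r := by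
      have := angularMode_radial m (fun r => c (-1) * f r) (zero_lt_one.trans hr'.1)
      simp only [mul_assoc] at this
      refine this.trans ?_
      split_ifs with hm
      · rw [hm]
      · rw [hc m hm, zero_mul]
    rw [← h1, ← hr]
    rfl
  simp only [hcoef] at s2
  have hle' := hasSum_le (fun m => ?_) ((s1.mul_left l).add (s2.mul_left γ)) (s3.add s4)
  · refine hle'.trans (le_of_eq ?_)
    have hi : ∀ {q : Plane → ℂ}, MemLp q 2 (volume.restrict (annulus 1 R)) →
        Integrable (fun x => ‖q x‖ ^ 2) (volume.restrict (annulus 1 R)) := fun hq =>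
      hq.integrable_norm_pow (by norm_num)
    rw [← integral_add (hi hrad.1) (hi hrad.2), ← integral_add (hi (Lp.memLp (G 0)))
      (hi (Lp.memLp (G 1)))]
    refine setIntegral_congr_fun (isOpen_annulus 1 R).measurableSet fun x hx => ?_
    exact norm_sq_radialPart_add (fun j => G j) (norm_ne_zero_iff.1 (by linarith [hx.1]))
  · have := mul_le_mul_of_nonneg_left (hle m) (by positivity : 0 ≤ 2 * π)
    linarith

end AnnulusGap

/-! ### The magnetic Sobolev space as a Hilbert space -/

section FormDomain

variable {Ω : Set Plane} {A : C(Plane, Plane)}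

/-- Square integrable vector fields. -/
abbrev L2Field (Ω : Set Plane) : Type := PiLp 2 fun _ : Fin 2 => L2 Ω

/-- The magnetic Sobolev space `H¹_A(Ω)`, realised as the graph of `-i∇ + A`. -/
def formDomain (Ω : Set Plane) (A : C(Plane, Plane)) :
    Submodule ℂ (WithLp 2 (L2 Ω × L2Field Ω)) where
  carrier := {p | HasMagneticGradient Ω A p.fst fun j => p.snd j}
  zero_mem' := HasMagneticGradient.zero
  add_mem' := fun hp hq => hp.add hq
  smul_mem' := fun c _ hp => hp.smul c

theorem continuous_integral_mul {ψ : Plane → ℂ} (hc : Continuous ψ) (hs : HasCompactSupport ψ) :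
    Continuous fun u : L2 Ω => ∫ x in Ω, u x * ψ x := by
  have hψ : MemLp (fun x => (starRingEnd ℂ) (ψ x)) 2 (volume.restrict Ω) :=
    (Complex.continuous_conj.comp hc).memLp_of_hasCompactSupport
      (hs.comp_left (g := starRingEnd ℂ) (map_zero _))
  have : (fun u : L2 Ω => ∫ x in Ω, u x * ψ x) = fun u => ⟪hψ.toLp _, u⟫ := by
    ext u
    rw [L2.inner_def]
    refine integral_congr_ae ?_
    filter_upwards [hψ.coeFn_toLp] with x hx
    rw [hx]
    simp
  rw [this]
  fun_prop

/-- Each test function imposes one condition that is continuous for $L^2$ convergence of function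
and gradient. The resulting completeness is what Lax–Milgram requires. -/
theorem isClosed_formDomain (Ω : Set Plane) (A : C(Plane, Plane)) :
    IsClosed (formDomain Ω A : Set (WithLp 2 (L2 Ω × L2Field Ω))) := by
  have : (formDomain Ω A : Set (WithLp 2 (L2 Ω × L2Field Ω))) =
      ⋂ (j : Fin 2) (φ : Plane → ℂ) (_ : IsTestFunction Ω φ),
        {p | ∫ x in Ω, p.fst x * (Complex.I * partialDeriv j φ x + (A x j : ℂ) * φ x) =
          ∫ x in Ω, p.snd j x * φ x} := by
    ext p
    simp only [Set.mem_iInter]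
    rfl
  rw [this]
  refine isClosed_iInter fun j => isClosed_iInter fun φ => isClosed_iInter fun hφ =>
    isClosed_eq ?_ ?_
  · exact (continuous_integral_mul (hφ.continuous_symbol A Complex.I j)
      (hφ.hasCompactSupport_symbol A Complex.I j)).comp (WithLp.fstL 2 ℂ (L2 Ω) (L2Field Ω)).continuous
  · exact (continuous_integral_mul hφ.1.continuous hφ.2.1).comp
      ((PiLp.proj 2 (fun _ : Fin 2 => L2 Ω) j : L2Field Ω →L[ℂ] L2 Ω).continuous.comp
        (WithLp.sndL 2 ℂ (L2 Ω) (L2Field Ω)).continuous)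

instance (Ω : Set Plane) (A : C(Plane, Plane)) : CompleteSpace (formDomain Ω A) :=
  (isClosed_formDomain Ω A).completeSpace_coe

/-- The embedding `H¹_A(Ω) → L²(Ω)`. -/
def formEmbedding (Ω : Set Plane) (A : C(Plane, Plane)) : formDomain Ω A →L[ℂ] L2 Ω :=
  WithLp.fstL 2 ℂ (L2 Ω) (L2Field Ω) ∘L (formDomain Ω A).subtypeL

/-- The magnetic gradient `-i∇ + A` on `H¹_A(Ω)`. -/
def formGradient (Ω : Set Plane) (A : C(Plane, Plane)) : formDomain Ω A →L[ℂ] L2Field Ω :=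
  WithLp.sndL 2 ℂ (L2 Ω) (L2Field Ω) ∘L (formDomain Ω A).subtypeL

theorem hasMagneticGradient_formGradient (v : formDomain Ω A) :
    HasMagneticGradient Ω A (formEmbedding Ω A v) fun j => formGradient Ω A v j := v.2

theorem norm_sq_formDomain (v : formDomain Ω A) :
    ‖v‖ ^ 2 = ‖formEmbedding Ω A v‖ ^ 2 + ‖formGradient Ω A v‖ ^ 2 :=
  WithLp.prod_norm_sq_eq_of_L2 (v : WithLp 2 (L2 Ω × L2Field Ω))

theorem exists_formDomain_eq {u : L2 Ω} {G : Fin 2 → L2 Ω} (h : HasMagneticGradient Ω A u G) :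
    ∃ v : formDomain Ω A, formEmbedding Ω A v = u ∧ ∀ j, formGradient Ω A v j = G j :=
  ⟨⟨WithLp.toLp 2 (u, WithLp.toLp 2 G), h⟩, rfl, fun _ => rfl⟩

end FormDomain

/-! ### Dependence on the field strength as a bounded perturbation -/

section Multiplication

variable {R : ℝ}

theorem abs_uniformPotential_le {x : Plane} (hx : x ∈ annulus 1 R) (j : Fin 2) :
    |uniformPotential x j| ≤ R := by
  have h0 := norm_coord_le x 0
  have h1 := norm_coord_le x 1
  have h2 := norm_nonneg x
  have h3 := hx.2
  fin_cases j
  · change |-(x 1) / 2| ≤ R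
    rw [abs_div, abs_neg, abs_two]
    linarith
  · change |x 0 / 2| ≤ R
    rw [abs_div, abs_two]
    linarith

theorem memLp_uniformPotential_mul (j : Fin 2) {u : Plane → ℂ}
    (hu : MemLp u 2 (volume.restrict (annulus 1 R))) :
    MemLp (fun x => (uniformPotential x j : ℂ) * u x) 2 (volume.restrict (annulus 1 R)) := by
  refine hu.of_le_mul (c := R) (Continuous.aestronglyMeasurable (by fun_prop) |>.mul hu.1) ?_
  filter_upwards [ae_restrict_mem (isOpen_annulus 1 R).measurableSet] with x hx
  rw [norm_mul, Complex.norm_real, Real.norm_eq_abs]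
  gcongr
  exact abs_uniformPotential_le hx j

/-- Multiplication by the component `j` of the potential in `L²` of the annulus. -/
def potentialMul (R : ℝ) (j : Fin 2) : L2 (annulus 1 R) →L[ℂ] L2 (annulus 1 R) :=
  LinearMap.mkContinuous
    { toFun := fun u => (memLp_uniformPotential_mul j (Lp.memLp u)).toLp _
      map_add' := fun u v => by
        ext1
        refine (MemLp.coeFn_toLp _).trans ?_
        filter_upwards [Lp.coeFn_add u v, Lp.coeFn_add
          ((memLp_uniformPotential_mul j (Lp.memLp u)).toLp _)
          ((memLp_uniformPotential_mul j (Lp.memLp v)).toLp _),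
          (memLp_uniformPotential_mul j (Lp.memLp u)).coeFn_toLp,
          (memLp_uniformPotential_mul j (Lp.memLp v)).coeFn_toLp] with x h1 h2 h3 h4
        rw [h2, Pi.add_apply, h3, h4, h1, Pi.add_apply, mul_add]
      map_smul' := fun c u => by
        ext1
        refine (MemLp.coeFn_toLp _).trans ?_
        filter_upwards [Lp.coeFn_smul c u, Lp.coeFn_smul c
          ((memLp_uniformPotential_mul j (Lp.memLp u)).toLp _),
          (memLp_uniformPotential_mul j (Lp.memLp u)).coeFn_toLp] with x h1 h2 h3
        rw [RingHom.id_apply, h2, Pi.smul_apply, h3, h1, Pi.smul_apply, smul_eq_mul, smul_eq_mul]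
        ring } |R| fun u => by
    refine Lp.norm_le_mul_norm_of_ae_le_mul ?_
    filter_upwards [(memLp_uniformPotential_mul j (Lp.memLp u)).coeFn_toLp,
      ae_restrict_mem (isOpen_annulus 1 R).measurableSet] with x h1 hx
    change ‖((memLp_uniformPotential_mul j (Lp.memLp u)).toLp _) x‖ ≤ _
    rw [h1, norm_mul, Complex.norm_real, Real.norm_eq_abs]
    exact mul_le_mul_of_nonneg_right ((abs_uniformPotential_le hx j).trans (le_abs_self R))
      (norm_nonneg _)

theorem potentialMul_ae (j : Fin 2) (u : L2 (annulus 1 R)) :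
    potentialMul R j u =ᵐ[volume.restrict (annulus 1 R)]
      fun x => (uniformPotential x j : ℂ) * u x :=
  (memLp_uniformPotential_mul j (Lp.memLp u)).coeFn_toLp

theorem norm_potentialMul_le (j : Fin 2) (u : L2 (annulus 1 R)) :
    ‖potentialMul R j u‖ ≤ |R| * ‖u‖ :=
  (potentialMul R j).le_of_opNorm_le (LinearMap.mkContinuous_norm_le _ (abs_nonneg R) _) u

/-- Changing the field strength adds a bounded multiple of $u$ to its magnetic gradient, so the
Sobolev space does not depend on the field. -/
theorem HasMagneticGradient.shift {s t : ℝ} {u : L2 (annulus 1 R)} {G : Fin 2 → L2 (annulus 1 R)}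
    (h : HasMagneticGradient (annulus 1 R) (s • uniformPotential) u G) :
    HasMagneticGradient (annulus 1 R) (t • uniformPotential) u
      fun j => G j + ((t - s : ℝ) : ℂ) • potentialMul R j u := by
  intro j φ hφ
  have h1 := h j φ hφ
  have i1 := integrable_mul_of_hasCompactSupport u (hφ.continuous_symbol (s • uniformPotential)
    Complex.I j) (hφ.hasCompactSupport_symbol (s • uniformPotential) Complex.I j)
  have i2 := integrable_mul_of_hasCompactSupport (G j) hφ.1.continuous hφ.2.1
  have i3 := (integrable_mul_of_hasCompactSupport (potentialMul R j u) hφ.1.continuous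
    hφ.2.1).const_mul (((t - s : ℝ) : ℂ))
  have e1 : ∫ x in annulus 1 R, (G j + ((t - s : ℝ) : ℂ) • potentialMul R j u : L2 (annulus 1 R)) x *
      φ x = ∫ x in annulus 1 R, (G j x * φ x + ((t - s : ℝ) : ℂ) * (potentialMul R j u x * φ x)) := by
    refine integral_congr_ae ?_
    filter_upwards [Lp.coeFn_add (G j) (((t - s : ℝ) : ℂ) • potentialMul R j u),
      Lp.coeFn_smul ((t - s : ℝ) : ℂ) (potentialMul R j u)] with x h2 h3
    rw [h2, Pi.add_apply, h3, Pi.smul_apply, smul_eq_mul]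
    ring
  rw [e1, integral_add i2 i3, ← h1, ← integral_add i1 i3]
  refine integral_congr_ae ?_
  filter_upwards [potentialMul_ae j u] with x hx
  rw [hx]
  simp only [ContinuousMap.smul_apply, PiLp.smul_apply, smul_eq_mul]
  push_cast
  ring

/-- Multiplication by the potential on the form domain. -/
def formPotential (R : ℝ) : formDomain (annulus 1 R) uniformPotential →L[ℂ] L2Field (annulus 1 R) :=
  (PiLp.continuousLinearEquiv 2 ℂ fun _ : Fin 2 => L2 (annulus 1 R)).symm.toContinuousLinearMap ∘L
    (ContinuousLinearMap.pi fun j => potentialMul R j) ∘L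
      formEmbedding (annulus 1 R) uniformPotential

theorem formPotential_apply (v : formDomain (annulus 1 R) uniformPotential) (j : Fin 2) :
    formPotential R v j = potentialMul R j (formEmbedding (annulus 1 R) uniformPotential v) := rfl

theorem norm_formPotential_le (v : formDomain (annulus 1 R) uniformPotential) :
    ‖formPotential R v‖ ≤ 2 * |R| * ‖formEmbedding (annulus 1 R) uniformPotential v‖ := by
  refine le_of_sq_le_sq ?_ (by positivity)
  rw [PiLp.norm_sq_eq_of_L2, Fin.sum_univ_two, formPotential_apply, formPotential_apply]
  have h0 := norm_potentialMul_le 0 (formEmbedding (annulus 1 R) uniformPotential v)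
  have h1 := norm_potentialMul_le 1 (formEmbedding (annulus 1 R) uniformPotential v)
  have h0' := pow_le_pow_left₀ (norm_nonneg _) h0 2
  have h1' := pow_le_pow_left₀ (norm_nonneg _) h1 2
  nlinarith [sq_nonneg (|R| * ‖formEmbedding (annulus 1 R) uniformPotential v‖)]

/-- Brings the whole family of operators to the fixed form domain of $B=1$, where the gradient is
affine in $s=B-1$, as perturbation theory requires. -/
theorem isFormOperator_annulusOperator (R s : ℝ) :
    IsFormOperator (V := formDomain (annulus 1 R) uniformPotential) (K := L2Field (annulus 1 R))
      (formEmbedding (annulus 1 R) uniformPotential)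
      (formGradient (annulus 1 R) uniformPotential + (s : ℂ) • formPotential R)
      (annulusOperator 1 R (1 + s)) := by
  intro u f
  rw [annulusOperator, neumannOperator_graph (isOpen_annulus 1 R)]
  set J := formEmbedding (annulus 1 R) uniformPotential with hJ
  set N := formGradient (annulus 1 R) uniformPotential + (s : ℂ) • formPotential R with hN
  have hNj : ∀ v j, N v j = formGradient (annulus 1 R) uniformPotential v j +
      (s : ℂ) • potentialMul R j (J v) := fun v j => rfl
  have h1 : ∀ v, HasMagneticGradient (annulus 1 R) ((1 + s) • uniformPotential) (J v)
      fun j => N v j := fun v => by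
    have h2 : ∀ A, A = uniformPotential → HasMagneticGradient (annulus 1 R) A (J v)
        fun j => formGradient (annulus 1 R) uniformPotential v j := by
      rintro _ rfl
      exact hasMagneticGradient_formGradient v
    have h3 := (h2 _ (one_smul ℝ uniformPotential)).shift (t := 1 + s)
    simp only [add_sub_cancel_left] at h3
    exact h3
  have h4 : ∀ w H, HasMagneticGradient (annulus 1 R) ((1 + s) • uniformPotential) w H →
      ∃ v, J v = w ∧ ∀ j, N v j = H j := fun w H hw => by
    have h5 := hw.shift (t := 1)
    rw [one_smul] at h5
    obtain ⟨v, hv, hv'⟩ := exists_formDomain_eq h5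
    refine ⟨v, hv, fun j => ?_⟩
    rw [hNj, hv', hJ, hv]
    simp
  constructor
  · rintro ⟨G, hG, hf⟩
    obtain ⟨v, hv, hv'⟩ := h4 _ _ hG
    refine ⟨v, hv, fun w => ?_⟩
    rw [PiLp.inner_apply, ← hf _ _ (h1 w)]
    simp only [hv']
  · rintro ⟨v, rfl, hv⟩
    refine ⟨fun j => N v j, h1 v, fun w H hw => ?_⟩
    obtain ⟨w', rfl, hw'⟩ := h4 _ _ hw
    rw [← hv w', PiLp.inner_apply]
    simp only [hw']

/-- The unperturbed gradient differs from the perturbed one by a term bounded by $\|Jv\|$, so the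
perturbed form still controls the graph norm. -/
theorem formGradient_coercive (R s : ℝ) : ∃ c : ℝ, 0 < c ∧
    ∀ v : formDomain (annulus 1 R) uniformPotential, c * ‖v‖ ^ 2 ≤
      ‖(formGradient (annulus 1 R) uniformPotential + (s : ℂ) • formPotential R) v‖ ^ 2 +
        ‖formEmbedding (annulus 1 R) uniformPotential v‖ ^ 2 := by
  set m := 2 * |R|
  refine ⟨1 / (2 + 2 * s ^ 2 * m ^ 2), by positivity, fun v => ?_⟩
  rw [norm_sq_formDomain, one_div, inv_mul_le_iff₀ (by positivity)]
  set J := formEmbedding (annulus 1 R) uniformPotential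
  set N := formGradient (annulus 1 R) uniformPotential
  have h1 : ‖N v‖ ≤ ‖(N + (s : ℂ) • formPotential R) v‖ + |s| * (m * ‖J v‖) := by
    have e : N v = (N + (s : ℂ) • formPotential R) v - (s : ℂ) • formPotential R v := by
      simp
    calc ‖N v‖ = ‖(N + (s : ℂ) • formPotential R) v - (s : ℂ) • formPotential R v‖ :=
          congrArg norm e
      _ ≤ ‖(N + (s : ℂ) • formPotential R) v‖ + ‖(s : ℂ) • formPotential R v‖ := norm_sub_le _ _
      _ ≤ _ := by
        rw [norm_smul, Complex.norm_real, Real.norm_eq_abs]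
        gcongr
        exact norm_formPotential_le v
  have h2 := pow_le_pow_left₀ (norm_nonneg _) h1 2
  have h3 : |s| ^ 2 = s ^ 2 := sq_abs s
  set a := ‖(N + (s : ℂ) • formPotential R) v‖
  set b := ‖J v‖
  have h4 : ‖N v‖ ^ 2 ≤ 2 * a ^ 2 + 2 * s ^ 2 * m ^ 2 * b ^ 2 := by
    rw [← h3]
    nlinarith [sq_nonneg (a - |s| * (m * b))]
  nlinarith [sq_nonneg b, mul_nonneg (sq_nonneg (s * m)) (sq_nonneg a)]

theorem lowestSpec_annulusOperator (R s : ℝ)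
    (h : ∃ v, ‖formEmbedding (annulus 1 R) uniformPotential v‖ = 1) :
    lowestSpec (annulusOperator 1 R (1 + s)) =
      rayleighBottom (V := formDomain (annulus 1 R) uniformPotential) (K := L2Field (annulus 1 R))
        (formEmbedding (annulus 1 R) uniformPotential)
        (formGradient (annulus 1 R) uniformPotential + (s : ℂ) • formPotential R) := by
  obtain ⟨c, hc, hco⟩ := formGradient_coercive R s
  exact lowestSpec_eq_rayleighBottom (isFormOperator_annulusOperator R s) hc hco h

end Multiplication

/-! ### Classical gradients are weak gradients -/

section ClassicalGradient

variable {Ω : Set Plane} {A : C(Plane, Plane)}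

theorem integral_toLp_mul {a : Plane → ℂ} (ha : MemLp a 2 (volume.restrict Ω)) (b : Plane → ℂ) :
    ∫ x in Ω, (ha.toLp a) x * b x = ∫ x in Ω, a x * b x := by
  refine integral_congr_ae ?_
  filter_upwards [ha.coeFn_toLp] with x hx
  rw [hx]

/-- A classical magnetic gradient is a weak one. -/
theorem hasMagneticGradient_toLp (hΩ : MeasurableSet Ω) {u : Plane → ℂ} {G : Fin 2 → Plane → ℂ}
    (hu : MemLp u 2 (volume.restrict Ω)) (hG : ∀ j, MemLp (G j) 2 (volume.restrict Ω))
    (hd : ∀ x ∈ Ω, DifferentiableAt ℝ u x)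
    (h : ∀ x ∈ Ω, ∀ j, G j x = -Complex.I * partialDeriv j u x + (A x j : ℂ) * u x) :
    HasMagneticGradient Ω A (hu.toLp u) fun j => (hG j).toLp (G j) := by
  intro j ψ hψ
  rw [integral_toLp_mul, integral_toLp_mul]
  have cψ := hψ.1.continuous
  have hψ0 : ∀ x, x ∉ Ω → ψ x = 0 := fun x hx =>
    image_eq_zero_of_notMem_tsupport fun h' => hx (hψ.2.2 h')
  have hdψ0 : ∀ x, x ∉ Ω → partialDeriv j ψ x = 0 := fun x hx => by
    rw [partialDeriv, fderiv_of_notMem_tsupport ℝ fun h' => hx (hψ.2.2 h')]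
    simp
  have hint : ∀ {a b : Plane → ℂ}, MemLp a 2 (volume.restrict Ω) → Continuous b →
      HasCompactSupport b → IntegrableOn (fun x => a x * b x) Ω := fun ha hb hb' =>
    ha.integrable_mul (hb.memLp_of_hasCompactSupport hb' : MemLp _ 2 (volume.restrict Ω))
  have hext : ∀ {p : Plane → ℂ}, IntegrableOn p Ω → (∀ x, x ∉ Ω → p x = 0) → Integrable p :=
    fun hp h0 => (integrableOn_iff_integrable_of_support_subset fun x hx => by
      by_contra hx'
      exact hx (h0 x hx')).1 hp
  have hAψ : Continuous fun x => (A x j : ℂ) * ψ x := by fun_prop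
  have j1 := hint (hG j) cψ hψ.2.1
  have j2 := hint hu hAψ hψ.2.1.mul_left
  have j3 := hint hu (hψ.continuous_partialDeriv j) (hψ.hasCompactSupport_partialDeriv j)
  have j4 : IntegrableOn (fun x => partialDeriv j u x * ψ x) Ω := by
    refine ((j1.sub j2).const_mul Complex.I).congr ?_
    filter_upwards [ae_restrict_mem hΩ] with x hx
    simp only [Pi.sub_apply, h x hx]
    linear_combination (-(partialDeriv j u x * ψ x)) * Complex.I_sq
  have key : ∫ x, u x * partialDeriv j ψ x = -∫ x, partialDeriv j u x * ψ x :=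
    integral_mul_fderiv_eq_neg_fderiv_mul_of_integrable
      (hext j4 fun x hx => by simp [hψ0 x hx]) (hext j3 fun x hx => mul_eq_zero_of_right _ (hdψ0 x hx))
      (hext (hint hu cψ hψ.2.1) fun x hx => by simp [hψ0 x hx])
      (fun x hx => hd x (hψ.2.2 hx)) (fun x _ => (hψ.1.differentiable (by simp)) x)
  have k1 : ∫ x in Ω, u x * partialDeriv j ψ x = ∫ x, u x * partialDeriv j ψ x :=
    setIntegral_eq_integral_of_forall_compl_eq_zero fun x hx => by simp [hdψ0 x hx]
  have k2 : ∫ x in Ω, partialDeriv j u x * ψ x = ∫ x, partialDeriv j u x * ψ x :=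
    setIntegral_eq_integral_of_forall_compl_eq_zero fun x hx => by simp [hψ0 x hx]
  rw [← k1, ← k2] at key
  calc ∫ x in Ω, u x * (Complex.I * partialDeriv j ψ x + (A x j : ℂ) * ψ x)
      = ∫ x in Ω, (Complex.I * (u x * partialDeriv j ψ x) + u x * ((A x j : ℂ) * ψ x)) := by
        congr 1; ext x; ring
    _ = ∫ x in Ω, (-Complex.I * (partialDeriv j u x * ψ x) + u x * ((A x j : ℂ) * ψ x)) := by
        rw [integral_add (j3.const_mul _) j2, integral_add (j4.const_mul _) j2,
          integral_const_mul, integral_const_mul, key]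
        ring
    _ = ∫ x in Ω, G j x * ψ x := by
        refine setIntegral_congr_fun hΩ fun x hx => ?_
        simp only [h x hx]
        ring

theorem norm_sq_L2_eq (u : L2 Ω) : ‖u‖ ^ 2 = ∫ x in Ω, ‖u x‖ ^ 2 := by
  have h : ⟪u, u⟫ = ((∫ x in Ω, ‖u x‖ ^ 2 : ℝ) : ℂ) := by
    rw [L2.inner_def, ← integral_complex_ofReal]
    congr 1; ext x
    rw [inner_self_eq_norm_sq_to_K]
    simp
  rw [inner_self_eq_norm_sq_to_K] at h
  refine Complex.ofReal_injective (Eq.trans ?_ h)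
  simp

end ClassicalGradient

/-! ### The ground state and the sign of the first order term -/

section RadialGroundState

open Set Real

variable {R : ℝ} {l : ℝ} {g f φ : ℝ → ℝ}

/-- The case $v=1$, $m=0$ of `setIntegral_mul_radial`. -/
theorem integral_radial (hR : 1 ≤ R) {q : ℝ → ℝ} (hq : ContinuousOn q (Icc 1 R)) :
    ∫ x in annulus 1 R, q ‖x‖ = 2 * π * ∫ r in (1 : ℝ)..R, r * q r := by
  have h := setIntegral_mul_radial (R := R) (v := fun _ => 1) (ψ := fun r => (q r : ℂ))
    (memLp_const 1) (Complex.continuous_ofReal.comp_continuousOn hq) 0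
  have hm : ∀ r : ℝ, angularMode 0 (fun _ => 1) r = 1 := fun r => by
    simp [angularMode, Real.volume_real_Ioo_of_le (show -π ≤ π by linarith [pi_pos])]
    field_simp
    norm_num
  simp only [hm, one_mul, zpow_zero, mul_one, zero_add, zpow_one] at h
  rw [intervalIntegral.integral_of_le hR, integral_Ioc_eq_integral_Ioo]
  rw [integral_complex_ofReal] at h
  have h2 : ∫ r in Ioo 1 R, (r : ℂ) * (q r : ℂ) = ((∫ r in Ioo 1 R, r * q r : ℝ) : ℂ) := by
    rw [← integral_complex_ofReal]
    push_cast
    rfl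
  rw [h2, Complex.real_smul] at h
  exact_mod_cast h

/-- The magnetic gradient of `f(r) e^{-iθ}`, where `f' = f₁`. -/
def modeGradient (f f₁ : ℝ → ℝ) : Fin 2 → Plane → ℂ :=
  ![fun x => (x 0 * (-Complex.I * radialMode f₁ x) -
      x 1 * radialMode (fun r => (r / 2 - 1 / r) * f r) x) / ‖x‖,
    fun x => (x 1 * (-Complex.I * radialMode f₁ x) +
      x 0 * radialMode (fun r => (r / 2 - 1 / r) * f r) x) / ‖x‖]

theorem differentiableAt_radialMode {f₁ : ℝ → ℝ} {x : Plane} (hx : x ∈ annulus 1 R)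
    (hf : HasDerivAt f (f₁ ‖x‖) ‖x‖) : DifferentiableAt ℝ (radialMode f) x ∧
      ∀ j, modeGradient f f₁ j x =
        -Complex.I * partialDeriv j (radialMode f) x + (uniformPotential x j : ℂ) * radialMode f x := by
  have hn : 0 < ‖x‖ := zero_lt_one.trans hx.1
  have hnc : (‖x‖ : ℂ) ≠ 0 := by exact_mod_cast hn.ne'
  have hη := hf.div (hasDerivAt_id ‖x‖) hn.ne'
  obtain ⟨L, hL, hLx, hLr⟩ := hasFDerivAt_modeFunction (R := R) 1 hη hx
  -- Here $f(r)e^{-i\theta}=(f(r)/r)\,\bar z$, so the derivatives computed for mode functions apply;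
  -- the two Cartesian derivatives are then solved from those along $x$ and its rotation.
  have e : modeFunction 1 (f / id) = radialMode f := by
    ext y
    simp [modeFunction, radialMode, div_mul_eq_mul_div, mul_div_assoc]
  rw [e] at hL hLr
  refine ⟨hL.differentiableAt, fun j => ?_⟩
  have en : (‖x‖ : ℂ) ^ 2 = (x 0 : ℂ) ^ 2 + (x 1 : ℂ) ^ 2 := by exact_mod_cast norm_sq_plane x
  have e1 : x 0 * L (EuclideanSpace.single 0 1) + x 1 * L (EuclideanSpace.single 1 1) =
      ‖x‖ * radialMode f₁ x := by
    have : L x = x 0 * L (EuclideanSpace.single 0 1) + x 1 * L (EuclideanSpace.single 1 1) := by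
      conv_lhs => rw [plane_eq_sum x]
      simp
    rw [← this, hLx]
    simp [radialMode]
    field_simp
    ring
  have e2 : -(x 1) * L (EuclideanSpace.single 0 1) + x 0 * L (EuclideanSpace.single 1 1) =
      -Complex.I * radialMode f x := by
    have : L (rot x) = -(x 1) * L (EuclideanSpace.single 0 1) +
        x 0 * L (EuclideanSpace.single 1 1) := by
      conv_lhs => rw [rot_eq_sum x]
      simp
    rw [← this, hLr]
    simp
  have e3 : radialMode (fun r => (r / 2 - 1 / r) * f r) x =
      (‖x‖ / 2 - 1 / ‖x‖) * radialMode f x := by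
    simp [radialMode]; ring
  have e0 : uniformPotential x 0 = -(x 1) / 2 := rfl
  have e0' : uniformPotential x 1 = x 0 / 2 := rfl
  have hr2 : (‖x‖ : ℂ) ^ 2 ≠ 0 := pow_ne_zero 2 hnc
  have hL0 : L (EuclideanSpace.single 0 1) =
      (x 0 * (‖x‖ * radialMode f₁ x) + x 1 * (Complex.I * radialMode f x)) / ‖x‖ ^ 2 := by
    rw [eq_div_iff hr2, en]
    linear_combination (x 0 : ℂ) * e1 - (x 1 : ℂ) * e2
  have hL1 : L (EuclideanSpace.single 1 1) =
      (x 1 * (‖x‖ * radialMode f₁ x) - x 0 * (Complex.I * radialMode f x)) / ‖x‖ ^ 2 := by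
    rw [eq_div_iff hr2, en]
    linear_combination (x 1 : ℂ) * e1 + (x 0 : ℂ) * e2
  revert j
  refine Fin.forall_fin_two.2 ⟨?_, ?_⟩
  · rw [partialDeriv, hL.fderiv, hL0, e0, Complex.ofReal_div, Complex.ofReal_neg,
      Complex.ofReal_ofNat]
    change (x 0 * (-Complex.I * radialMode f₁ x) -
      x 1 * radialMode (fun r => (r / 2 - 1 / r) * f r) x) / ‖x‖ = _
    rw [e3]
    field_simp
    linear_combination (2 * radialMode f x * x 1) * Complex.I_sq
  · rw [partialDeriv, hL.fderiv, hL1, e0', Complex.ofReal_div, Complex.ofReal_ofNat]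
    change (x 1 * (-Complex.I * radialMode f₁ x) +
      x 0 * radialMode (fun r => (r / 2 - 1 / r) * f r) x) / ‖x‖ = _
    rw [e3]
    field_simp
    linear_combination (-2 * radialMode f x * x 0) * Complex.I_sq

theorem norm_sq_modeGradient (f f₁ : ℝ → ℝ) {x : Plane} (hx : x ∈ annulus 1 R) :
    ‖modeGradient f f₁ 0 x‖ ^ 2 + ‖modeGradient f f₁ 1 x‖ ^ 2 =
      f₁ ‖x‖ ^ 2 + ((‖x‖ / 2 - 1 / ‖x‖) * f ‖x‖) ^ 2 := by
  have hn : 0 < ‖x‖ := zero_lt_one.trans hx.1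
  have hx0 : x ≠ 0 := norm_pos_iff.1 hn
  have h1 := norm_radialMode f₁ hx0
  have h2 := norm_radialMode (fun r => (r / 2 - 1 / r) * f r) hx0
  rw [← sq_abs (f₁ ‖x‖), ← sq_abs ((‖x‖ / 2 - 1 / ‖x‖) * f ‖x‖), ← h1, ← h2]
  simp only [modeGradient, Matrix.cons_val_zero, Matrix.cons_val_one]
  generalize radialMode f₁ x = a
  generalize radialMode (fun r => (r / 2 - 1 / r) * f r) x = b
  rw [norm_div, norm_div, div_pow, div_pow, Complex.norm_real, norm_norm,
    ← add_div, div_eq_iff (by positivity), norm_sq_plane x]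
  simp only [← Complex.normSq_eq_norm_sq, Complex.normSq_apply]
  simp
  ring

/-- The potential is purely angular of size $r/2$, so only the angular component $(r/2-1/r)f$ of the
gradient contributes: $(r/2-1/r)(r/2)=r^2/4-1/2$. -/
theorem inner_modeGradient (f f₁ : ℝ → ℝ) {x : Plane} (hx : x ∈ annulus 1 R) :
    (⟪modeGradient f f₁ 0 x, (uniformPotential x 0 : ℂ) * radialMode f x⟫ +
      ⟪modeGradient f f₁ 1 x, (uniformPotential x 1 : ℂ) * radialMode f x⟫ : ℂ) =
      ((‖x‖ ^ 2 / 4 - 1 / 2) * f ‖x‖ ^ 2 : ℝ) := by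
  have hn : 0 < ‖x‖ := zero_lt_one.trans hx.1
  have hnc : (‖x‖ : ℂ) ≠ 0 := by exact_mod_cast hn.ne'
  have hx0 : x ≠ 0 := norm_pos_iff.1 hn
  have e0 : uniformPotential x 0 = -(x 1) / 2 := rfl
  have e0' : uniformPotential x 1 = x 0 / 2 := rfl
  have en : (‖x‖ : ℂ) ^ 2 = (x 0 : ℂ) ^ 2 + (x 1 : ℂ) ^ 2 := by exact_mod_cast norm_sq_plane x
  have h1 : (starRingEnd ℂ) (radialMode f x) * radialMode f x = (f ‖x‖ : ℂ) ^ 2 := by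
    rw [← Complex.normSq_eq_conj_mul_self, Complex.normSq_eq_norm_sq, norm_radialMode f hx0, sq_abs]
    push_cast
    rfl
  have e3 : radialMode (fun r => (r / 2 - 1 / r) * f r) x =
      ((‖x‖ / 2 - 1 / ‖x‖ : ℝ) : ℂ) * radialMode f x := by
    simp [radialMode]; ring
  rw [e0, e0']
  simp only [modeGradient, Matrix.cons_val_zero, Matrix.cons_val_one, e3, RCLike.inner_apply]
  push_cast
  rw [← h1]
  simp
  rw [show (starRingEnd ℂ) 2 = 2 from map_ofNat _ 2]
  field_simp
  linear_combination
    (-(4 * radialMode f x * (starRingEnd ℂ) (radialMode f x) * (‖x‖ ^ 2 - 2))) * en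

/-- The difference of the two integrands is the derivative of $rff'=f\cdot(fg)$, which vanishes at
both radii: the energy identity for an eigenfunction. -/
theorem IsRadialGroundState.integral_energy (H : IsRadialGroundState R l g f φ) (hR : 1 ≤ R) :
    ∫ r in (1 : ℝ)..R, r * ((φ r * f r) ^ 2 + ((r / 2 - 1 / r) * f r) ^ 2) =
      l * ∫ r in (1 : ℝ)..R, r * f r ^ 2 := by
  have hne : ∀ r ∈ Icc 1 R, r ≠ 0 := fun r hr => by linarith [hr.1]
  have hf := H.continuous
  have hφ := H.continuous_log_deriv
  have hc : ContinuousOn (fun r => r * ((φ r * f r) ^ 2 + ((r / 2 - 1 / r) * f r) ^ 2))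
      (Icc 1 R) := by fun_prop (disch := assumption)
  have hc' : Continuous fun r => l * (r * f r ^ 2) := by fun_prop
  have i1 := (hc.mono (uIcc_of_le hR).le).intervalIntegrable (μ := volume)
  have i2 := hc'.intervalIntegrable (μ := volume) 1 R
  rw [← intervalIntegral.integral_const_mul, ← sub_eq_zero, ← intervalIntegral.integral_sub i1 i2]
  have key := intervalIntegral.integral_eq_sub_of_hasDerivAt_of_le
    (f := fun r => f r * (f r * g r)) (f' := fun r => r * ((φ r * f r) ^ 2 +
      ((r / 2 - 1 / r) * f r) ^ 2) - l * (r * f r ^ 2)) hR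
    (hf.continuousOn.mul (hf.continuousOn.mul H.continuousOn_riccati)) (fun r hr => ?_) (i1.sub i2)
  · rw [key, H.left, H.right]
    ring
  · have h1 := (H.hasDerivAt r).mul (H.riccati.hasDerivAt_mul H.hasDerivAt H.log_deriv hr)
    convert! h1 using 1
    have hr' := Ioo_subset_Icc_self hr
    have hr0 := hne r hr'
    have : g r = φ r * r := by rw [H.log_deriv r hr']; field_simp
    rw [this]
    ring

/-- Here $R<\sqrt2$ decides the sign: the first order term is a positive multiple of $\int_1^R
r\,(r^2/4-1/2)f^2\,dr$, whose integrand is negative. -/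
theorem IsRadialGroundState.exists_formDomain_radialMode (H : IsRadialGroundState R l g f φ)
    (hR : 1 < R) (hR2 : R < √2) : ∃ w : formDomain (annulus 1 R) uniformPotential,
      formEmbedding (annulus 1 R) uniformPotential w =ᵐ[volume.restrict (annulus 1 R)]
        radialMode f ∧
      0 < ‖formEmbedding (annulus 1 R) uniformPotential w‖ ∧
      ‖formGradient (annulus 1 R) uniformPotential w‖ ^ 2 =
        l * ‖formEmbedding (annulus 1 R) uniformPotential w‖ ^ 2 ∧
      (⟪formGradient (annulus 1 R) uniformPotential w, formPotential R w⟫ : ℂ).re < 0 := by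
  have hΩ := (isOpen_annulus 1 R).measurableSet
  have hne : ∀ r ∈ Icc 1 R, r ≠ 0 := fun r hr => by linarith [hr.1]
  have hf := H.continuous
  have hφ := H.continuous_log_deriv
  set f₁ : ℝ → ℝ := fun r => φ r * f r with hf₁
  have hcβ : ContinuousOn (fun r => (r / 2 - 1 / r) * f r) (Icc 1 R) := by
    fun_prop (disch := assumption)
  have hu := memLp_radialMode (R := R) hf.continuousOn
  have hα := (memLp_radialMode (R := R) (f := f₁) (by fun_prop)).const_mul (-Complex.I)
  have hβ := memLp_radialMode hcβ
  have hG : ∀ j, MemLp (modeGradient f f₁ j) 2 (volume.restrict (annulus 1 R)) := by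
    refine Fin.forall_fin_two.2 ⟨?_, ?_⟩
    · convert! (memLp_radialPart (G := ![fun x => -Complex.I * radialMode f₁ x,
        -radialMode (fun r => (r / 2 - 1 / r) * f r)])
        (Fin.forall_fin_two.2 ⟨hα, hβ.neg⟩)).1 using 1
      ext x
      simp [modeGradient, radialPart]
      ring
    · convert! (memLp_radialPart (G := ![fun x => -(-Complex.I * radialMode f₁ x),
        radialMode (fun r => (r / 2 - 1 / r) * f r)])
        (Fin.forall_fin_two.2 ⟨hα.neg, hβ⟩)).2 using 1
      ext x
      simp [modeGradient, angularPart]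
      ring
  have hgrad : HasMagneticGradient (annulus 1 R) uniformPotential (hu.toLp _)
      fun j => (hG j).toLp _ :=
    hasMagneticGradient_toLp hΩ hu hG
      (fun x hx => (differentiableAt_radialMode (f₁ := f₁) hx (H.hasDerivAt _)).1)
      (fun x hx => (differentiableAt_radialMode (f₁ := f₁) hx (H.hasDerivAt _)).2)
  obtain ⟨w, hw, hw'⟩ := exists_formDomain_eq hgrad
  set J := formEmbedding (annulus 1 R) uniformPotential
  set N := formGradient (annulus 1 R) uniformPotential
  have E1 : ‖J w‖ ^ 2 = 2 * π * ∫ r in (1 : ℝ)..R, r * f r ^ 2 := by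
    rw [hw, norm_sq_L2_eq, ← integral_radial hR.le (by fun_prop)]
    refine integral_congr_ae ?_
    filter_upwards [hu.coeFn_toLp, ae_restrict_mem hΩ] with x h1 hx
    rw [h1, norm_radialMode f (norm_ne_zero_iff.1 (by linarith [hx.1])), sq_abs]
  have E2 : ‖N w‖ ^ 2 = l * ‖J w‖ ^ 2 := by
    have hc : ContinuousOn (fun r => f₁ r ^ 2 + ((r / 2 - 1 / r) * f r) ^ 2) (Icc 1 R) := by
      fun_prop (disch := assumption)
    have h1 : ‖N w‖ ^ 2 = 2 * π * ∫ r in (1 : ℝ)..R,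
        r * (f₁ r ^ 2 + ((r / 2 - 1 / r) * f r) ^ 2) := by
      rw [PiLp.norm_sq_eq_of_L2, Fin.sum_univ_two, hw', hw', norm_sq_L2_eq, norm_sq_L2_eq,
        ← integral_radial hR.le hc, ← integral_add ((Lp.memLp _).integrable_norm_pow (by norm_num))
          ((Lp.memLp _).integrable_norm_pow (by norm_num))]
      refine integral_congr_ae ?_
      filter_upwards [(hG 0).coeFn_toLp, (hG 1).coeFn_toLp, ae_restrict_mem hΩ] with x h1 h2 hx
      rw [h1, h2, norm_sq_modeGradient f f₁ hx]
    rw [h1, E1, H.integral_energy hR.le]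
    ring
  have E3 : (⟪N w, formPotential R w⟫ : ℂ).re < 0 := by
    have hc : Continuous fun r => (r ^ 2 / 4 - 1 / 2) * f r ^ 2 := by fun_prop
    have h1 : (⟪N w, formPotential R w⟫ : ℂ) =
        ((∫ x in annulus 1 R, (‖x‖ ^ 2 / 4 - 1 / 2) * f ‖x‖ ^ 2 : ℝ) : ℂ) := by
      rw [PiLp.inner_apply, Fin.sum_univ_two, hw', hw', formPotential_apply, formPotential_apply,
        L2.inner_def, L2.inner_def, ← integral_add (L2.integrable_inner _ _)
          (L2.integrable_inner _ _), ← integral_complex_ofReal]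
      refine integral_congr_ae ?_
      filter_upwards [(hG 0).coeFn_toLp, (hG 1).coeFn_toLp, hu.coeFn_toLp,
        potentialMul_ae 0 (J w), potentialMul_ae 1 (J w), ae_restrict_mem hΩ] with x h1 h2 h3 h4 h5 hx
      rw [h1, h2, h4, h5, hw, h3]
      exact inner_modeGradient f f₁ hx
    rw [h1, Complex.ofReal_re, integral_radial (q := fun r => (r ^ 2 / 4 - 1 / 2) * f r ^ 2) hR.le
      hc.continuousOn]
    have h2 := intervalIntegral.intervalIntegral_pos_of_pos_on (a := 1) (b := R)
      (f := fun r => -(r * ((r ^ 2 / 4 - 1 / 2) * f r ^ 2)))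
      (Continuous.intervalIntegrable (by fun_prop) _ _) (fun r hr => ?_) hR
    · rw [intervalIntegral.integral_neg] at h2
      nlinarith [pi_pos]
    · have h3 : r ^ 2 < 2 := by
        have := sq_le_two_of_le hR.le hR2 le_rfl
        nlinarith [hr.1, hr.2]
      have h4 := H.pos r
      have h5 : 0 < r := by linarith [hr.1]
      have : 0 < r * ((1 / 2 - r ^ 2 / 4) * f r ^ 2) := by
        have : 0 < 1 / 2 - r ^ 2 / 4 := by linarith
        positivity
      linarith
  have hpos : 0 < ‖J w‖ := by
    have : 0 < ‖J w‖ ^ 2 := by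
      rw [E1]
      have := intervalIntegral.intervalIntegral_pos_of_pos_on (a := 1) (b := R)
        (f := fun r => r * f r ^ 2) (Continuous.intervalIntegrable (by fun_prop) _ _)
        (fun r hr => mul_pos (by linarith [hr.1]) (pow_pos (H.pos r) 2)) hR
      positivity
    exact norm_pos_iff.2 fun h0 => by simp [h0] at this
  exact ⟨w, hw ▸ hu.coeFn_toLp, hpos, E2, E3⟩

/-- The ground state of the magnetic form of the annulus. -/
theorem IsRadialGroundState.exists_isGroundState (H : IsRadialGroundState R l g f φ) (hR : 1 < R)
    (hR2 : R < √2) : ∃ v₀ γ, IsGroundState (V := formDomain (annulus 1 R) uniformPotential)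
        (K := L2Field (annulus 1 R)) (formEmbedding (annulus 1 R) uniformPotential)
        (formGradient (annulus 1 R) uniformPotential) v₀ γ ∧
      (⟪formGradient (annulus 1 R) uniformPotential v₀, formPotential R v₀⟫ : ℂ).re < 0 := by
  obtain ⟨w, hw, hpos, E2, E3⟩ := H.exists_formDomain_radialMode hR hR2
  obtain ⟨γ, hγ, hgap⟩ := H.exists_annulus_gap hR hR2
  set J := formEmbedding (annulus 1 R) uniformPotential
  set N := formGradient (annulus 1 R) uniformPotential
  set a : ℝ := ‖J w‖⁻¹
  have ha : 0 < a := inv_pos.2 hpos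
  have hac : (a : ℂ) ≠ 0 := by exact_mod_cast ha.ne'
  refine ⟨(a : ℂ) • w, γ, ⟨?_, hγ, fun v => ?_⟩, ?_⟩
  · rw [map_smul, norm_smul, Complex.norm_real, Real.norm_of_nonneg ha.le,
      inv_mul_cancel₀ hpos.ne']
  · obtain ⟨c, hc⟩ := hgap _ _ (hasMagneticGradient_formGradient v)
    -- Division by $a$ undoes the normalisation of the ground state.
    refine ⟨c / a, ?_⟩
    have h1 : ‖N ((a : ℂ) • w)‖ ^ 2 = l := by
      rw [map_smul, norm_smul, Complex.norm_real, Real.norm_of_nonneg ha.le, mul_pow, E2]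
      simp only [a]
      field_simp
    have h2 : ‖J v - (c / a) • J ((a : ℂ) • w)‖ ^ 2 =
        ∫ x in annulus 1 R, ‖J v x - c * radialMode f x‖ ^ 2 := by
      rw [map_smul, smul_smul, div_mul_cancel₀ c hac, norm_sq_L2_eq]
      refine integral_congr_ae ?_
      filter_upwards [Lp.coeFn_sub (J v) (c • J w), Lp.coeFn_smul c (J w), hw] with x h1 h2 h3
      rw [h1, Pi.sub_apply, h2, Pi.smul_apply, h3, smul_eq_mul]
    have h3 : ‖N v‖ ^ 2 = (∫ x in annulus 1 R, ‖N v 0 x‖ ^ 2) + ∫ x in annulus 1 R, ‖N v 1 x‖ ^ 2 := by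
      rw [PiLp.norm_sq_eq_of_L2, Fin.sum_univ_two, norm_sq_L2_eq (N v 0), norm_sq_L2_eq (N v 1)]
    rw [h1, h2, h3, norm_sq_L2_eq (J v)]
    exact hc
  · rw [map_smul, map_smul, inner_smul_left, inner_smul_right, Complex.conj_ofReal,
      Complex.re_ofReal_mul, Complex.re_ofReal_mul]
    exact mul_neg_of_pos_of_neg ha (mul_neg_of_pos_of_neg ha E3)

end RadialGroundState

end MagneticNeumann

end

/-! ### Conclusion: derivative and monotonicity at $B=1$ -/

theorem theorem3p1 (Ro : ℝ) (hRo : 1 < Ro) (hRo' : Ro < Real.sqrt 2) :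
    (∃ d : ℝ, d < 0 ∧
      HasDerivAt (fun B : ℝ => MagneticNeumann.lowestSpec (MagneticNeumann.annulusOperator 1 Ro B))
        d 1) ∧
    ∃ ε : ℝ, 0 < ε ∧
      StrictAntiOn
        (fun B : ℝ => MagneticNeumann.lowestSpec (MagneticNeumann.annulusOperator 1 Ro B))
        (Set.Ioo (1 - ε) (1 + ε)) := by
  obtain ⟨l, g, f, φ, H⟩ := MagneticNeumann.exists_isRadialGroundState hRo hRo'
  obtain ⟨v₀, γ, hv, hneg⟩ := H.exists_isGroundState hRo hRo'
  have hm : 0 ≤ 2 * |Ro| := by positivity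
  have hd := hv.hasDerivAt_rayleighBottom hm MagneticNeumann.norm_formPotential_le
  obtain ⟨ε, hε, hanti⟩ :=
    hv.exists_strictAntiOn_rayleighBottom hm MagneticNeumann.norm_formPotential_le hneg
  have hspec : ∀ B : ℝ, MagneticNeumann.lowestSpec (MagneticNeumann.annulusOperator 1 Ro B) = _ :=
    fun B => (congrArg (fun t => MagneticNeumann.lowestSpec
      (MagneticNeumann.annulusOperator 1 Ro t)) (add_sub_cancel 1 B).symm).trans
        (MagneticNeumann.lowestSpec_annulusOperator Ro (B - 1) ⟨v₀, hv.norm_eq⟩)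
  simp only [hspec]
  -- Perturbation theory is stated at $s=0$; with $s=B-1$ the base point is written as $1-1$ so that
  -- the translation lemma applies.
  rw [← sub_self (1 : ℝ)] at hd
  refine ⟨⟨_, mul_neg_of_pos_of_neg two_pos hneg, hd.comp_sub_const 1 1⟩, ε, hε, ?_⟩
  intro a ha b hb hab
  exact hanti ⟨by linarith [ha.1], by linarith [ha.2]⟩ ⟨by linarith [hb.1], by linarith [hb.2]⟩
    (sub_lt_sub_right hab 1)
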